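/- Let $k$ be a field and let $0\le t\le n$ be integers. Let $B$ be a PBW algebra over $k$ on generators $x_1,\dots,x_n$: that is, $B$ is an associative unital $k$-algebra with elements $x_1,\dots,x_n\in B$, an admissible order $<$ on $\mathbb{N}^n$ (a total well-order such that $\alpha<\beta$ implies $\alpha+\gamma<\beta+\gamma$) and scalars $q_{ij}\in k^{*}$ $(1\le i<j\le n)$ such that 1. the monomials $x^\alpha=x_1^{\alpha_1}\cdots x_n^{\alpha_n}$, $\alpha\in\mathbb{N}^n$, form a $k$-basis of $B$; 2. for $i<j$ one has $x_ix_j=q_{ij}x_jx_i+p_{ij}$, where $p_{ij}\in B$ is a linear combination of monomials $x^\alpha$ with $\alpha<e_i+e_j$ ($e_i$ being the $i$-th unit vector). Put $q_{ji}=q_{ij}^{-1}$ for $i<j$ and $q_{ii}=1$. A monomial $x^a$ is said to be in the braided center of $B$ if $$x^a x^b=\Big(\prod_{r<l}q_{lr}^{-(b_la_r-b_ra_l)}\Big)\,x^b x^a\qquad\text{for all } b\in\mathbb{N}^n .$$ Let $N_1,\dots,N_t>1$ be integers such that $x_i^{N_i}$ is in the braided center of $B$ for every $1\le i\le t$, and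 let $A=B/(x_1^{N_1},\dots,x_t^{N_t})$ be the quotient by the two-sided ideal generated by these powers. Suppose that $A$ is augmented by a $k$-algebra homomorphism $\varepsilon:A\to k$ with $\varepsilon(x_i)=0$ for all $1\le i\le n$, and regard $k$ as an $A$-module via $\varepsilon$. Then the cohomology algebra $$H^*(A,k)=\bigoplus_{r\ge 0}\mathrm{Ext}_A^r(k,k),$$ with the Yoneda product, is finitely generated as a $k$-algebra. -/

import Mathlib

open CategoryTheory CategoryTheory.Abelian
open scoped DirectSum

universe u o

noncomputable section

/-! ### PBW algebras -/

namespace PBW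

variable {k : Type*} [Field k] {R : Type*} [Ring R] [Algebra k R] {n : ℕ}

/-- The ordered monomial `x₁ ^ α₁ * ⋯ * xₙ ^ αₙ` (factors in increasing order of the index). -/
def monomial (x : Fin n → R) (α : Fin n →₀ ℕ) : R :=
  (List.ofFn fun i => x i ^ α i).prod

/-- `R` is a PBW algebra over `k` on the elements `x₁, …, xₙ`, with respect to the admissible
order `m` on `ℕⁿ` (a total well-order compatible with addition) and the scalars `q i j ∈ kˣ`.
The scalars given for `i < j` are extended to all pairs by `q j i = (q i j)⁻¹`, `q i i = 1`. -/
structure IsPBWAlgebra (x : Fin n → R) (m : MonomialOrder (Fin n)) (q : Fin n → Fin n → kˣ) :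
    Prop where
  q_self : ∀ i, q i i = 1
  q_inv : ∀ i j, q j i = (q i j)⁻¹
  /-- The ordered monomials form a `k`-basis of `R`. -/
  linearIndependent : LinearIndependent k (monomial x)
  span_eq_top : Submodule.span k (Set.range (monomial x)) = ⊤
  /-- For `i < j` one has `x i * x j = q i j • (x j * x i) + p i j`, where `p i j` is a linear
  combination of ordered monomials whose exponents are smaller than the exponent of `x i * x j`. -/
  commutation : ∀ i j, i < j →
    x i * x j - (q i j : k) • (x j * x i) ∈ Submodule.span k
      (monomial x '' {α | m.toSyn α < m.toSyn (Finsupp.single i 1 + Finsupp.single j 1)})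

/-- The braided commutator `[x^a, x^b]_c = x^a x^b - (∏_{r < l} q_{l r}^{-(b_l a_r - b_r a_l)}) x^b x^a`
of two ordered monomials. -/
def braidedCommutator (x : Fin n → R) (q : Fin n → Fin n → kˣ) (a b : Fin n →₀ ℕ) : R :=
  monomial x a * monomial x b -
    ((∏ r : Fin n, ∏ l ∈ Finset.Ioi r,
        q l r ^ (-((b l : ℤ) * (a r : ℤ) - (b r : ℤ) * (a l : ℤ))) : kˣ) : k) •
      (monomial x b * monomial x a)

/-- The ordered monomial `x^a` lies in the braided center: its braided commutator with every
ordered monomial vanishes. -/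
def MemBraidedCenter (x : Fin n → R) (q : Fin n → Fin n → kˣ) (a : Fin n →₀ ℕ) : Prop :=
  ∀ b : Fin n →₀ ℕ, braidedCommutator x q a b = 0

/-- The two-sided ideal `(x₁ ^ N₁, …, x_t ^ N_t)`, where `t ≤ n`. -/
def powerIdeal {t : ℕ} (ht : t ≤ n) (x : Fin n → R) (N : Fin t → ℕ) : TwoSidedIdeal R :=
  TwoSidedIdeal.span (Set.range fun i : Fin t => x (Fin.castLE ht i) ^ N i)

/-- The quotient algebra `R / (x₁ ^ N₁, …, x_t ^ N_t)`. -/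
abbrev PowerQuotient {t : ℕ} (ht : t ≤ n) (x : Fin n → R) (N : Fin t → ℕ) : Type _ :=
  (powerIdeal ht x N).ringCon.Quotient

/-- The class of `r` in `R / (x₁ ^ N₁, …, x_t ^ N_t)`. -/
abbrev PowerQuotient.mk {t : ℕ} (ht : t ≤ n) (x : Fin n → R) (N : Fin t → ℕ) (r : R) :
    PowerQuotient ht x N :=
  (powerIdeal ht x N).ringCon.mk' r

end PBW

/-! ### The Ext algebra of an object of a linear abelian category -/

namespace ExtAlg

universe w v c s

variable {C : Type c} [Category.{v} C] [Abelian C] [HasExt.{w} C]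

/-- The graded pieces `Ext^r(X, X)`. -/
abbrev SelfExt (X : C) (r : ℕ) : Type w := Ext X X r

theorem mk_comp {X : C} {a b c d : ℕ} (α : SelfExt X a) (β : SelfExt X b)
    (h : a + b = c) (h' : a + b = d) :
    GradedMonoid.mk (A := SelfExt X) c (α.comp β h) = GradedMonoid.mk d (α.comp β h') := by
  subst h
  subst h'
  rfl

/-- The unit of `Ext^*(X, X)`: the identity of `X`, in degree `0`. -/
instance gone (X : C) : GradedMonoid.GOne (SelfExt X) where
  one := Ext.mk₀ (𝟙 X)

/-- The Yoneda product `Ext^a(X, X) × Ext^b(X, X) → Ext^(a + b)(X, X)`. -/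
instance gmul (X : C) : GradedMonoid.GMul (SelfExt X) where
  mul {_ _} α β := α.comp β rfl

instance gmonoid (X : C) : GradedMonoid.GMonoid (SelfExt X) where
  one_mul := fun ⟨a, α⟩ =>
    (mk_comp (Ext.mk₀ (𝟙 X)) α rfl (zero_add a)).trans
      (congrArg (GradedMonoid.mk (A := SelfExt X) a) (Ext.mk₀_id_comp α))
  mul_one := fun ⟨a, α⟩ =>
    congrArg (GradedMonoid.mk (A := SelfExt X) a) (Ext.comp_mk₀_id α)
  mul_assoc := fun ⟨a, α⟩ ⟨b, β⟩ ⟨c, γ⟩ =>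
    (mk_comp (α.comp β rfl) γ rfl (add_assoc a b c)).trans
      (congrArg (GradedMonoid.mk (A := SelfExt X) (a + (b + c)))
        (Ext.comp_assoc α β γ rfl rfl (add_assoc a b c)))

/-- The Yoneda product makes `⨁ r, Ext^r(X, X)` a graded ring. -/
instance gring (X : C) : DirectSum.GRing (SelfExt X) where
  __ := gmonoid X
  mul_zero _ := Ext.comp_zero _ _ _ _ _
  zero_mul β := Ext.zero_comp X _ β _ rfl
  mul_add _ _ _ := Ext.comp_add _ _ _ _
  add_mul _ _ _ := Ext.add_comp _ _ _ _
  natCast r := r • Ext.mk₀ (𝟙 X)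
  natCast_zero := zero_smul _ _
  natCast_succ r := succ_nsmul _ r
  intCast z := z • Ext.mk₀ (𝟙 X)
  intCast_ofNat r := natCast_zsmul _ r
  intCast_negSucc_ofNat r := negSucc_zsmul _ r

/-- The `k`-algebra structure on `⨁ r, Ext^r(X, X)` for an object `X` of a `k`-linear category. -/
instance galgebra (k : Type s) [Field k] [Linear k C] (X : C) :
    DirectSum.GAlgebra k (SelfExt X) where
  toFun :=
    { toFun := fun c => c • Ext.mk₀ (𝟙 X)
      map_zero' := zero_smul _ _
      map_add' := fun _ _ => add_smul _ _ _ }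
  map_one := one_smul _ _
  map_mul c d := by
    refine congrArg (GradedMonoid.mk (A := SelfExt X) 0) ?_
    change (c * d) • Ext.mk₀ (𝟙 X) = (c • Ext.mk₀ (𝟙 X)).comp (d • Ext.mk₀ (𝟙 X)) (add_zero 0)
    rw [Ext.smul_comp, Ext.comp_smul, Ext.comp_mk₀_id, mul_smul]
  commutes c := fun ⟨a, α⟩ => by
    refine (mk_comp (c • Ext.mk₀ (𝟙 X)) α rfl (zero_add a)).trans
      (congrArg (GradedMonoid.mk (A := SelfExt X) a) ?_)
    change _ = α.comp (c • Ext.mk₀ (𝟙 X)) (add_zero a)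
    rw [Ext.smul_comp, Ext.comp_smul, Ext.comp_mk₀_id, Ext.mk₀_id_comp]
  smul_def c := fun ⟨a, α⟩ => by
    refine Eq.trans (congrArg (GradedMonoid.mk (A := SelfExt X) a) ?_)
      (mk_comp (c • Ext.mk₀ (𝟙 X)) α (zero_add a) rfl)
    change c • α = _
    rw [Ext.smul_comp, Ext.mk₀_id_comp]

end ExtAlg

/-- The trivial module of an augmented `k`-algebra `(A, ε)`: the field `k`, on which `a ∈ A` acts
as multiplication by `ε a`. -/
abbrev trivialModule {k A : Type u} [Field k] [Ring A] [Algebra k A] (ε : A →ₐ[k] k) :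
    ModuleCat.{u} A :=
  (ModuleCat.restrictScalars ε.toRingHom).obj (ModuleCat.of.{u} k k)

/-- The cohomology algebra `H^*(A, k) = ⨁ r, Ext_A^r(k, k)` of an augmented `k`-algebra `(A, ε)`,
with the Yoneda product. -/
abbrev CohomologyAlgebra {k A : Type u} [Field k] [Ring A] [Algebra k A] (ε : A →ₐ[k] k) : Type u :=
  ⨁ r, ExtAlg.SelfExt (trivialModule ε) r

end

/-! The algebra `A` has a basis of ordered monomials in which `x i` occurs to a power below `N i`
for the truncated variables. Up to nonzero scalars and smaller terms, they multiply as in the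
commutative ring `k[x₁, …, xₙ]/(xᵢ ^ Nᵢ)`. Over that ring the trivial module has a classical
resolution, the tensor product of the one-variable periodic ones. Its free generators, the cells
`e_δ`, have degrees with each `δ i` congruent to `0` or `1` modulo `N i`, and equal to `0` or `1`
for an untruncated variable. Its exactness comes from a matching of the elements `x^α e_δ`, and the
matching is triangular for a well-order that compares `α + δ` first. Hence it survives the passage
to `A`: there is a resolution on the same cells whose boundary does not raise the total degree `α +
δ` (`MonomialAlgebra.exists_resolution`).

For each truncated variable, the coefficient of `xᵢ ^ Nᵢ` in the product of two normal forms is a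
Hochschild `2`-cocycle with trivial coefficients (`IsPBWAlgebra.powerCocycle`). Braided centrality
enters twice: it makes the span of the monomials divisible by a power a two-sided ideal, and it
makes the coefficient functional on this ideal a bimodule map to the trivial module. The cocycle
lifts to a chain map of degree `2` that lowers the total degree by `Nᵢ eᵢ`. The coefficient of `e_δ`
in the image of the cell of degree `δ + Nᵢ eᵢ` never vanishes (`IsResolution.cof_shift_ne_zero`),
because no coefficient of a face in a boundary vanishes (`IsResolution.cof_ne_zero`).

Every class in `Ext^r(k, k)` comes from a morphism from the `r`-th syzygy to `k`. Its leading cell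
is the smallest cell on which it is nonzero, and multiplication by the `i`-th class of degree `2`
moves the leading cell by exactly `Nᵢ eᵢ`. By Dickson's lemma all leading cells arise in this way
from finitely many. The corresponding classes and those of degree `2` then generate the algebra, by
cancelling leading terms (`Tower.finiteType_of_isLead`). Neither minimality of the resolution nor
commutativity of the operators is needed. -/

noncomputable section

/-! ### Yoneda products and syzygies -/

namespace Syzygy

universe w v c s

variable {C : Type c} [Category.{v} C] [Abelian C] [HasExt.{w} C]

/-- A sequence of syzygies `K (r + 1) → P r → K r` with projective middle terms. -/
structure Tower (C : Type c) [Category.{v} C] [Abelian C] where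
  K : ℕ → C
  P : ℕ → C
  i : ∀ r, K (r + 1) ⟶ P r
  p : ∀ r, P r ⟶ K r
  w : ∀ r, i r ≫ p r = 0
  exact : ∀ r, (ShortComplex.mk (i r) (p r) (w r)).ShortExact
  projective : ∀ r, Projective (P r)

variable (R : Tower C)

/-- The class in `Ext^r(K 0, K r)` of the exact sequence of syzygies. -/
def Tower.cls : ∀ r, Ext.{w} (R.K 0) (R.K r) r
  | 0 => Ext.mk₀ (𝟙 _)
  | r + 1 => (Tower.cls r).comp (R.exact r).extClass rfl

/-- Dimension shifting: positive Ext groups out of a projective vanish, so each connecting map is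
onto and one extension class can be split off at a time. -/
theorem Tower.exists_eq_cls_comp {Y : C} (s : ℕ) : ∀ (j r : ℕ) (h : s + j = r)
    (y : Ext.{w} (R.K 0) Y r), ∃ y' : Ext (R.K s) Y j, (R.cls s).comp y' h = y := by
  induction s with
  | zero =>
    intro j r h y
    obtain rfl : j = r := by omega
    exact ⟨y, Ext.mk₀_id_comp y⟩
  | succ s ih =>
    intro j r h y
    obtain ⟨y', rfl⟩ := ih (1 + j) r (by omega) y
    have := R.projective s
    obtain ⟨y'', rfl⟩ := Ext.contravariant_sequence_exact₃ (R.exact s) Y (n₀ := j) y'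
      (by
        -- `Ext.eq_zero_of_projective` needs the degree in successor form. The class is generalized
        -- so that its degree can be rewritten.
        obtain ⟨l, hl⟩ : ∃ l, 1 + j = l + 1 := ⟨j, by omega⟩
        generalize hz : (Ext.mk₀ (ShortComplex.mk (R.i s) (R.p s) (R.w s)).g).comp y'
          (zero_add (1 + j)) = z
        clear hz
        revert z
        rw [hl]
        intro z
        exact Ext.eq_zero_of_projective (P := R.P s) z) rfl
    exact ⟨y'', Ext.comp_assoc _ _ _ _ _ (by omega)⟩

theorem Tower.exists_eq_cls_comp_mk₀ {Y : C} (r : ℕ) (y : Ext.{w} (R.K 0) Y r) :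
    ∃ α : R.K r ⟶ Y, (R.cls r).comp (Ext.mk₀ α) (add_zero r) = y := by
  obtain ⟨y', rfl⟩ := R.exists_eq_cls_comp r 0 r (add_zero r) y
  exact ⟨Ext.homEquiv₀ y', by rw [Ext.mk₀_homEquiv₀_apply]⟩

/-- A degree `2` endomorphism of the tower: maps of syzygies `K (r + 2) → K r` compatible with the
short exact sequences. -/
structure Tower.Shift where
  g : ∀ r, R.K (r + 2) ⟶ R.K r
  X : ∀ r, R.P (r + 2) ⟶ R.P r
  comm_i : ∀ r, R.i (r + 2) ≫ X r = g (r + 1) ≫ R.i r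
  comm_p : ∀ r, R.p (r + 2) ≫ g r = X r ≫ R.p r

variable {R}

/-- The class in `Ext^2(K 0, K 0)` of a degree `2` endomorphism of the tower. -/
def Tower.Shift.cls (G : R.Shift) : Ext.{w} (R.K 0) (R.K 0) 2 :=
  (R.cls 2).comp (Ext.mk₀ (G.g 0)) (add_zero 2)

/-- Naturality of the extension class, applied to the morphism of short exact sequences formed by `g
(r + 1)`, `X r` and `g r`, carries the identity from one syzygy to the next. -/
theorem Tower.Shift.cls_comp (G : R.Shift) (r : ℕ) (h : 2 + r = r + 2) :
    G.cls.comp (R.cls r) h = (R.cls.{w} (r + 2)).comp (Ext.mk₀ (G.g r)) (add_zero _) := by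
  induction r with
  | zero => exact Ext.comp_mk₀_id _
  | succ r ih =>
    have hnat := ShortComplex.ShortExact.extClass_naturality (R.exact (r + 2)) (R.exact r)
      { τ₁ := G.g (r + 1), τ₂ := G.X r, τ₃ := G.g r, comm₁₂ := (G.comm_i r).symm,
        comm₂₃ := (G.comm_p r).symm }
    have e1 : G.cls.comp (R.cls (r + 1)) h =
        (G.cls.comp (R.cls r) (by omega)).comp (R.exact r).extClass rfl :=
      (Ext.comp_assoc _ _ _ _ rfl (by omega)).symm
    rw [e1, ih (by omega)]
    have e2 : (R.cls (r + 1 + 2)).comp (Ext.mk₀ (G.g (r + 1))) (add_zero _) =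
        (R.cls (r + 2)).comp ((R.exact (r + 2)).extClass.comp (Ext.mk₀ (G.g (r + 1)))
          (add_zero 1)) rfl :=
      Ext.comp_assoc _ _ _ _ _ (by omega)
    rw [e2]
    erw [hnat]
    exact Ext.comp_assoc _ _ _ _ _ (by omega)

theorem Tower.Shift.cls_comp_comp (G : R.Shift) (r : ℕ) {Y : C} (α : R.K r ⟶ Y)
    (h : 2 + r = r + 2) :
    G.cls.comp ((R.cls r).comp (Ext.mk₀ α) (add_zero r)) h =
      (R.cls.{w} (r + 2)).comp (Ext.mk₀ (G.g r ≫ α)) (add_zero _) := by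
  rw [← Ext.comp_assoc (a₁₂ := r + 2) _ _ _ h (add_zero r) (by omega), G.cls_comp r h,
    Ext.comp_assoc (a₂₃ := 0) _ _ _ _ (add_zero 0) (by omega), Ext.mk₀_comp_mk₀]

/-! ### A criterion for finite generation -/

section Generation

variable {k : Type s} [Field k] [Linear k C] {Ω : Type*} [LinearOrder Ω]

/-- `ω` is the smallest element of the support of `f`. -/
def IsLead (f : Ω → k) (ω : Ω) : Prop :=
  f ω ≠ 0 ∧ ∀ ω' < ω, f ω' = 0

theorem exists_isLead {f : Ω → k} (hf : f ≠ 0) {F : Set Ω} (hF : F.Finite)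
    (h : ∀ ω, f ω ≠ 0 → ω ∈ F) : ∃ ω, IsLead f ω := by
  have hfin : {ω | f ω ≠ 0}.Finite := hF.subset h
  obtain ⟨ω₀, h₀⟩ := Function.ne_iff.mp hf
  obtain ⟨ω, hω, hmin⟩ := Set.exists_min_image _ id hfin ⟨ω₀, h₀⟩
  exact ⟨ω, hω, fun ω' hlt => by_contra fun hne => (hmin ω' hne).not_gt hlt⟩

variable (R) in
/-- The element of the Ext algebra represented by a morphism `K r ⟶ K 0`. -/
def Tower.rep (r : ℕ) (α : R.K r ⟶ R.K 0) : ⨁ r, ExtAlg.SelfExt.{w} (R.K 0) r :=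
  DirectSum.of (ExtAlg.SelfExt.{w} (R.K 0)) r ((R.cls r).comp (Ext.mk₀ α) (add_zero r))

theorem Tower.rep_add (r : ℕ) (α β : R.K r ⟶ R.K 0) :
    R.rep.{w} r (α + β) = R.rep r α + R.rep r β := by
  rw [Tower.rep, Ext.mk₀_add, Ext.comp_add, map_add]
  rfl

theorem Tower.rep_smul (r : ℕ) (a : k) (α : R.K r ⟶ R.K 0) :
    R.rep.{w} r (a • α) = a • R.rep r α := by
  rw [Tower.rep, Ext.mk₀_smul, Ext.comp_smul, ← DirectSum.lof_eq_of k,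
    map_smul, DirectSum.lof_eq_of]
  rfl

/-- This reduces Yoneda products with the degree `2` classes to composition of morphisms, where
leading terms can be followed. -/
theorem Tower.Shift.of_cls_mul_rep (G : R.Shift) (r : ℕ) (α : R.K r ⟶ R.K 0) :
    DirectSum.of (ExtAlg.SelfExt.{w} (R.K 0)) 2 G.cls * R.rep r α =
      R.rep (r + 2) (G.g r ≫ α) := by
  rw [Tower.rep, DirectSum.of_mul_of, Tower.rep, ← G.cls_comp_comp r α (by omega)]
  exact DirectSum.of_eq_of_gradedMonoid_eq (ExtAlg.mk_comp _ _ _ _)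

/-- A subduction argument: some element of the subalgebra has any given leading position, so leading
terms can be cancelled one after another. This stops because each degree has only finitely many
positions. -/
theorem Tower.finiteType_of_isLead [AddCommMonoid Ω] {ι : Type*} [Finite ι] (G : ι → R.Shift) (ν : ι → Ω)
    (ev : ∀ r, (R.K r ⟶ R.K 0) →ₗ[k] (Ω → k)) (hinj : ∀ r α, ev r α = 0 → α = 0)
    (F : ℕ → Set Ω) (hF : ∀ r, (F r).Finite) (hdisj : ∀ r r' ω, ω ∈ F r → ω ∈ F r' → r = r')
    (hev : ∀ r α ω, ev r α ω ≠ 0 → ω ∈ F r)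
    (hshift : ∀ i r α ω, IsLead (ev r α) ω → IsLead (ev (r + 2) ((G i).g r ≫ α)) (ω + ν i))
    (hdickson : ∀ L : Set Ω, L ⊆ ⋃ r, F r → ∃ M ⊆ L, M.Finite ∧
      ∀ ω ∈ L, ∃ ω₀ ∈ M, ∃ z ∈ AddSubmonoid.closure (Set.range ν), ω = ω₀ + z) :
    Algebra.FiniteType k (⨁ r, ExtAlg.SelfExt.{w} (R.K 0) r) := by
  classical
  obtain ⟨M, hML, hMfin, hM⟩ := hdickson {ω | ∃ r α, IsLead (ev r α) ω} (by
    rintro ω ⟨r, α, h⟩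
    exact Set.mem_iUnion.mpr ⟨r, hev r α ω h.1⟩)
  have hML' : ∀ ω ∈ M, ∃ r α, IsLead (ev r α) ω := fun ω hω => hML hω
  choose r₀ α₀ h₀ using hML'
  -- One representative for each basic leading position, together with the degree `2` classes.
  let S : Set (⨁ r, ExtAlg.SelfExt.{w} (R.K 0) r) :=
    (Set.range fun ω : M => R.rep (r₀ ω ω.2) (α₀ ω ω.2)) ∪
      Set.range fun i => DirectSum.of (ExtAlg.SelfExt.{w} (R.K 0)) 2 (G i).cls
  have := hMfin.to_subtype
  have hS : S.Finite := (Set.finite_range _).union (Set.finite_range _)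
  have key : ∀ z ∈ AddSubmonoid.closure (Set.range ν), ∀ ω r α, IsLead (ev r α) ω →
      R.rep r α ∈ Algebra.adjoin k S →
      ∃ r' α', IsLead (ev r' α') (ω + z) ∧ R.rep r' α' ∈ Algebra.adjoin k S := by
    intro z hz
    induction hz using AddSubmonoid.closure_induction with
    | mem z hz =>
      obtain ⟨i, rfl⟩ := hz
      intro ω r α hα hmem
      refine ⟨_, _, hshift i r α ω hα, ?_⟩
      rw [← (G i).of_cls_mul_rep]
      exact mul_mem (Algebra.subset_adjoin (Or.inr ⟨i, rfl⟩)) hmem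
    | zero =>
      intro ω r α hα hmem
      exact ⟨r, α, by rwa [add_zero], hmem⟩
    | add x y _ _ hx hy =>
      intro ω r α hα hmem
      obtain ⟨r', α', h', hm'⟩ := hx ω r α hα hmem
      obtain ⟨r'', α'', h'', hm''⟩ := hy _ r' α' h' hm'
      exact ⟨r'', α'', by rwa [← add_assoc], hm''⟩
  have hlead : ∀ r α ω, IsLead (ev r α) ω →
      ∃ β, IsLead (ev r β) ω ∧ R.rep r β ∈ Algebra.adjoin k S := by
    intro r α ω hα
    obtain ⟨ω₀, hω₀, z, hz, rfl⟩ := hM ω ⟨r, α, hα⟩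
    obtain ⟨r', β, hβ, hmem⟩ := key z hz ω₀ _ _ (h₀ _ hω₀)
      (Algebra.subset_adjoin (Or.inl ⟨⟨ω₀, hω₀⟩, rfl⟩))
    -- The product built by `key` has the right cohomological degree because a position determines
    -- its degree.
    obtain rfl := hdisj r r' _ (hev _ _ _ hα.1) (hev _ _ _ hβ.1)
    exact ⟨β, hβ, hmem⟩
  -- Induction on the number of positions not below the leading one. It drops at each cancellation.
  have hall : ∀ r (c : ℕ) α ω, IsLead (ev r α) ω → ((hF r).toFinset.filter (ω ≤ ·)).card ≤ c →
      R.rep r α ∈ Algebra.adjoin k S := by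
    intro r c
    induction c with
    | zero =>
      intro α ω hα hc
      rw [Nat.le_zero, Finset.card_eq_zero] at hc
      have : ω ∈ (hF r).toFinset.filter (ω ≤ ·) := by simpa using hev _ _ _ hα.1
      simp [hc] at this
    | succ c ih =>
      intro α ω hα hc
      obtain ⟨β, hβ, hmem⟩ := hlead r α ω hα
      let a : k := ev r α ω / ev r β ω
      have hsplit : R.rep.{w} r α = R.rep r (α - a • β) + a • R.rep r β := by
        rw [← Tower.rep_smul, ← Tower.rep_add, sub_add_cancel]
      rw [hsplit]
      refine add_mem ?_ (Subalgebra.smul_mem _ hmem a)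
      by_cases h0 : α - a • β = 0
      · rw [h0, ← zero_smul k (0 : R.K r ⟶ R.K 0), Tower.rep_smul, zero_smul]
        exact zero_mem _
      obtain ⟨ω', hω'⟩ := exists_isLead (fun h => h0 (hinj r _ h)) (hF r) (hev r _)
      have hle : ∀ ω'' ≤ ω, ev r (α - a • β) ω'' = 0 := by
        intro ω'' hle
        rw [map_sub, map_smul, Pi.sub_apply, Pi.smul_apply, smul_eq_mul]
        rcases hle.lt_or_eq with hlt | rfl
        · rw [hα.2 _ hlt, hβ.2 _ hlt, mul_zero, sub_zero]
        · rw [div_mul_cancel₀ _ hβ.1, sub_self]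
      have hlt : ω < ω' := not_le.mp fun h => hω'.1 (hle _ h)
      refine ih _ ω' hω' (Nat.le_of_lt_succ (lt_of_lt_of_le (Finset.card_lt_card ?_) hc))
      refine Finset.ssubset_iff_subset_ne.mpr ⟨fun x hx => ?_, fun h => ?_⟩
      · rw [Finset.mem_filter] at hx ⊢
        exact ⟨hx.1, hlt.le.trans hx.2⟩
      · have : ω ∈ (hF r).toFinset.filter (ω ≤ ·) := by simpa using hev _ _ _ hα.1
        rw [← h, Finset.mem_filter] at this
        exact hlt.not_ge this.2
  refine ⟨Subalgebra.fg_def.mpr ⟨S, hS, eq_top_iff.mpr fun y _ => ?_⟩⟩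
  induction y using DirectSum.induction_on with
  | zero => exact zero_mem _
  | add x y hx hy => exact add_mem (hx trivial) (hy trivial)
  | of r y =>
    obtain ⟨α, rfl⟩ := R.exists_eq_cls_comp_mk₀ r y
    by_cases h0 : α = 0
    · rw [h0, Ext.mk₀_zero, Ext.comp_zero, map_zero]
      exact zero_mem _
    obtain ⟨ω, hω⟩ := exists_isLead (fun h => h0 (hinj r _ h)) (hF r) (hev r _)
    exact hall r _ α ω hω le_rfl

end Generation

end Syzygy

/-! ### Cells of the Anick resolution -/

namespace Anick

open Finsupp

/-- The size of the step that leads down from a one-variable cell of degree `d`, for the truncation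
exponent `M` (`0` stands for no truncation). -/
def step (M d : ℕ) : ℕ := if d % M = 0 then M - 1 else 1

/-- The pair `(a, d)` of a one-variable exponent and a one-variable cell is the one with the larger
cell among the pairs of the same total degree. -/
def Top (M a d : ℕ) : Prop := (d % M = 1 ∧ (M = 0 ∨ a + 1 < M)) ∨ (d % M = 0 ∧ a = 0)

/-! ### The periodic resolution in one variable. -/

section OneVariable

variable {M a d : ℕ}

theorem eq_mul_of_mod_eq_zero (h : d % M = 0) : ∃ q, d = M * q :=
  Nat.dvd_of_mod_eq_zero h

theorem le_of_mod_eq_zero (hd : 0 < d) (h : d % M = 0) : M ≤ d :=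
  Nat.le_of_dvd hd (Nat.dvd_of_mod_eq_zero h)

theorem step_le (hd : 0 < d) : step M d ≤ d := by
  unfold step
  split_ifs with h
  · have := le_of_mod_eq_zero hd h
    omega
  · omega

theorem step_pos (hM : M ≠ 1) (hd : 0 < d) : 0 < step M d := by
  unfold step
  split_ifs with h
  · have : M ≠ 0 := by rintro rfl; simp at h; omega
    omega
  · omega

theorem step_lt (hM : M ≠ 1) : M = 0 ∨ step M d < M := by
  unfold step
  split_ifs <;> omega

theorem step_add_self : step M (d + M) = step M d := by
  simp [step]

/-- The cells have degree `M q`, of height `2 q`, or `M q + 1`, of height `2 q + 1`, and a step goes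
to the cell just below. For `M = 0` the conventions `d % 0 = d` and `d / 0 = 0` leave only the
degrees `0` and `1`. -/
theorem sub_step_eq (hM : M ≠ 1) (hd : 0 < d) (hc : d % M ≤ 1) :
    (d % M = 0 ∧ 2 ≤ M ∧ step M d = M - 1 ∧ (d - step M d) % M = 1 ∧
      (d - step M d) / M + 1 = d / M) ∨
    (d % M = 1 ∧ step M d = 1 ∧ (d - step M d) % M = 0 ∧ (d - step M d) / M = d / M) := by
  rcases Nat.le_one_iff_eq_zero_or_eq_one.mp hc with h | h
  · left
    have h0 : M ≠ 0 := by rintro rfl; simp at h; omega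
    have h2 : 2 ≤ M := by omega
    have hs : step M d = M - 1 := by simp [step, h]
    obtain ⟨q, rfl⟩ := eq_mul_of_mod_eq_zero h
    obtain ⟨q, rfl⟩ : ∃ p, q = p + 1 := ⟨q - 1, by
      have : q ≠ 0 := by rintro rfl; simp at hd
      omega⟩
    have e : M * (q + 1) - (M - 1) = 1 + M * q := by rw [mul_add]; omega
    rw [hs, e]
    refine ⟨h, h2, rfl, ?_, ?_⟩
    · rw [Nat.add_mul_mod_self_left, Nat.mod_eq_of_lt h2]
    · rw [Nat.add_mul_div_left _ _ (by omega), Nat.div_eq_of_lt h2,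
        Nat.mul_div_cancel_left _ (by omega)]
      omega
  · right
    have hs : step M d = 1 := by simp [step, h]
    rw [hs]
    have e : d - 1 = M * (d / M) := by
      have := Nat.div_add_mod d M
      omega
    refine ⟨h, rfl, ?_, ?_⟩
    · rw [e, Nat.mul_mod_right]
    · rcases Nat.eq_zero_or_pos M with rfl | hp
      · simp
      · rw [e, Nat.mul_div_cancel_left _ hp]

theorem sub_step_mod_le (hM : M ≠ 1) (hd : 0 < d) (hc : d % M ≤ 1) :
    (d - step M d) % M ≤ 1 := by
  rcases sub_step_eq hM hd hc with h | h <;> omega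

theorem sub_step_height (hM : M ≠ 1) (hd : 0 < d) (hc : d % M ≤ 1) :
    2 * ((d - step M d) / M) + (d - step M d) % M + 1 = 2 * (d / M) + d % M := by
  rcases sub_step_eq hM hd hc with h | h <;> omega

theorem Top.add_step (hM : M ≠ 1) (h : Top M a d) : M = 0 ∨ a + step M d < M := by
  rcases h with ⟨h, h'⟩ | ⟨h, rfl⟩
  · simpa [step, h] using h'
  · simpa using step_lt hM

theorem not_top_step (hM : M ≠ 1) (hd : 0 < d) (hc : d % M ≤ 1) :
    ¬ Top M (step M d) (d - step M d) := by
  unfold Top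
  rcases sub_step_eq hM hd hc with h | h <;> omega

/-- Each positive total degree `M q + s` has exactly two pairs: `(s, M q)` and `(s - 1, M q + 1)` if
`s > 0`, or `(0, M q)` and `(M - 1, M (q - 1) + 1)` if `s = 0`. The pair with the smaller cell is
one step down from the other. -/
theorem exists_top_of_not_top (hM : M ≠ 1) (ha : M = 0 ∨ a < M) (hc : d % M ≤ 1)
    (hpos : 0 < a + d) (h : ¬ (0 < d ∧ Top M a d)) :
    ∃ a' d', 0 < d' ∧ d' % M ≤ 1 ∧ Top M a' d' ∧ a = a' + step M d' ∧ d = d' - step M d' ∧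
      a' ≤ a ∧ d' = d + step M d' := by
  rcases Nat.le_one_iff_eq_zero_or_eq_one.mp hc with h0 | h1
  · have ha0 : 0 < a := by
      by_contra hcon
      exact h ⟨by omega, Or.inr ⟨h0, by omega⟩⟩
    have hm : (d + 1) % M = 1 := by
      obtain ⟨q, rfl⟩ := eq_mul_of_mod_eq_zero h0
      rcases ha with rfl | ha
      · simp
      · rw [Nat.mul_add_mod, Nat.mod_eq_of_lt (by omega)]
    have hs : step M (d + 1) = 1 := by simp [step, hm]
    refine ⟨a - 1, d + 1, by omega, hm.le, Or.inl ⟨hm, by omega⟩, ?_, ?_, by omega, ?_⟩ <;>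
      rw [hs] <;> omega
  · have hd : 0 < d := Nat.pos_of_ne_zero (by rintro rfl; simp at h1)
    have hM0 : M ≠ 0 ∧ a + 1 = M := by
      have : ¬ Top M a d := fun ht => h ⟨hd, ht⟩
      unfold Top at this
      omega
    have e : d + (M - 1) = M * (d / M + 1) := by
      have := Nat.div_add_mod d M
      rw [mul_add]
      omega
    have hm : (d + (M - 1)) % M = 0 := by rw [e, Nat.mul_mod_right]
    have hs : step M (d + (M - 1)) = M - 1 := by simp [step, hm]
    refine ⟨0, d + (M - 1), by omega, by omega, Or.inr ⟨hm, rfl⟩, ?_, ?_, by omega, ?_⟩ <;>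
      rw [hs] <;> omega

/-- If the total degree is that of a cell, the two pairs of this degree are the cell itself and its
face. -/
theorem eq_zero_or_eq_step (hM : M ≠ 1) (ha : M = 0 ∨ a < M) (hc : d % M ≤ 1)
    (hs : (a + d) % M ≤ 1) : a = 0 ∨ a = step M (a + d) := by
  by_cases ha0 : a = 0
  · exact Or.inl ha0
  right
  have hdm := Nat.div_add_mod d M
  rcases ha with rfl | ha
  · simp only [Nat.mod_zero] at hs hc
    simp only [step, Nat.mod_zero]
    split_ifs <;> omega
  rcases Nat.le_one_iff_eq_zero_or_eq_one.mp hc with h0 | h1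
  · have e : (a + d) % M = a := by
      rw [← hdm, h0, add_zero, Nat.add_mul_mod_self_left, Nat.mod_eq_of_lt ha]
    rw [e] at hs
    simp only [step, e]
    split_ifs
    omega
  · by_cases hlt : a + 1 < M
    · have e : (a + d) % M = a + 1 := by
        rw [← hdm, h1, ← add_assoc, add_right_comm, Nat.add_mul_mod_self_left, Nat.mod_eq_of_lt hlt]
      omega
    · have e : (a + d) % M = 0 := by
        rw [← hdm, h1, ← add_assoc, add_right_comm, Nat.add_mul_mod_self_left]
        have : a + 1 = M := by omega
        rw [this, Nat.mod_self]
      simp only [step, e]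
      simp
      omega

end OneVariable

/-! ### Cells, faces and the matching in several variables. -/

variable {n : ℕ} (N : Fin n → ℕ)

/-- The exponents of the monomials that survive in the truncated algebra. -/
def Box (α : Fin n →₀ ℕ) : Prop := ∀ i, N i = 0 ∨ α i < N i

/-- The degrees of the cells of the resolution. -/
def Cell (δ : Fin n →₀ ℕ) : Prop := ∀ i, δ i % N i ≤ 1

/-- The homological degree of a cell. -/
def height (δ : Fin n →₀ ℕ) : ℕ := ∑ i, (2 * (δ i / N i) + δ i % N i)

/-- The exponent by which the `i`-th component of the boundary of the cell `δ` multiplies. -/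
def up (i : Fin n) (δ : Fin n →₀ ℕ) : Fin n →₀ ℕ := single i (step (N i) (δ i))

/-- The `i`-th face of the cell `δ`. -/
def drop (i : Fin n) (δ : Fin n →₀ ℕ) : Fin n →₀ ℕ := δ - up N i δ

/-- Pairs of an exponent in the box and a cell of height `r`. -/
def valid (r : ℕ) : Set ((Fin n →₀ ℕ) × (Fin n →₀ ℕ)) :=
  {x | Box N x.1 ∧ Cell N x.2 ∧ height N x.2 = r}

/-- The pair `x` is an upper one, with first index `i`. -/
def FirstTop (i : Fin n) (x : (Fin n →₀ ℕ) × (Fin n →₀ ℕ)) : Prop :=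
  (∀ j < i, x.1 j = 0 ∧ x.2 j = 0) ∧ 0 < x.2 i ∧ Top (N i) (x.1 i) (x.2 i)

/-- The pairs that are matched with pairs of smaller height. -/
def upper (r : ℕ) : Set ((Fin n →₀ ℕ) × (Fin n →₀ ℕ)) :=
  {x | x ∈ valid N r ∧ (x = 0 ∨ ∃ i, FirstTop N i x)}

/-- The matching of upper pairs with lower pairs. -/
def face (i : Fin n) (x : (Fin n →₀ ℕ) × (Fin n →₀ ℕ)) : (Fin n →₀ ℕ) × (Fin n →₀ ℕ) :=
  (x.1 + up N i x.2, drop N i x.2)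

variable {N}

theorem drop_apply_self (i : Fin n) (δ : Fin n →₀ ℕ) :
    drop N i δ i = δ i - step (N i) (δ i) := by
  simp [drop, up]

theorem drop_apply_ne {i j : Fin n} (h : j ≠ i) (δ : Fin n →₀ ℕ) : drop N i δ j = δ j := by
  simp [drop, up, single_eq_of_ne h]

theorem up_le {i : Fin n} {δ : Fin n →₀ ℕ} (hi : 0 < δ i) : up N i δ ≤ δ := by
  rw [up, single_le_iff]
  exact step_le hi

theorem up_add_drop {i : Fin n} {δ : Fin n →₀ ℕ} (hi : 0 < δ i) : up N i δ + drop N i δ = δ :=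
  add_tsub_cancel_of_le (up_le hi)

theorem Cell.drop (hN : ∀ i, N i ≠ 1) {i : Fin n} {δ : Fin n →₀ ℕ} (h : Cell N δ) (hi : 0 < δ i) :
    Cell N (drop N i δ) := by
  intro j
  by_cases hj : j = i
  · subst hj
    rw [drop_apply_self]
    exact sub_step_mod_le (hN j) hi (h j)
  · rw [drop_apply_ne hj]
    exact h j

theorem Cell.height_drop (hN : ∀ i, N i ≠ 1) {i : Fin n} {δ : Fin n →₀ ℕ} (h : Cell N δ)
    (hi : 0 < δ i) : height N (Anick.drop N i δ) + 1 = height N δ := by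
  unfold height
  rw [← Finset.add_sum_erase _ _ (Finset.mem_univ i),
    ← Finset.add_sum_erase (a := i) Finset.univ (fun j => 2 * (δ j / N j) + δ j % N j)
      (Finset.mem_univ i), drop_apply_self, ← sub_step_height (hN i) hi (h i)]
  rw [Finset.sum_congr rfl fun j hj => by rw [drop_apply_ne (Finset.ne_of_mem_erase hj)]]
  omega

theorem box_up (hN : ∀ i, N i ≠ 1) (i : Fin n) (δ : Fin n →₀ ℕ) : Box N (up N i δ) := by
  intro j
  by_cases hj : j = i
  · subst hj
    simpa [up] using step_lt (hN j)
  · simp [up, single_eq_of_ne hj]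
    omega

theorem box_zero (N : Fin n → ℕ) : Box N 0 := fun i => by simp; omega

theorem cell_zero (N : Fin n → ℕ) : Cell N 0 := fun i => by simp

theorem height_zero (N : Fin n → ℕ) : height N 0 = 0 := by simp [height]

theorem height_eq_zero_iff {δ : Fin n →₀ ℕ} : height N δ = 0 ↔ δ = 0 := by
  constructor
  · intro h
    ext i
    have := (Finset.sum_eq_zero_iff.mp h) i (Finset.mem_univ i)
    have := Nat.div_add_mod (δ i) (N i)
    have h1 : δ i / N i = 0 := by omega
    rw [h1] at this
    simp
    omega
  · rintro rfl
    exact height_zero N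

theorem finite_cells (N : Fin n → ℕ) (r : ℕ) : {δ | Cell N δ ∧ height N δ = r}.Finite := by
  refine (Set.finite_Iic (Finsupp.equivFunOnFinite.symm fun i => N i * r + r)).subset ?_
  rintro δ ⟨-, h⟩ i
  have h1 : 2 * (δ i / N i) + δ i % N i ≤ r := by
    rw [← h]
    exact Finset.single_le_sum (f := fun i => 2 * (δ i / N i) + δ i % N i)
      (fun _ _ => Nat.zero_le _) (Finset.mem_univ i)
  have h2 := Nat.div_add_mod (δ i) (N i)
  have h3 : N i * (δ i / N i) ≤ N i * r := Nat.mul_le_mul_left _ (by omega)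
  simp
  omega

/-- The first index in the support. -/
def First (i : Fin n) (δ : Fin n →₀ ℕ) : Prop := 0 < δ i ∧ ∀ j < i, δ j = 0

theorem exists_first {δ : Fin n →₀ ℕ} (h : δ ≠ 0) : ∃ i, First i δ := by
  obtain ⟨i, hi⟩ := Finsupp.ne_iff.mp h
  obtain ⟨i, hi, hmin⟩ := Set.exists_min_image {i | δ i ≠ 0} id (Set.toFinite _) ⟨i, hi⟩
  exact ⟨i, Nat.pos_of_ne_zero hi, fun j hj => by_contra fun hne => (hmin j hne).not_gt hj⟩

theorem First.unique {i j : Fin n} {δ : Fin n →₀ ℕ} (hi : First i δ) (hj : First j δ) : i = j := by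
  rcases lt_trichotomy i j with h | h | h
  · exact absurd (hj.2 i h) hi.1.ne'
  · exact h
  · exact absurd (hi.2 j h) hj.1.ne'

theorem FirstTop.first_add {i : Fin n} {x} (h : FirstTop N i x) : First i (x.1 + x.2) :=
  ⟨by have := h.2.1; simp; omega, fun j hj => by simp [h.1 j hj]⟩

theorem FirstTop.first {i : Fin n} {x} (h : FirstTop N i x) : First i x.2 :=
  ⟨h.2.1, fun j hj => (h.1 j hj).2⟩

theorem exists_firstTop {r : ℕ} {x} (h : x ∈ upper N (r + 1)) : ∃ i, FirstTop N i x := by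
  refine h.2.resolve_left ?_
  rintro rfl
  have := h.1.2.2
  simp [height_zero] at this

theorem face_add {i : Fin n} {x : (Fin n →₀ ℕ) × (Fin n →₀ ℕ)} (h : 0 < x.2 i) :
    (face N i x).1 + (face N i x).2 = x.1 + x.2 := by
  rw [face, add_assoc, up_add_drop h]

theorem face_mem_valid (hN : ∀ i, N i ≠ 1) {r : ℕ} {i : Fin n} {x} (hx : x ∈ valid N (r + 1))
    (h : FirstTop N i x) : face N i x ∈ valid N r := by
  refine ⟨fun j => ?_, hx.2.1.drop hN h.2.1, ?_⟩
  · by_cases hj : j = i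
    · subst hj
      simpa [face, up] using h.2.2.add_step (hN j)
    · simpa [face, up, single_eq_of_ne hj] using hx.1 j
  · have := hx.2.1.height_drop hN h.2.1
    rw [hx.2.2] at this
    exact Nat.add_right_cancel this

theorem up_mem_valid (hN : ∀ i, N i ≠ 1) {r : ℕ} {i : Fin n} {δ : Fin n →₀ ℕ} (hδ : Cell N δ)
    (hr : height N δ = r + 1) (hi : 0 < δ i) : (up N i δ, drop N i δ) ∈ valid N r := by
  refine ⟨box_up hN i δ, hδ.drop hN hi, ?_⟩
  have := hδ.height_drop hN hi
  show height N (drop N i δ) = r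
  omega

/-- Only the first index with positive total degree has to change, and there the one-variable
matching applies. Earlier coordinates stay zero, so this index is also the first one of the partner.
-/
theorem exists_face_eq (hN : ∀ i, N i ≠ 1) {r : ℕ} {x} (hx : x ∈ valid N r) (h : x ∉ upper N r) :
    ∃ y ∈ upper N (r + 1), ∃ i, FirstTop N i y ∧ face N i y = x := by
  have h0 : x ≠ 0 := fun h0 => h ⟨hx, Or.inl h0⟩
  have hne : x.1 + x.2 ≠ 0 := fun h1 => h0 (by
    ext i
    · have := DFunLike.congr_fun h1 i; simp at this; simp [this]
    · have := DFunLike.congr_fun h1 i; simp at this; simp [this])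
  obtain ⟨i, hi, hlt⟩ := exists_first hne
  have hlt' : ∀ j < i, x.1 j = 0 ∧ x.2 j = 0 := fun j hj => by simpa using hlt j hj
  have hnt : ¬ (0 < x.2 i ∧ Top (N i) (x.1 i) (x.2 i)) := fun ht =>
    h ⟨hx, Or.inr ⟨i, hlt', ht.1, ht.2⟩⟩
  obtain ⟨a, d, hd, hc, ht, hea, hed, hle, hed'⟩ :=
    exists_top_of_not_top (hN i) (hx.1 i) (hx.2.1 i) hi hnt
  let y : (Fin n →₀ ℕ) × (Fin n →₀ ℕ) := (x.1.update i a, x.2.update i d)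
  have hy1 : y.1 i = a := by simp [y]
  have hy2 : y.2 i = d := by simp [y]
  have hy1' : ∀ j, j ≠ i → y.1 j = x.1 j := fun j hj => by simp [y, Finsupp.update, hj]
  have hy2' : ∀ j, j ≠ i → y.2 j = x.2 j := fun j hj => by simp [y, Finsupp.update, hj]
  have hft : FirstTop N i y := by
    refine ⟨fun j hj => ?_, by rwa [hy2], by rwa [hy1, hy2]⟩
    rw [hy1' j hj.ne, hy2' j hj.ne]
    exact hlt' j hj
  have hface : face N i y = x := by
    refine Prod.ext (Finsupp.ext fun j => ?_) (Finsupp.ext fun j => ?_)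
    · by_cases hj : j = i
      · subst hj
        simp [face, up, hy1, hy2, ← hea]
      · simp [face, up, single_eq_of_ne hj, hy1' j hj]
    · by_cases hj : j = i
      · subst hj
        simp [face, drop_apply_self, hy2, ← hed]
      · simp [face, drop_apply_ne hj, hy2' j hj]
  have hcell : Cell N y.2 := by
    intro j
    by_cases hj : j = i
    · subst hj
      rwa [hy2]
    · rw [hy2' j hj]
      exact hx.2.1 j
  refine ⟨y, ⟨⟨fun j => ?_, hcell, ?_⟩, Or.inr ⟨i, hft⟩⟩, i, hft, hface⟩
  · by_cases hj : j = i
    · subst hj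
      rw [hy1]
      exact (hx.1 j).imp_right fun h => lt_of_le_of_lt hle h
    · rw [hy1' j hj]
      exact hx.1 j
  · rw [← hcell.height_drop hN hft.2.1, ← hx.2.2, ← hface]
    rfl

/-- The only other possible exponent is the step, and it belongs to the lower pair of the matching.
-/
theorem FirstTop.fst_eq_zero (hN : ∀ i, N i ≠ 1) {i : Fin n} {x} (h : FirstTop N i x)
    {r : ℕ} (hx : x ∈ valid N r) (hc : Cell N (x.1 + x.2)) : x.1 i = 0 := by
  have hi : 0 < (x.1 + x.2) i := h.first_add.1
  rw [Finsupp.add_apply] at hi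
  rcases eq_zero_or_eq_step (hN i) (hx.1 i) (hx.2.1 i) (hc i) with h0 | h1
  · exact h0
  · refine absurd h.2.2 ?_
    have := not_top_step (hN i) hi (hc i)
    rwa [← h1, Nat.add_sub_cancel_left] at this

/-- Each nonzero exponent is a step and costs one unit of height, so a nonzero exponent would put
`x.2` strictly below the total degree. -/
theorem fst_eq_zero_of_height (hN : ∀ i, N i ≠ 1) {r : ℕ} {x} (hx : x ∈ valid N r)
    (hc : Cell N (x.1 + x.2)) (hr : height N (x.1 + x.2) ≤ r) : x.1 = 0 := by
  have key : ∀ i, x.1 i = 0 ∨ 2 * (x.2 i / N i) + x.2 i % N i + 1 =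
      2 * ((x.1 + x.2) i / N i) + (x.1 + x.2) i % N i := by
    intro i
    rcases eq_zero_or_eq_step (hN i) (hx.1 i) (hx.2.1 i) (hc i) with h0 | h1
    · exact Or.inl h0
    · by_cases h0 : x.1 i = 0
      · exact Or.inl h0
      right
      have hi : 0 < x.1 i + x.2 i := by omega
      have := sub_step_height (hN i) hi (hc i)
      rwa [← h1, Nat.add_sub_cancel_left] at this
  by_contra hne
  obtain ⟨i, hi⟩ := Finsupp.ne_iff.mp hne
  have : height N x.2 < height N (x.1 + x.2) := by
    refine Finset.sum_lt_sum (fun j _ => ?_) ⟨i, Finset.mem_univ i, ?_⟩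
    · rcases key j with h | h
      · simp [h]
      · omega
    · have := (key i).resolve_left hi
      omega
  have := hx.2.2
  omega

/-- A height defect of one leaves room for a single step: in the total degree of a cell and one
height below it, only the faces of that cell occur. This isolates the extreme terms of a boundary.
-/
theorem eq_up_drop (hN : ∀ i, N i ≠ 1) {r : ℕ} {x} (hx : x ∈ valid N r)
    (hc : Cell N (x.1 + x.2)) (hr : height N (x.1 + x.2) = r + 1) :
    ∃ l, 0 < (x.1 + x.2) l ∧ x = (up N l (x.1 + x.2), drop N l (x.1 + x.2)) := by
  have hne : x.1 ≠ 0 := by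
    intro h
    rw [h, zero_add, hx.2.2] at hr
    omega
  obtain ⟨l, hl⟩ := Finsupp.ne_iff.mp hne
  have hl' : x.1 l ≠ 0 := hl
  have hpos : 0 < (x.1 + x.2) l := by simp; omega
  have hstep : x.1 l = step (N l) ((x.1 + x.2) l) :=
    (eq_zero_or_eq_step (hN l) (hx.1 l) (hx.2.1 l) (hc l)).resolve_left hl'
  -- Without its `l`-th exponent the pair has the `l`-th face as total degree, and there the height
  -- defect is zero.
  let y : (Fin n →₀ ℕ) × (Fin n →₀ ℕ) := (x.1.erase l, x.2)
  have hy : y.1 + up N l (x.1 + x.2) = x.1 := by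
    ext j
    by_cases hj : j = l
    · subst hj
      simpa [y, up, erase_same] using hstep.symm
    · simp [y, up, erase_ne hj, single_eq_of_ne hj]
  have hsum : y.1 + y.2 = drop N l (x.1 + x.2) := by
    have h1 : up N l (x.1 + x.2) + (y.1 + y.2) = x.1 + x.2 := by
      rw [← add_assoc, add_comm (up N l _), hy]
    have h2 := up_add_drop (N := N) hpos
    exact add_left_cancel (h1.trans h2.symm)
  have hyv : y ∈ valid N r := by
    refine ⟨fun j => ?_, hx.2⟩
    by_cases hj : j = l
    · subst hj
      have h0 : y.1 j = 0 := erase_same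
      rw [h0]
      omega
    · have h0 : y.1 j = x.1 j := erase_ne hj
      rw [h0]
      exact hx.1 j
  have hy0 : y.1 = 0 := by
    refine fst_eq_zero_of_height hN hyv ?_ ?_
    · rw [hsum]
      exact hc.drop hN hpos
    · have := hc.height_drop hN hpos
      rw [hsum]
      omega
  refine ⟨l, hpos, Prod.ext ?_ ?_⟩
  · exact (hy.symm.trans (by rw [hy0, zero_add]))
  · rw [← hsum, hy0, zero_add]

/-! ### The order on pairs -/

/-- Modulo `M > 0` the total degree is `a + 1`, between `1` and `M - 1`, in the first case and `0`
in the second, so it determines the exponent. For `M = 0` the cell has degree `1` or the pair is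
zero. -/
theorem top_unique {M a d a' d' : ℕ} (h : Top M a d)
    (h' : Top M a' d') (e : a + d = a' + d') : a = a' := by
  have aux : ∀ {a d : ℕ}, d % M = 1 → a + 1 < M → (a + d) % M = a + 1 := by
    intro a d h1 hlt
    rw [← Nat.div_add_mod d M, h1, ← add_assoc, add_right_comm, Nat.add_mul_mod_self_left,
      Nat.mod_eq_of_lt hlt]
  rcases h with ⟨h1, hM | hM⟩ | ⟨h0, rfl⟩ <;> rcases h' with ⟨h1', hM' | hM'⟩ | ⟨h0', rfl⟩
  · subst hM
    simp only [Nat.mod_zero] at h1 h1'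
    omega
  · omega
  · subst hM
    simp only [Nat.mod_zero] at h0'
    omega
  · omega
  · have := aux h1 hM
    rw [e, aux h1' hM'] at this
    omega
  · have := aux h1 hM
    rw [e, zero_add, h0'] at this
    omega
  · subst hM'
    simp only [Nat.mod_zero] at h0
    omega
  · have := aux h1' hM'
    rw [← e, zero_add, h0] at this
    omega
  · rfl

variable (m : MonomialOrder.{0, o} (Fin n))

/-- Pairs are compared by their total degree first, and then by the exponent. -/
def key (x : (Fin n →₀ ℕ) × (Fin n →₀ ℕ)) : m.syn ×ₗ Lex (Fin n →₀ ℕ) :=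
  toLex (m.toSyn (x.1 + x.2), toLex x.1)

variable {m}

theorem key_lt_iff {x y} : key m x < key m y ↔ m.toSyn (x.1 + x.2) < m.toSyn (y.1 + y.2) ∨
    (x.1 + x.2 = y.1 + y.2 ∧ toLex x.1 < toLex y.1) := by
  rw [key, key, Prod.Lex.toLex_lt_toLex, m.toSyn.injective.eq_iff]

theorem key_injective : Function.Injective (key m) := by
  intro x y h
  rw [key, key, toLex_inj, Prod.mk.injEq, m.toSyn.injective.eq_iff, toLex_inj] at h
  exact Prod.ext h.2 (add_left_cancel (h.2 ▸ h.1))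

theorem deg_le_of_key_lt {x y} (h : key m x < key m y) :
    m.toSyn (x.1 + x.2) ≤ m.toSyn (y.1 + y.2) := by
  rcases key_lt_iff.mp h with h | h
  · exact h.le
  · rw [h.1]

theorem lex_lt_of {α β : Fin n →₀ ℕ} (i : Fin n) (h : ∀ j < i, α j = β j) (hi : α i < β i) :
    toLex α < toLex β :=
  ⟨i, h, hi⟩

/-- With equal totals, both pairs have the same first index and agree there by `top_unique`, so the
same step is added to both exponents. Distinct upper pairs thus get distinct leading faces, in the
same order. -/
theorem face_lt_face {x y} {i j : Fin n} (hx : FirstTop N i x) (hy : FirstTop N j y)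
    (h : key m x < key m y) : key m (face N i x) < key m (face N j y) := by
  rw [key_lt_iff, face_add hx.2.1, face_add hy.2.1]
  refine (key_lt_iff.mp h).imp_right fun h => ⟨h.1, ?_⟩
  obtain rfl : i = j := hx.first_add.unique (h.1 ▸ hy.first_add)
  have hi : x.1 i + x.2 i = y.1 i + y.2 i := DFunLike.congr_fun h.1 i
  have h1 : x.1 i = y.1 i := top_unique hx.2.2 hy.2.2 hi
  have h2 : x.2 i = y.2 i := by omega
  have h3 : up N i x.2 = up N i y.2 := by rw [up, up, h2]
  show toLex (x.1 + up N i x.2) < toLex (y.1 + up N i y.2)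
  rw [h3, toLex_add, toLex_add]
  exact add_lt_add_left h.2 _

/-- The first face dominates the correction terms. In equal total degree the upper pair has exponent
zero at the first index and the face a positive one, so the lexicographic comparison decides. -/
theorem key_add_lt (hN : ∀ i, N i ≠ 1) {δ : Fin n →₀ ℕ} {i : Fin n} (hδ : Cell N δ)
    (hi : First i δ) {r : ℕ} {z} (hz : z ∈ upper N r)
    (hle : m.toSyn (z.1 + z.2) ≤ m.toSyn δ) (α : Fin n →₀ ℕ) :
    key m (α + z.1, z.2) < key m (α + up N i δ, drop N i δ) := by
  rw [key_lt_iff]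
  simp only [add_assoc, up_add_drop hi.1]
  rcases hle.lt_or_eq with hlt | heq
  · left
    rw [map_add, map_add m.toSyn α]
    exact add_lt_add_right hlt _
  · right
    have heq : z.1 + z.2 = δ := m.toSyn.injective heq
    refine ⟨by rw [heq], ?_⟩
    rw [toLex_add, toLex_add]
    refine add_lt_add_right ?_ _
    obtain ⟨j, hj⟩ : ∃ j, FirstTop N j z := by
      refine hz.2.resolve_left ?_
      rintro rfl
      have := hi.1
      simp [← heq] at this
    obtain rfl : i = j := hi.unique (heq ▸ hj.first_add)
    refine lex_lt_of i (fun j' hj' => ?_) ?_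
    · rw [(hj.1 j' hj').1, up, single_eq_of_ne hj'.ne]
    · rw [hj.fst_eq_zero hN hz.1 (by rwa [heq]), up, single_eq_same]
      exact step_pos (hN i) hi.1

theorem drop_le (i : Fin n) (δ : Fin n →₀ ℕ) : drop N i δ ≤ δ := tsub_le_self

theorem First.drop {i j : Fin n} {δ : Fin n →₀ ℕ} (h : First i δ) (hij : i ≠ j) :
    First i (drop N j δ) := by
  refine ⟨by rw [drop_apply_ne hij]; exact h.1, fun l hl => ?_⟩
  have := drop_le (N := N) j δ l
  rw [h.2 l hl] at this
  omega

theorem up_drop {i j : Fin n} (h : i ≠ j) (δ : Fin n →₀ ℕ) : up N i (drop N j δ) = up N i δ := by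
  rw [up, up, drop_apply_ne h]

theorem drop_drop (i j : Fin n) (h : i ≠ j) (δ : Fin n →₀ ℕ) :
    drop N i (drop N j δ) = drop N j (drop N i δ) := by
  have h1 := up_drop (N := N) h δ
  have h2 := up_drop (N := N) h.symm δ
  rw [drop, h1, drop, drop, h2, drop, tsub_right_comm]

variable (N) in
/-- The degree of the `i`-th periodicity operator. -/
def period (i : Fin n) : Fin n →₀ ℕ := single i (N i)

theorem up_add_period (i j : Fin n) (δ : Fin n →₀ ℕ) : up N j (δ + period N i) = up N j δ := by
  by_cases h : j = i
  · subst h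
    simp [up, period, step_add_self]
  · simp [up, period, single_eq_of_ne h]

theorem drop_add_period (i : Fin n) {j : Fin n} {δ : Fin n →₀ ℕ} (hj : 0 < δ j) :
    drop N j (δ + period N i) = drop N j δ + period N i := by
  rw [drop, drop, up_add_period, tsub_add_eq_add_tsub (up_le hj)]

theorem Cell.add_period {δ : Fin n →₀ ℕ} (h : Cell N δ) (i : Fin n) : Cell N (δ + period N i) := by
  intro j
  by_cases hj : j = i
  · subst hj
    simpa [period] using h j
  · simpa [period, single_eq_of_ne hj] using h j

theorem height_add_period (δ : Fin n →₀ ℕ) {i : Fin n} (hi : N i ≠ 0) :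
    height N (δ + period N i) = height N δ + 2 := by
  unfold height
  rw [← Finset.add_sum_erase _ _ (Finset.mem_univ i),
    ← Finset.add_sum_erase (a := i) Finset.univ (fun j => 2 * (δ j / N j) + δ j % N j)
      (Finset.mem_univ i)]
  rw [Finset.sum_congr rfl fun j hj => by
    rw [Finsupp.add_apply, period, single_eq_of_ne (Finset.ne_of_mem_erase hj), add_zero]]
  have h1 : (δ + period N i) i = δ i + N i := by simp [period]
  rw [h1, Nat.add_div_right _ (Nat.pos_of_ne_zero hi), Nat.add_mod_right]
  omega

/-! ### Dickson's lemma for cells -/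

/-- The minimal elements of the image form an antichain, hence a finite set. One preimage of each
suffices. -/
theorem exists_finite_basis {α β : Type*} [PartialOrder β] [WellQuasiOrderedLE β] (f : α → β)
    (L : Set α) : ∃ M ⊆ L, M.Finite ∧ ∀ x ∈ L, ∃ y ∈ M, f y ≤ f x := by
  have hmin : {b | Minimal (· ∈ f '' L) b}.Finite :=
    WellQuasiOrderedLE.finite_of_isAntichain (setOfPred_minimal_antichain _)
  have h : ∀ b ∈ {b | Minimal (· ∈ f '' L) b}, ∃ x ∈ L, f x = b := fun b hb => hb.1
  choose g hgL hgf using h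
  have := hmin.to_subtype
  refine ⟨Set.range fun b : {b | Minimal (· ∈ f '' L) b} => g b b.2, ?_, Set.finite_range _, ?_⟩
  · rintro _ ⟨b, rfl⟩
    exact hgL _ _
  · intro x hx
    obtain ⟨b, hb, hmin⟩ := exists_minimal_le_of_wellFoundedLT (· ∈ f '' L) (f x) ⟨x, hx, rfl⟩
    exact ⟨_, ⟨⟨b, hmin⟩, rfl⟩, (hgf b hmin).trans_le hb⟩

variable (N) in
theorem exists_finite_cells (L : Set (Fin n →₀ ℕ)) (hL : ∀ δ ∈ L, Cell N δ) :
    ∃ M ⊆ L, M.Finite ∧ ∀ δ ∈ L, ∃ δ₀ ∈ M,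
      ∃ z ∈ AddSubmonoid.closure (Set.range fun i : {i // N i ≠ 0} => period N i.1),
        δ = δ₀ + z := by
  obtain ⟨M, hML, hM, h⟩ := exists_finite_basis
    -- Recording each remainder with its complement forces comparable cells to have equal
    -- remainders, so they differ by multiples of the periods.
    (fun (δ : Fin n →₀ ℕ) (i : Fin n) => (δ i / N i, δ i % N i, 1 - δ i % N i)) L
  refine ⟨M, hML, hM, fun δ hδ => ?_⟩
  obtain ⟨δ₀, h₀, hle⟩ := h δ hδ
  refine ⟨δ₀, h₀, ∑ i, (δ i / N i - δ₀ i / N i) • period N i, ?_, ?_⟩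
  · refine sum_mem fun i _ => nsmul_mem ?_ _
    by_cases hi : N i = 0
    · rw [period, hi, single_zero]
      exact zero_mem _
    · exact AddSubmonoid.subset_closure ⟨⟨i, hi⟩, rfl⟩
  · ext j
    have hsum : (∑ i, (δ i / N i - δ₀ i / N i) • period N i) j =
        (δ j / N j - δ₀ j / N j) * N j := by
      rw [Finsupp.finsetSum_apply, Finset.sum_eq_single j]
      · simp [period]
      · intro i _ hij
        simp [period, single_eq_of_ne hij.symm]
      · simp
    rw [Finsupp.add_apply, hsum]
    obtain ⟨h1, h2, h3⟩ := hle j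
    simp only at h1 h2 h3
    have c := hL δ hδ j
    have c₀ := hL δ₀ (hML h₀) j
    have e : δ j % N j = δ₀ j % N j := by omega
    have d := Nat.div_add_mod (δ j) (N j)
    have d₀ := Nat.div_add_mod (δ₀ j) (N j)
    obtain ⟨q, hq⟩ := Nat.exists_eq_add_of_le h1
    rw [hq] at d ⊢
    rw [Nat.add_sub_cancel_left]
    rw [mul_add] at d
    rw [mul_comm q]
    omega

end Anick

namespace Anick

open Finsupp

/-! ### Algebras with a basis of truncated monomials -/

/-- An augmented algebra `A` with a `k`-basis of monomials `mon α`, indexed by the exponents `α` in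
the box given by `N`, which multiply like commuting variables truncated at `N`, up to nonzero scalars
and terms that are smaller for the order `m`. -/
structure MonomialAlgebra (k A : Type*) [Field k] [Ring A] [Algebra k A] {n : ℕ}
    (m : MonomialOrder.{0, o} (Fin n)) (N : Fin n → ℕ) where
  mon : (Fin n →₀ ℕ) → A
  coeff : (Fin n →₀ ℕ) → A →ₗ[k] k
  ε : A →ₐ[k] k
  lc : (Fin n →₀ ℕ) → (Fin n →₀ ℕ) → k
  mon_zero : mon 0 = 1
  mon_eq_zero : ∀ α, ¬ Box N α → mon α = 0
  span_eq_top : Submodule.span k (Set.range mon) = ⊤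
  coeff_mon : ∀ α β, Box N α → coeff β (mon α) = if β = α then 1 else 0
  lc_ne_zero : ∀ α β, lc α β ≠ 0
  mul_mem : ∀ α β, mon α * mon β - lc α β • mon (α + β) ∈
    Submodule.span k (mon '' {γ | m.toSyn γ < m.toSyn (α + β)})
  aug_mon : ∀ α, α ≠ 0 → ε (mon α) = 0

namespace MonomialAlgebra

variable {k A : Type*} [Field k] [Ring A] [Algebra k A] {n : ℕ}
  {m : MonomialOrder.{0, o} (Fin n)} {N : Fin n → ℕ} (M : MonomialAlgebra k A m N)

/-- The basis element `x^α e_δ` of the free module on the cells. -/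
def elt (x : (Fin n →₀ ℕ) × (Fin n →₀ ℕ)) : (Fin n →₀ ℕ) →₀ A := single x.2 (M.mon x.1)

/-- The `k`-span of the basis elements in `T`. -/
def sp (T : Set ((Fin n →₀ ℕ) × (Fin n →₀ ℕ))) : Submodule k ((Fin n →₀ ℕ) →₀ A) :=
  Submodule.span k (M.elt '' T)

/-- The coefficient of a basis element. -/
def cof (x : (Fin n →₀ ℕ) × (Fin n →₀ ℕ)) : ((Fin n →₀ ℕ) →₀ A) →ₗ[k] k :=
  M.coeff x.1 ∘ₗ lapply x.2

variable (m) in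
/-- The pairs of total degree at most `g`. -/
def dle (g : m.syn) : Set ((Fin n →₀ ℕ) × (Fin n →₀ ℕ)) := {x | m.toSyn (x.1 + x.2) ≤ g}

theorem elt_zero_fst (δ : Fin n →₀ ℕ) : M.elt (0, δ) = single δ 1 := by
  rw [elt, M.mon_zero]

theorem smul_single_eq (a : A) (δ : Fin n →₀ ℕ) :
    single δ a = a • (single δ 1 : (Fin n →₀ ℕ) →₀ A) := by
  rw [smul_single, smul_eq_mul, mul_one]

theorem elt_eq_smul (x) : M.elt x = M.mon x.1 • (single x.2 1 : (Fin n →₀ ℕ) →₀ A) :=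
  smul_single_eq _ _

theorem elt_eq_zero {x} (h : ¬ Box N x.1) : M.elt x = 0 := by
  rw [elt, M.mon_eq_zero _ h, single_zero]

theorem cof_elt (x) {y} (h : Box N y.1) : M.cof x (M.elt y) = if x = y then 1 else 0 := by
  by_cases h2 : y.2 = x.2
  · have : x = y ↔ x.1 = y.1 := ⟨fun h => h ▸ rfl, fun h => Prod.ext h h2.symm⟩
    simp [cof, elt, h2, M.coeff_mon _ _ h, this]
  · have : x ≠ y := fun h => h2 (h ▸ rfl)
    simp [cof, elt, this, single_eq_of_ne (Ne.symm h2)]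

variable {M}

theorem elt_mem {x} {T} (h : x ∈ T) : M.elt x ∈ M.sp T := Submodule.subset_span ⟨x, h, rfl⟩

theorem sp_mono {S T} (h : S ⊆ T) : M.sp S ≤ M.sp T := Submodule.span_mono (Set.image_mono h)

theorem sp_le {T} {W : Submodule k ((Fin n →₀ ℕ) →₀ A)} (h : ∀ x ∈ T, Box N x.1 → M.elt x ∈ W) :
    M.sp T ≤ W := by
  refine Submodule.span_le.mpr ?_
  rintro _ ⟨x, hx, rfl⟩
  by_cases hb : Box N x.1
  · exact h x hx hb
  · rw [M.elt_eq_zero hb]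
    exact zero_mem _

theorem cof_eq_zero {T} {p} (hp : p ∈ M.sp T) {x} (hx : x ∉ T) : M.cof x p = 0 := by
  have : M.sp T ≤ LinearMap.ker (M.cof x) := sp_le fun y hy hb => by
    rw [LinearMap.mem_ker, M.cof_elt x hb, if_neg (fun h : x = y => hx (h ▸ hy))]
  exact this hp

theorem map_mem {Q : Type*} [AddCommGroup Q] [Module k Q] {T} {W : Submodule k Q}
    (f : ((Fin n →₀ ℕ) →₀ A) →ₗ[k] Q) (h : ∀ x ∈ T, Box N x.1 → f (M.elt x) ∈ W) {p}
    (hp : p ∈ M.sp T) : f p ∈ W :=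
  (sp_le (W := W.comap f) h) hp

theorem mon_span_le {S : Set (Fin n →₀ ℕ)} {W : Submodule k A}
    (h : ∀ α ∈ S, M.mon α ∈ W) : Submodule.span k (M.mon '' S) ≤ W := by
  refine Submodule.span_le.mpr ?_
  rintro _ ⟨x, hx, rfl⟩
  exact h x hx

theorem smul_elt_sub_mem (α : Fin n →₀ ℕ) (x) :
    M.mon α • M.elt x - M.lc α x.1 • M.elt (α + x.1, x.2) ∈
      M.sp {y | y.2 = x.2 ∧ m.toSyn y.1 < m.toSyn (α + x.1)} := by
  have e : M.mon α • M.elt x - M.lc α x.1 • M.elt (α + x.1, x.2) =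
      lsingle (R := k) x.2 (M.mon α * M.mon x.1 - M.lc α x.1 • M.mon (α + x.1)) := by
    simp [elt, smul_single]
  rw [e]
  exact (mon_span_le (W := (M.sp _).comap (lsingle (R := k) x.2)) fun β hβ =>
    elt_mem (M := M) (x := (β, x.2))
      (T := {y | y.2 = x.2 ∧ m.toSyn y.1 < m.toSyn (α + x.1)}) ⟨rfl, hβ⟩) (M.mul_mem α x.1)

theorem smul_elt_mem (α : Fin n →₀ ℕ) (x) :
    M.mon α • M.elt x ∈ M.sp {y | y.2 = x.2 ∧ (y.1 = α + x.1 ∨ m.toSyn y.1 < m.toSyn (α + x.1))} := by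
  have h := sp_mono (M := M) (T := {y | y.2 = x.2 ∧ (y.1 = α + x.1 ∨
    m.toSyn y.1 < m.toSyn (α + x.1))}) (fun y hy => ⟨hy.1, Or.inr hy.2⟩) (smul_elt_sub_mem α x)
  rw [← sub_add_cancel (M.mon α • M.elt x)]
  refine add_mem h (Submodule.smul_mem _ _ (elt_mem ?_))
  exact ⟨rfl, Or.inl rfl⟩

/-- Multiplication by an element of `A` as a `k`-linear map. -/
def smulMap (a : A) : ((Fin n →₀ ℕ) →₀ A) →ₗ[k] ((Fin n →₀ ℕ) →₀ A) :=
  Algebra.lsmul k k _ a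

theorem smulMap_apply (a : A) (p : (Fin n →₀ ℕ) →₀ A) : smulMap (k := k) a p = a • p := rfl

theorem smul_mem_valid {α : Fin n →₀ ℕ} {r : ℕ} {T : Set ((Fin n →₀ ℕ) × (Fin n →₀ ℕ))} {p}
    (hT : T ⊆ valid N r) (hp : p ∈ M.sp T) (S : Set ((Fin n →₀ ℕ) × (Fin n →₀ ℕ)))
    (h : ∀ x ∈ T, ∀ y : (Fin n →₀ ℕ) × (Fin n →₀ ℕ), y.2 = x.2 →
      (y.1 = α + x.1 ∨ m.toSyn y.1 < m.toSyn (α + x.1)) → y ∈ S) :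
    M.mon α • p ∈ M.sp (valid N r ∩ S) := by
  refine map_mem (smulMap (M.mon α)) (fun x hx _ => ?_) hp
  refine sp_le (W := M.sp (valid N r ∩ S)) (fun y hy hb => elt_mem ⟨⟨hb, ?_⟩, h x hx y hy.1 hy.2⟩)
    (smul_elt_mem α x)
  rw [hy.1]
  exact (hT hx).2

theorem add_le_of_or {α β γ δ : Fin n →₀ ℕ} (h : β = γ ∨ m.toSyn β < m.toSyn γ)
    (hle : m.toSyn (γ + δ) ≤ m.toSyn α) : m.toSyn (β + δ) ≤ m.toSyn α := by
  rcases h with rfl | h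
  · exact hle
  · refine le_trans ?_ hle
    rw [map_add, map_add]
    exact add_le_add_left h.le _

theorem smul_mem_dle {α : Fin n →₀ ℕ} {r : ℕ} {g : m.syn} {p}
    (hp : p ∈ M.sp (valid N r ∩ dle m g)) : M.mon α • p ∈ M.sp (valid N r ∩ dle m (m.toSyn α + g)) := by
  refine smul_mem_valid Set.inter_subset_left hp _ fun x hx y h2 h1 => ?_
  show m.toSyn (y.1 + y.2) ≤ _
  rw [h2, ← m.toSyn.apply_symm_apply (m.toSyn α + g)]
  refine add_le_of_or h1 ?_
  rw [m.toSyn.apply_symm_apply, add_assoc, map_add]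
  exact add_le_add_right hx.2 _

theorem exists_dle {T} {p} (hp : p ∈ M.sp T) : ∃ g, p ∈ M.sp (T ∩ dle m g) := by
  induction hp using Submodule.span_induction with
  | mem _ h =>
    obtain ⟨x, hx, rfl⟩ := h
    exact ⟨m.toSyn (x.1 + x.2), elt_mem ⟨hx, le_rfl⟩⟩
  | zero => exact ⟨0, zero_mem _⟩
  | add p q _ _ hp hq =>
    obtain ⟨g, hg⟩ := hp
    obtain ⟨g', hg'⟩ := hq
    exact ⟨max g g', add_mem
      (sp_mono (Set.inter_subset_inter_right _ fun x hx => le_trans hx (le_max_left _ _)) hg)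
      (sp_mono (Set.inter_subset_inter_right _ fun x hx => le_trans hx (le_max_right _ _)) hg')⟩
  | smul c p _ hp =>
    obtain ⟨g, hg⟩ := hp
    exact ⟨g, Submodule.smul_mem _ _ hg⟩

/-! ### The boundary maps -/

/-- `D` maps cells of height `r + 1` to combinations of the basis elements of height `r`, with
the prescribed leading terms. -/
structure IsBoundary (M : MonomialAlgebra k A m N) (r : ℕ)
    (D : ((Fin n →₀ ℕ) →₀ A) →ₗ[A] ((Fin n →₀ ℕ) →₀ A)) : Prop where
  eq_zero : ∀ δ, ¬ (Cell N δ ∧ height N δ = r + 1) → D (single δ 1) = 0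
  single_sub_mem : ∀ δ i, Cell N δ → height N δ = r + 1 → First i δ →
    D (single δ 1) - M.elt (up N i δ, drop N i δ) ∈ M.sp (upper N r ∩ dle m (m.toSyn δ))

variable (M) in
/-- A linear map is injective on upper elements, and its values are attained on upper elements of the
same degree. -/
structure IsReduced {Q : Type*} [AddCommGroup Q] [Module A Q] (r : ℕ)
    (D : ((Fin n →₀ ℕ) →₀ A) →ₗ[A] Q) : Prop where
  inj : ∀ s ∈ M.sp (upper N r), D s = 0 → s = 0
  exists_upper : ∀ g, ∀ z ∈ M.sp (valid N r ∩ dle m g),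
    ∃ s ∈ M.sp (upper N r ∩ dle m g), D s = D z

/-- The first face of a cell need not be a cycle. Subtracting the upper element with the same image
makes it one, without changing the leading term or exceeding the degree of the cell. -/
theorem exists_isBoundary (hN : ∀ i, N i ≠ 1) {Q : Type*} [AddCommGroup Q] [Module A Q] {r : ℕ}
    {D : ((Fin n →₀ ℕ) →₀ A) →ₗ[A] Q} (hD : M.IsReduced r D) :
    ∃ D' : ((Fin n →₀ ℕ) →₀ A) →ₗ[A] ((Fin n →₀ ℕ) →₀ A),
      M.IsBoundary r D' ∧ ∀ p, D (D' p) = 0 := by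
  classical
  have h : ∀ δ, ∃ p : (Fin n →₀ ℕ) →₀ A, D p = 0 ∧ (¬ (Cell N δ ∧ height N δ = r + 1) → p = 0) ∧
      ∀ i, Cell N δ → height N δ = r + 1 → First i δ →
        p - M.elt (up N i δ, drop N i δ) ∈ M.sp (upper N r ∩ dle m (m.toSyn δ)) := by
    intro δ
    by_cases hδ : Cell N δ ∧ height N δ = r + 1
    · have hne : δ ≠ 0 := by
        rintro rfl
        rw [height_zero] at hδ
        omega
      obtain ⟨i, hi⟩ := exists_first hne
      obtain ⟨s, hs, hDs⟩ := hD.exists_upper (m.toSyn δ) (M.elt (up N i δ, drop N i δ))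
        (elt_mem ⟨up_mem_valid hN hδ.1 hδ.2 hi.1, by
          show m.toSyn (up N i δ + drop N i δ) ≤ _
          rw [up_add_drop hi.1]⟩)
      refine ⟨M.elt (up N i δ, drop N i δ) - s, by rw [map_sub, hDs, sub_self],
        fun h => absurd hδ h, fun j _ _ hj => ?_⟩
      obtain rfl := hi.unique hj
      rw [sub_sub_cancel_left]
      exact neg_mem hs
    · exact ⟨0, map_zero _, fun _ => rfl, fun i h1 h2 => absurd ⟨h1, h2⟩ hδ⟩
  choose p hp0 hpz hp using h
  have hlc : ∀ δ, linearCombination A p (single δ 1) = p δ := fun δ => by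
    rw [linearCombination_single, one_smul]
  refine ⟨linearCombination A p, ⟨fun δ hδ => ?_, fun δ i h1 h2 h3 => ?_⟩, fun q => ?_⟩
  · rw [hlc, hpz δ hδ]
  · rw [hlc]
    exact hp δ i h1 h2 h3
  · rw [linearCombination_apply, Finsupp.sum, map_sum]
    exact Finset.sum_eq_zero fun δ _ => by rw [map_smul, hp0, smul_zero]

variable {r : ℕ} {D : ((Fin n →₀ ℕ) →₀ A) →ₗ[A] ((Fin n →₀ ℕ) →₀ A)}

theorem upper_subset (r : ℕ) : upper N r ⊆ valid N r := fun _ h => h.1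

theorem IsBoundary.single_mem (hN : ∀ i, N i ≠ 1) (hD : M.IsBoundary r D) {δ : Fin n →₀ ℕ}
    (hδ : Cell N δ) (hr : height N δ = r + 1) :
    D (single δ 1) ∈ M.sp (valid N r ∩ dle m (m.toSyn δ)) := by
  have hne : δ ≠ 0 := by
    rintro rfl
    rw [height_zero] at hr
    omega
  obtain ⟨i, hi⟩ := exists_first hne
  rw [← sub_add_cancel (D (single δ 1))]
  refine add_mem (sp_mono (Set.inter_subset_inter_left _ (upper_subset r))
    (hD.single_sub_mem δ i hδ hr hi)) (elt_mem ⟨up_mem_valid hN hδ hr hi.1, ?_⟩)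
  show m.toSyn (up N i δ + drop N i δ) ≤ _
  rw [up_add_drop hi.1]

theorem IsBoundary.map_mem_dle (hN : ∀ i, N i ≠ 1) (hD : M.IsBoundary r D) {g : m.syn} {p}
    (hp : p ∈ M.sp (valid N (r + 1) ∩ dle m g)) : D p ∈ M.sp (valid N r ∩ dle m g) := by
  refine map_mem (D.restrictScalars k) (fun x hx _ => ?_) hp
  rw [LinearMap.restrictScalars_apply, M.elt_eq_smul, map_smul]
  refine sp_mono (Set.inter_subset_inter_right _ fun y hy => le_trans ?_ hx.2)
    (smul_mem_dle (hD.single_mem hN hx.1.2.1 hx.1.2.2))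
  exact le_of_le_of_eq hy (map_add _ _ _).symm

/-- There are two sources of error: the upper corrections, controlled by `key_add_lt`, and the
smaller monomials in the product of `x^α` with the coefficient of the first face. -/
theorem IsBoundary.exists_sub_mem (hN : ∀ i, N i ≠ 1) (hD : M.IsBoundary r D) {x} {i : Fin n}
    (hx : x ∈ valid N (r + 1)) (hi : FirstTop N i x) :
    ∃ c : k, c ≠ 0 ∧ D (M.elt x) - c • M.elt (face N i x) ∈
      M.sp (valid N r ∩ {y | key m y < key m (face N i x)}) := by
  refine ⟨M.lc x.1 (up N i x.2), M.lc_ne_zero _ _, ?_⟩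
  have e : D (M.elt x) - M.lc x.1 (up N i x.2) • M.elt (face N i x) =
      M.mon x.1 • (D (single x.2 1) - M.elt (up N i x.2, drop N i x.2)) +
      (M.mon x.1 • M.elt (up N i x.2, drop N i x.2) -
        M.lc x.1 (up N i x.2) • M.elt (x.1 + up N i x.2, drop N i x.2)) := by
    rw [M.elt_eq_smul x, map_smul, smul_sub, face]
    abel
  have hlt : ∀ (y z : (Fin n →₀ ℕ) × (Fin n →₀ ℕ)) (γ : Fin n →₀ ℕ), y.2 = z.2 →
      m.toSyn y.1 < m.toSyn γ → key m y < key m (γ, z.2) := by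
    intro y z γ h2 h1
    rw [key_lt_iff, h2, map_add, map_add]
    exact Or.inl (add_lt_add_left h1 _)
  rw [e]
  refine add_mem ?_ ?_
  · refine smul_mem_valid (Set.inter_subset_left.trans (upper_subset r))
      (hD.single_sub_mem x.2 i hx.2.1 hx.2.2 hi.first) _ fun z hz y h2 h1 => ?_
    have hk := key_add_lt (m := m) hN hx.2.1 hi.first hz.1 hz.2 x.1
    rcases h1 with h1 | h1
    · have hy : y = (x.1 + z.1, z.2) := Prod.ext h1 h2
      rw [hy]
      exact hk
    · exact (hlt y z _ h2 h1).trans hk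
  · refine sp_le (W := M.sp (valid N r ∩ {y | key m y < key m (face N i x)}))
      (fun y hy hb => elt_mem ⟨⟨hb, ?_⟩, ?_⟩) (smul_elt_sub_mem _ _)
    · rw [hy.1]
      exact (face_mem_valid hN hx hi).2
    · exact hlt y (up N i x.2, drop N i x.2) _ hy.1 hy.2

/-- Triangularity: the face of the largest pair in the support occurs in the image of no other pair
of the support, by `face_lt_face`. -/
theorem IsBoundary.inj (hN : ∀ i, N i ≠ 1) (hD : M.IsBoundary r D) {s}
    (hs : s ∈ M.sp (upper N (r + 1))) (h0 : D s = 0) : s = 0 := by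
  obtain ⟨l, hl, rfl⟩ := (Finsupp.mem_span_image_iff_linearCombination k).mp hs
  by_contra hne
  have hl0 : l.support.Nonempty := by
    rw [Finset.nonempty_iff_ne_empty]
    intro h
    rw [Finsupp.support_eq_empty] at h
    exact hne (by rw [h, map_zero])
  obtain ⟨x, hx, hmax⟩ := Finset.exists_max_image l.support (key m) hl0
  have hup : ∀ y ∈ l.support, y ∈ upper N (r + 1) := fun y hy =>
    (Finsupp.mem_supported k l).mp hl hy
  obtain ⟨i, hi⟩ := exists_firstTop (hup x hx)
  obtain ⟨c, hc, hcm⟩ := hD.exists_sub_mem hN (hup x hx).1 hi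
  have hfx := face_mem_valid hN (hup x hx).1 hi
  have hcx : M.cof (face N i x) (D (M.elt x)) = c := by
    have := cof_eq_zero hcm (x := face N i x) (fun h => lt_irrefl (key m (face N i x)) h.2)
    rw [map_sub, map_smul, M.cof_elt _ hfx.1, if_pos rfl, smul_eq_mul, mul_one] at this
    exact sub_eq_zero.mp this
  have hother : ∀ y ∈ l.support, y ≠ x → M.cof (face N i x) (D (M.elt y)) = 0 := by
    intro y hy hyx
    obtain ⟨j, hj⟩ := exists_firstTop (hup y hy)
    obtain ⟨c', -, hcm'⟩ := hD.exists_sub_mem hN (hup y hy).1 hj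
    have hlt := face_lt_face hj hi (lt_of_le_of_ne (hmax y hy) fun h => hyx (key_injective h))
    have := cof_eq_zero hcm' (x := face N i x) (fun h => lt_asymm hlt h.2)
    rw [map_sub, map_smul, M.cof_elt _ (face_mem_valid hN (hup y hy).1 hj).1,
      if_neg (fun h => hlt.ne (congrArg _ h.symm)), smul_zero, sub_zero] at this
    exact this
  have hsum : M.cof (face N i x) (D (linearCombination k M.elt l)) = l x * c := by
    have : D (linearCombination k M.elt l) = D.restrictScalars k (linearCombination k M.elt l) := rfl
    rw [this, linearCombination_apply, Finsupp.sum, map_sum, map_sum,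
      Finset.sum_eq_single_of_mem x hx]
    · rw [map_smul, map_smul, LinearMap.restrictScalars_apply, hcx, smul_eq_mul]
    · intro y hy hyx
      rw [map_smul, map_smul, LinearMap.restrictScalars_apply, hother y hy hyx, smul_zero]
  rw [h0, map_zero] at hsum
  exact mul_ne_zero (Finsupp.mem_support_iff.mp hx) hc hsum.symm

/-- A pair that is not upper is the leading face of an upper pair. Modulo the boundary of that pair
it is a combination of pairs with smaller key, and well-founded induction applies. -/
theorem IsBoundary.valid_le (hN : ∀ i, N i ≠ 1) (hD : M.IsBoundary r D) (g : m.syn) :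
    M.sp (valid N r ∩ dle m g) ≤ M.sp (upper N r ∩ dle m g) ⊔
      (M.sp (upper N (r + 1) ∩ dle m g)).map (D.restrictScalars k) := by
  have key : ∀ (κ : m.syn ×ₗ Lex (Fin n →₀ ℕ)), ∀ x ∈ valid N r ∩ dle m g, key m x = κ →
      M.elt x ∈ M.sp (upper N r ∩ dle m g) ⊔
        (M.sp (upper N (r + 1) ∩ dle m g)).map (D.restrictScalars k) := by
    intro κ
    induction κ using WellFoundedLT.induction with
    | ind κ ih =>
    rintro x hx rfl
    by_cases hu : x ∈ upper N r
    · exact Submodule.mem_sup_left (elt_mem ⟨hu, hx.2⟩)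
    obtain ⟨y, hy, i, hi, rfl⟩ := exists_face_eq hN hx.1 hu
    obtain ⟨c, hc, hmem⟩ := hD.exists_sub_mem hN hy.1 hi
    have hyg : y ∈ dle m g := by
      have := hx.2
      rw [dle, Set.mem_ofPred_eq, face_add hi.2.1] at this
      exact this
    have h1 : D (M.elt y) - c • M.elt (face N i y) ∈ M.sp (upper N r ∩ dle m g) ⊔
        (M.sp (upper N (r + 1) ∩ dle m g)).map (D.restrictScalars k) :=
      sp_le (fun z hz _ => ih _ hz.2 z ⟨hz.1, (deg_le_of_key_lt hz.2).trans hx.2⟩ rfl) hmem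
    have h2 : D (M.elt y) ∈ M.sp (upper N r ∩ dle m g) ⊔
        (M.sp (upper N (r + 1) ∩ dle m g)).map (D.restrictScalars k) :=
      Submodule.mem_sup_right ⟨_, elt_mem ⟨hy, hyg⟩, rfl⟩
    have h3 := Submodule.smul_mem _ c⁻¹ (sub_mem h2 h1)
    rwa [sub_sub_cancel, smul_smul, inv_mul_cancel₀ hc, one_smul] at h3
  exact sp_le fun x hx _ => key _ x hx rfl

theorem IsBoundary.exists_eq_add (hN : ∀ i, N i ≠ 1) (hD : M.IsBoundary r D) {g : m.syn} {z}
    (hz : z ∈ M.sp (valid N r ∩ dle m g)) : ∃ u ∈ M.sp (upper N r ∩ dle m g),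
      ∃ s ∈ M.sp (upper N (r + 1) ∩ dle m g), z = u + D s := by
  obtain ⟨u, hu, _, ⟨s, hs, rfl⟩, rfl⟩ := Submodule.mem_sup.mp (hD.valid_le hN g hz)
  exact ⟨u, hu, s, hs, rfl⟩

section

variable {Q : Type*} [AddCommGroup Q] [Module A Q] {D₀ : ((Fin n →₀ ℕ) →₀ A) →ₗ[A] Q}

/-- Modulo boundaries a cycle is upper, and upper cycles vanish. This is exactness, with a degree
bound on the preimage that the later lifting of chain maps needs. -/
theorem IsBoundary.exists_preimage (hN : ∀ i, N i ≠ 1) (hD : M.IsBoundary r D)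
    (h₀ : M.IsReduced r D₀) (hcomp : ∀ p, D₀ (D p) = 0) {g : m.syn} {z}
    (hz : z ∈ M.sp (valid N r ∩ dle m g)) (h0 : D₀ z = 0) :
    ∃ s ∈ M.sp (upper N (r + 1) ∩ dle m g), D s = z := by
  obtain ⟨u, hu, s, hs, rfl⟩ := hD.exists_eq_add hN hz
  rw [map_add, hcomp, add_zero] at h0
  rw [h₀.inj u (sp_mono Set.inter_subset_left hu) h0, zero_add]
  exact ⟨s, hs, rfl⟩

theorem IsBoundary.isReduced (hN : ∀ i, N i ≠ 1) (hD : M.IsBoundary r D)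
    (h₀ : M.IsReduced r D₀) (hcomp : ∀ p, D₀ (D p) = 0) : M.IsReduced (r + 1) D :=
  ⟨fun _ hs h0 => hD.inj hN hs h0, fun _ _ hz =>
    hD.exists_preimage hN h₀ hcomp (hD.map_mem_dle hN hz) (hcomp _)⟩

end

/-- The augmentation with values in the span of a vector `q`. -/
def augMap {Q : Type*} [AddCommGroup Q] [Module A Q] (q : Q) : ((Fin n →₀ ℕ) →₀ A) →ₗ[A] Q :=
  (LinearMap.toSpanSingleton A Q q) ∘ₗ lapply 0

theorem mem_upper_zero {x} (h : x ∈ upper N 0) : x = 0 := by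
  refine h.2.resolve_right ?_
  rintro ⟨i, hi⟩
  have := height_eq_zero_iff.mp h.1.2.2
  have h2 := hi.2.1
  simp [this] at h2

theorem isReduced_augMap {Q : Type*} [AddCommGroup Q] [Module A Q] (q : Q)
    (hq : ∀ a : A, a • q = algebraMap k A (M.ε a) • q)
    (hq0 : ∀ c : k, algebraMap k A c • q = 0 → c = 0) : M.IsReduced 0 (augMap (n := n) q) := by
  have hc : ∀ c : k, augMap (n := n) q (c • M.elt 0) = algebraMap k A c • q := by
    intro c
    simp [augMap, elt, M.mon_zero, Algebra.algebraMap_eq_smul_one]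
  constructor
  · intro s hs h0
    have hs' : s ∈ Submodule.span k {M.elt 0} := by
      refine Submodule.span_mono ?_ hs
      rintro _ ⟨x, hx, rfl⟩
      rw [mem_upper_zero hx]
      rfl
    obtain ⟨c, rfl⟩ := Submodule.mem_span_singleton.mp hs'
    rw [hc] at h0
    rw [hq0 c h0, zero_smul]
  · intro g z _
    -- In height zero the only upper element is `e_0`, so the scalar has to be the augmentation.
    refine ⟨M.ε (z 0) • M.elt 0, Submodule.smul_mem _ _ (elt_mem ⟨⟨⟨box_zero N, cell_zero N,
      height_zero N⟩, Or.inl rfl⟩, ?_⟩), ?_⟩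
    · show m.toSyn (0 + 0) ≤ g
      simp
    · rw [hc, ← hq]
      rfl

/-- The boundary maps of a resolution, together with the augmentation. -/
theorem exists_resolution (M : MonomialAlgebra k A m N) (hN : ∀ i, N i ≠ 1) {Q : Type*}
    [AddCommGroup Q] [Module A Q] (q : Q) (hq : ∀ a : A, a • q = algebraMap k A (M.ε a) • q)
    (hq0 : ∀ c : k, algebraMap k A c • q = 0 → c = 0) :
    ∃ D : ℕ → ((Fin n →₀ ℕ) →₀ A) →ₗ[A] ((Fin n →₀ ℕ) →₀ A),
      (∀ r, M.IsBoundary r (D r)) ∧ (∀ p, augMap q (D 0 p) = 0) ∧ (∀ r p, D r (D (r + 1) p) = 0) ∧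
      ∀ r, M.IsReduced (r + 1) (D r) := by
  have h0 := isReduced_augMap (M := M) q hq hq0
  obtain ⟨D₀, hD₀, hc₀⟩ := exists_isBoundary hN h0
  let S (r : ℕ) := {D // M.IsBoundary r D ∧ M.IsReduced (r + 1) D}
  have step : ∀ r (D : S r), ∃ D' : S (r + 1), ∀ p, D.1 (D'.1 p) = 0 := by
    intro r D
    obtain ⟨D', hD', hc'⟩ := exists_isBoundary hN D.2.2
    exact ⟨⟨D', hD', hD'.isReduced hN D.2.2 hc'⟩, hc'⟩
  choose next hnext using step
  let F : ∀ r, S r := fun r => Nat.rec ⟨D₀, hD₀, hD₀.isReduced hN h0 hc₀⟩ (fun r D => next r D) r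
  exact ⟨fun r => (F r).1, fun r => (F r).2.1, hc₀, fun r p => hnext r (F r) p, fun r => (F r).2.2⟩

end MonomialAlgebra

end Anick

/-! ### Coefficients of extreme terms and maps that lower the degree. -/

namespace Anick

open Finsupp

section

variable {n : ℕ} {N : Fin n → ℕ}

theorem up_apply_self (i : Fin n) (δ : Fin n →₀ ℕ) : up N i δ i = step (N i) (δ i) := by
  simp [up]

theorem up_apply_ne {i j : Fin n} (h : j ≠ i) (δ : Fin n →₀ ℕ) : up N i δ j = 0 := by
  simp [up, single_eq_of_ne h]

theorem up_pos (hN : ∀ i, N i ≠ 1) {i : Fin n} {δ : Fin n →₀ ℕ} (hi : 0 < δ i) :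
    0 < up N i δ i := by
  rw [up_apply_self]
  exact step_pos (hN i) hi

theorem box_up_add_up (hN : ∀ i, N i ≠ 1) {i j : Fin n} (h : i ≠ j) (δ δ' : Fin n →₀ ℕ) :
    Box N (up N i δ + up N j δ') := by
  intro l
  rw [Finsupp.add_apply]
  by_cases hl : l = i
  · subst hl
    rw [up_apply_ne h, add_zero]
    exact box_up hN l δ l
  · rw [up_apply_ne hl, zero_add]
    exact box_up hN j δ' l

theorem up_not_mem_upper (hN : ∀ i, N i ≠ 1) {i : Fin n} {δ : Fin n →₀ ℕ} (hδ : Cell N δ)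
    (hi : First i δ) (r : ℕ) : (up N i δ, drop N i δ) ∉ upper N r := by
  rintro ⟨hv, h | ⟨j, hj⟩⟩
  · have := up_pos hN hi.1
    have h0 : up N i δ = 0 := (Prod.ext_iff.mp h).1
    rw [h0] at this
    exact lt_irrefl _ this
  · have h1 := hj.first_add
    simp only [up_add_drop hi.1] at h1
    obtain rfl := hi.unique h1
    have h2 := hj.2.2
    simp only [up_apply_self, drop_apply_self] at h2
    exact not_top_step (hN i) hi.1 (hδ i) h2

theorem up_ne (hN : ∀ i, N i ≠ 1) {i j : Fin n} {δ : Fin n →₀ ℕ} (h : i ≠ j) (hi : 0 < δ i) :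
    (up N i δ, drop N i δ) ≠ (up N j δ, drop N j δ) := by
  intro he
  have := up_pos hN hi
  have h0 : up N i δ = up N j δ := (Prod.ext_iff.mp he).1
  rw [h0, up_apply_ne h] at this
  exact lt_irrefl _ this

end

namespace MonomialAlgebra

variable {k A : Type*} [Field k] [Ring A] [Algebra k A] {n : ℕ}
  {m : MonomialOrder.{0, o} (Fin n)} {N : Fin n → ℕ} {M : MonomialAlgebra k A m N}

variable (m) in
/-- The pairs whose total degree is at most `g` when raised by `ν`. -/
def dles (ν : Fin n →₀ ℕ) (g : m.syn) : Set ((Fin n →₀ ℕ) × (Fin n →₀ ℕ)) :=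
  {x | m.toSyn (x.1 + x.2 + ν) ≤ g}

theorem dles_add (ν δ : Fin n →₀ ℕ) : dles m ν (m.toSyn (δ + ν)) = dle m (m.toSyn δ) := by
  ext x
  show m.toSyn (x.1 + x.2 + ν) ≤ _ ↔ m.toSyn (x.1 + x.2) ≤ _
  rw [map_add m.toSyn _ ν, map_add m.toSyn _ ν, add_le_add_iff_right]

/-- Degrees in `m.syn` cannot be subtracted, so `g - ν` is replaced by a bound taken from the terms
of `p`. If there are no terms such a bound may not exist, hence the separate zero case. -/
theorem mem_dles_or {T} {ν : Fin n →₀ ℕ} {g : m.syn} {p} (hp : p ∈ M.sp (T ∩ dles m ν g)) :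
    p = 0 ∨ ∃ g', g' + m.toSyn ν ≤ g ∧ p ∈ M.sp (T ∩ dle m g') := by
  induction hp using Submodule.span_induction with
  | mem _ h =>
    obtain ⟨x, hx, rfl⟩ := h
    exact Or.inr ⟨m.toSyn (x.1 + x.2), by rw [← map_add]; exact hx.2, elt_mem ⟨hx.1, le_rfl⟩⟩
  | zero => exact Or.inl rfl
  | add p q _ _ hp hq =>
    rcases hp with rfl | ⟨g₁, h₁, hg₁⟩
    · rwa [zero_add]
    rcases hq with rfl | ⟨g₂, h₂, hg₂⟩
    · rw [add_zero]
      exact Or.inr ⟨g₁, h₁, hg₁⟩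
    refine Or.inr ⟨max g₁ g₂, ?_, add_mem
      (sp_mono (Set.inter_subset_inter_right _ fun x hx => le_trans hx (le_max_left _ _)) hg₁)
      (sp_mono (Set.inter_subset_inter_right _ fun x hx => le_trans hx (le_max_right _ _)) hg₂)⟩
    rcases max_choice g₁ g₂ with h | h <;> rwa [h]
  | smul c p _ hp =>
    rcases hp with rfl | ⟨g₁, h₁, hg₁⟩
    · exact Or.inl (smul_zero c)
    · exact Or.inr ⟨g₁, h₁, Submodule.smul_mem _ _ hg₁⟩

theorem smul_mem_dles {α ν : Fin n →₀ ℕ} {r : ℕ} {g : m.syn} {p}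
    (hp : p ∈ M.sp (valid N r ∩ dles m ν g)) :
    M.mon α • p ∈ M.sp (valid N r ∩ dles m ν (m.toSyn α + g)) := by
  rcases mem_dles_or hp with rfl | ⟨g', hg', hp'⟩
  · rw [smul_zero]
    exact zero_mem _
  refine sp_mono (Set.inter_subset_inter_right _ fun x hx => ?_) (smul_mem_dle hp')
  show m.toSyn (x.1 + x.2 + ν) ≤ _
  rw [map_add]
  refine (add_le_add_left (show m.toSyn (x.1 + x.2) ≤ _ from hx) _).trans ?_
  rw [add_assoc]
  exact add_le_add_right hg' _

/-- The degree bound limits the exponents of `p` in the cell `δ` to at most `β`, so only the term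
`x^β e_δ` can reach `x^(α + β) e_δ`. -/
theorem cof_smul {α β δ : Fin n →₀ ℕ} {r : ℕ} (hb : Box N (α + β)) {p}
    (hp : p ∈ M.sp (valid N r ∩ dle m (m.toSyn (β + δ)))) :
    M.cof (α + β, δ) (M.mon α • p) = M.lc α β * M.cof (β, δ) p := by
  have hb' : Box N β := fun i => (hb i).imp_right fun h => by
    rw [Finsupp.add_apply] at h
    omega
  have key : M.sp (valid N r ∩ dle m (m.toSyn (β + δ))) ≤
      LinearMap.ker (M.cof (α + β, δ) ∘ₗ smulMap (M.mon α) - M.lc α β • M.cof (β, δ)) := by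
    refine sp_le fun x hx hxb => ?_
    rw [LinearMap.mem_ker, LinearMap.sub_apply, LinearMap.comp_apply, smulMap_apply,
      LinearMap.smul_apply, smul_eq_mul, M.cof_elt _ hxb]
    by_cases hxe : (β, δ) = x
    · subst hxe
      rw [if_pos rfl, mul_one]
      have := cof_eq_zero (smul_elt_sub_mem (M := M) α (β, δ)) (x := (α + β, δ))
        (fun h => lt_irrefl (m.toSyn (α + β)) h.2)
      rwa [map_sub, LinearMap.map_smul (M.cof (α + β, δ)) (M.lc α β),
        M.cof_elt (α + β, δ) (y := (α + β, δ)) hb, if_pos rfl, smul_eq_mul, mul_one] at this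
    · rw [if_neg hxe, mul_zero, sub_zero]
      refine cof_eq_zero (smul_elt_mem α x) ?_
      rintro ⟨h2, h1⟩
      have h2 : δ = x.2 := h2
      rcases h1 with h1 | h1
      · exact hxe (Prod.ext (add_left_cancel h1) h2)
      · have h1 : m.toSyn (α + β) < m.toSyn (α + x.1) := h1
        have h3 : m.toSyn (x.1 + x.2) ≤ m.toSyn (β + δ) := hx.2
        rw [map_add, map_add, add_lt_add_iff_left] at h1
        rw [h2, map_add, map_add, add_le_add_iff_right] at h3
        exact h3.not_gt h1
  have := key hp
  rw [LinearMap.mem_ker, LinearMap.sub_apply] at this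
  exact sub_eq_zero.mp this

/-- By the degree bounds, the exponents of the product in the cell `δ` are at most `τ`. The value
`τ` could only come from a leading term `α + x.1 = τ`, which would make `τ` a multiple of `α`. -/
theorem cof_smul_eq_zero {α τ δ ν : Fin n →₀ ℕ} {r : ℕ} {g : m.syn}
    (hg : m.toSyn α + g ≤ m.toSyn (τ + δ + ν)) (hα : ¬ α ≤ τ) {p}
    (hp : p ∈ M.sp (valid N r ∩ dles m ν g)) : M.cof (τ, δ) (M.mon α • p) = 0 := by
  refine map_mem (W := ⊥) (M.cof (τ, δ) ∘ₗ smulMap (M.mon α)) (fun x hx hxb => ?_) hp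
  refine cof_eq_zero (smul_elt_mem α x) ?_
  rintro ⟨h2, h1⟩
  have h2 : δ = x.2 := h2
  rcases h1 with h1 | h1
  · exact hα (le_self_add.trans_eq h1.symm)
  · have h1 : m.toSyn τ < m.toSyn (α + x.1) := h1
    have h3 : m.toSyn (x.1 + x.2 + ν) ≤ g := hx.2
    rw [h2] at hg
    have h4 := (add_le_add_right h3 (m.toSyn α)).trans hg
    rw [← map_add, ← add_assoc, ← add_assoc, map_add _ _ ν, map_add _ _ ν, add_le_add_iff_right,
      map_add _ _ x.2, map_add _ _ x.2, add_le_add_iff_right] at h4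
    exact h4.not_gt h1

theorem dles_zero (g : m.syn) : dles m 0 g = dle m g := by
  ext x
  show m.toSyn (x.1 + x.2 + 0) ≤ g ↔ m.toSyn (x.1 + x.2) ≤ g
  rw [add_zero]

/-! ### The resolution -/

/-- The cycles of a sequence of boundary maps. -/
def Cyc (M : MonomialAlgebra k A m N) (D : ℕ → ((Fin n →₀ ℕ) →₀ A) →ₗ[A] ((Fin n →₀ ℕ) →₀ A)) :
    ℕ → ((Fin n →₀ ℕ) →₀ A) → Prop
  | 0, z => M.ε (z 0) = 0
  | r + 1, z => D r z = 0

/-- `D` is the sequence of boundary maps of a resolution of the trivial module. -/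
structure IsResolution (M : MonomialAlgebra k A m N)
    (D : ℕ → ((Fin n →₀ ℕ) →₀ A) →ₗ[A] ((Fin n →₀ ℕ) →₀ A)) : Prop where
  boundary : ∀ r, M.IsBoundary r (D r)
  cyc : ∀ r p, M.Cyc D r (D r p)
  exact : ∀ r g, ∀ z ∈ M.sp (valid N r ∩ dle m g), M.Cyc D r z →
    ∃ s ∈ M.sp (valid N (r + 1) ∩ dle m g), D r s = z

theorem exists_isResolution (M : MonomialAlgebra k A m N) (hN : ∀ i, N i ≠ 1) :
    ∃ D, M.IsResolution D := by
  let : Module A k := Module.compHom k M.ε.toRingHom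
  have hsmul : ∀ (a : A) (c : k), a • c = M.ε a * c := fun _ _ => rfl
  have hq : ∀ a : A, a • (1 : k) = algebraMap k A (M.ε a) • (1 : k) := fun a => by
    rw [hsmul, hsmul, AlgHom.commutes]
    rfl
  have hq0 : ∀ c : k, algebraMap k A c • (1 : k) = 0 → c = 0 := fun c hc => by
    rw [hsmul, AlgHom.commutes, mul_one] at hc
    exact hc
  have haug : ∀ z : (Fin n →₀ ℕ) →₀ A, augMap (1 : k) z = M.ε (z 0) := fun z => by
    show z 0 • (1 : k) = _
    rw [hsmul, mul_one]
  obtain ⟨D, hD, h0, hDD, hred⟩ := exists_resolution M hN (1 : k) hq hq0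
  refine ⟨D, hD, ?_, ?_⟩
  · rintro (_ | r) p
    · show M.ε (D 0 p 0) = 0
      rw [← haug, h0]
    · exact hDD r p
  · rintro (_ | r) g z hz hc
    · obtain ⟨s, hs, h⟩ := (hD 0).exists_preimage hN (isReduced_augMap (M := M) (1 : k) hq hq0) h0 hz
        ((haug z).trans hc)
      exact ⟨s, sp_mono (Set.inter_subset_inter_left _ (upper_subset _)) hs, h⟩
    · obtain ⟨s, hs, h⟩ := (hD (r + 1)).exists_preimage hN (hred r) (hDD r) hz hc
      exact ⟨s, sp_mono (Set.inter_subset_inter_left _ (upper_subset _)) hs, h⟩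

variable {D : ℕ → ((Fin n →₀ ℕ) →₀ A) →ₗ[A] ((Fin n →₀ ℕ) →₀ A)}

theorem IsBoundary.cof_first (hN : ∀ i, N i ≠ 1) {r : ℕ} {D} (hD : M.IsBoundary r D)
    {δ : Fin n →₀ ℕ} {i : Fin n} (hδ : Cell N δ) (hr : height N δ = r + 1) (hi : First i δ) :
    M.cof (up N i δ, drop N i δ) (D (single δ 1)) = 1 := by
  have := cof_eq_zero (hD.single_sub_mem δ i hδ hr hi) (x := (up N i δ, drop N i δ))
    fun h => up_not_mem_upper hN hδ hi r h.1
  rw [map_sub, M.cof_elt _ (y := (up N i δ, drop N i δ)) (box_up hN i δ), if_pos rfl] at this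
  exact sub_eq_zero.mp this

theorem deg_cases {S} {x : (Fin n →₀ ℕ) × (Fin n →₀ ℕ)} {δ : Fin n →₀ ℕ}
    (hx : x ∈ S ∩ dle m (m.toSyn δ)) : m.toSyn (x.1 + x.2) < m.toSyn δ ∨ x.1 + x.2 = δ :=
  hx.2.lt_or_eq.imp_right fun h => m.toSyn.injective h

/-- All coefficients of the extreme terms of the boundary of a cell are nonzero. -/
theorem IsResolution.cof_ne_zero (hN : ∀ i, N i ≠ 1) (hD : M.IsResolution D) (r : ℕ) :
    ∀ (δ : Fin n →₀ ℕ) (j : Fin n), Cell N δ → height N δ = r + 1 → 0 < δ j →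
      M.cof (up N j δ, drop N j δ) (D r (single δ 1)) ≠ 0 := by
  induction r with
  | zero =>
    intro δ j hδ hr hj
    have hd : height N (drop N j δ) = 0 := by
      have := hδ.height_drop hN hj
      omega
    have hfirst : First j δ := by
      refine ⟨hj, fun l hl => ?_⟩
      rw [height_eq_zero_iff] at hd
      rw [← drop_apply_ne (N := N) hl.ne, hd]
      rfl
    rw [(hD.boundary 0).cof_first hN hδ hr hfirst]
    exact one_ne_zero
  | succ r ih =>
    intro δ j hδ hr hj
    have hne : δ ≠ 0 := by
      rintro rfl
      exact lt_irrefl _ hj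
    obtain ⟨i, hi⟩ := exists_first hne
    by_cases hij : i = j
    · subst hij
      rw [(hD.boundary _).cof_first hN hδ hr hi]
      exact one_ne_zero
    have hi' := hi.1
    have hci := hδ.drop hN hi'
    have hcj := hδ.drop hN hj
    have hhi : height N (drop N i δ) = r + 1 := by
      have := hδ.height_drop hN hi'
      omega
    have hhj : height N (drop N j δ) = r + 1 := by
      have := hδ.height_drop hN hj
      omega
    have hji : 0 < drop N i δ j := by rwa [drop_apply_ne (Ne.symm hij)]
    have hij' : 0 < drop N j δ i := by rwa [drop_apply_ne hij]
    have hdeg : up N i δ + up N j δ + drop N j (drop N i δ) = δ := by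
      rw [add_assoc, ← up_drop (N := N) (Ne.symm hij) δ, up_add_drop hji, up_add_drop hi']
    -- In total degree at most `δ`, only the `i`-th and `j`-th faces contribute to the chosen
    -- coefficient of `D r`. Smaller totals do not reach it, and a third face carries a power of `x
    -- l`. The `j`-th face contributes with factor `1`, since `i` is still its first index.
    have key : M.sp (valid N (r + 1) ∩ dle m (m.toSyn δ)) ≤ LinearMap.ker
        (M.cof (up N i δ + up N j δ, drop N j (drop N i δ)) ∘ₗ (D r).restrictScalars k -
          ((M.lc (up N i δ) (up N j δ) *
            M.cof (up N j (drop N i δ), drop N j (drop N i δ)) (D r (single (drop N i δ) 1))) •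
              M.cof (up N i δ, drop N i δ) +
            M.lc (up N j δ) (up N i δ) • M.cof (up N j δ, drop N j δ))) := by
      refine sp_le fun x hx hxb => ?_
      rw [LinearMap.mem_ker, LinearMap.sub_apply, LinearMap.comp_apply, LinearMap.add_apply,
        LinearMap.restrictScalars_apply, LinearMap.smul_apply, LinearMap.smul_apply,
        M.cof_elt _ hxb, M.cof_elt _ hxb]
      rcases deg_cases hx with hlt | heq
      · have h1 : (up N i δ, drop N i δ) ≠ x := by
          rintro rfl
          exact hlt.ne (by rw [up_add_drop hi'])
        have h2 : (up N j δ, drop N j δ) ≠ x := by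
          rintro rfl
          exact hlt.ne (by rw [up_add_drop hj])
        have h3 := (hD.boundary r).map_mem_dle hN
          (elt_mem (M := M) (x := x) (T := valid N (r + 1) ∩ dle m (m.toSyn (x.1 + x.2)))
            ⟨hx.1, le_rfl⟩)
        rw [if_neg h1, if_neg h2, cof_eq_zero h3 (fun h => (lt_of_le_of_lt h.2 hlt).ne
          (congrArg _ hdeg))]
        simp
      · obtain ⟨l, hl, hxl⟩ := eq_up_drop hN hx.1 (by rwa [heq]) (by rwa [heq])
        rw [heq] at hl hxl
        subst hxl
        rw [M.elt_eq_smul, map_smul]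
        have hmem := (hD.boundary r).single_mem hN (hδ.drop hN hl)
          (by have := hδ.height_drop hN hl; omega)
        by_cases hli : l = i
        · subst hli
          rw [if_pos rfl, if_neg (up_ne hN (Ne.symm hij) hj)]
          have e : up N j δ + drop N j (drop N l δ) = drop N l δ := by
            rw [← up_drop (N := N) (Ne.symm hij) δ, up_add_drop hji]
          rw [cof_smul (box_up_add_up hN hij δ δ) (by rwa [e]), up_drop (N := N) (Ne.symm hij) δ]
          simp
        by_cases hlj : l = j
        · subst hlj
          rw [if_pos rfl, if_neg (up_ne hN hij hi')]
          have e : up N i δ + drop N l (drop N i δ) = drop N l δ := by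
            rw [← drop_drop i l hij, ← up_drop (N := N) hij δ, up_add_drop hij']
          have hc := (hD.boundary r).cof_first hN hcj hhj (hi.drop hij)
          rw [up_drop hij, drop_drop i l hij] at hc
          rw [add_comm (up N i δ), cof_smul (box_up_add_up hN (Ne.symm hij) δ δ) (by rwa [e]), hc]
          simp
        · rw [if_neg (up_ne hN (Ne.symm hli) hi'), if_neg (up_ne hN (Ne.symm hlj) hj)]
          rw [← dles_zero] at hmem
          rw [cof_smul_eq_zero _ _ hmem]
          · simp
          · rw [← map_add, up_add_drop hl, hdeg, add_zero]
          · intro hle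
            have h1 : up N l δ l ≤ (up N i δ + up N j δ) l := hle l
            have h2 := up_pos hN hl
            rw [Finsupp.add_apply, up_apply_ne hli, up_apply_ne hlj] at h1
            omega
    -- Applied to `D r (D (r + 1) e_δ) = 0`, this balances the wanted coefficient against a
    -- coefficient of the `i`-th face, which is nonzero by induction.
    have hz := key ((hD.boundary (r + 1)).single_mem hN hδ hr)
    have hdd : D r (D (r + 1) (single δ 1)) = 0 := hD.cyc (r + 1) (single δ 1)
    rw [LinearMap.mem_ker, LinearMap.sub_apply, LinearMap.comp_apply,
      LinearMap.restrictScalars_apply, hdd, map_zero, LinearMap.add_apply, LinearMap.smul_apply,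
      LinearMap.smul_apply, (hD.boundary (r + 1)).cof_first hN hδ hr hi, smul_eq_mul, mul_one,
      smul_eq_mul] at hz
    intro h0
    rw [h0, mul_zero, add_zero, zero_sub, neg_eq_zero] at hz
    exact mul_ne_zero (M.lc_ne_zero _ _) (ih _ j hci hhi hji) hz

/-! ### Maps of degree `2` -/

/-- `X` maps cells of height `r + 2` to combinations of basis elements of height `r`, and lowers the
total degree by `ν`. -/
def IsShift (M : MonomialAlgebra k A m N) (ν : Fin n →₀ ℕ) (r : ℕ)
    (X : ((Fin n →₀ ℕ) →₀ A) →ₗ[A] ((Fin n →₀ ℕ) →₀ A)) : Prop :=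
  ∀ δ, Cell N δ → height N δ = r + 2 →
    X (single δ 1) ∈ M.sp (valid N r ∩ dles m ν (m.toSyn δ))

theorem IsShift.map_mem {ν : Fin n →₀ ℕ} {r : ℕ} {X} (hX : M.IsShift ν r X) {g : m.syn} {p}
    (hp : p ∈ M.sp (valid N (r + 2) ∩ dle m g)) : X p ∈ M.sp (valid N r ∩ dles m ν g) := by
  refine MonomialAlgebra.map_mem (X.restrictScalars k) (fun x hx _ => ?_) hp
  rw [LinearMap.restrictScalars_apply, M.elt_eq_smul, map_smul]
  refine sp_mono (Set.inter_subset_inter_right _ fun y hy => le_trans ?_ hx.2)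
    (smul_mem_dles (hX _ hx.1.2.1 hx.1.2.2))
  exact le_of_le_of_eq hy (map_add _ _ _).symm

/-- The comparison theorem with degree control: exactness gives preimages inside the same degree
bound. The recursion also carries the cycle condition that the next lift requires. -/
theorem IsResolution.exists_shift (hN : ∀ i, N i ≠ 1) (hD : M.IsResolution D) {ν : Fin n →₀ ℕ}
    {X₀ : ((Fin n →₀ ℕ) →₀ A) →ₗ[A] ((Fin n →₀ ℕ) →₀ A)} (hX₀ : M.IsShift ν 0 X₀)
    (hcyc : ∀ p, M.ε (X₀ (D 2 p) 0) = 0) :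
    ∃ X : ℕ → ((Fin n →₀ ℕ) →₀ A) →ₗ[A] ((Fin n →₀ ℕ) →₀ A), X 0 = X₀ ∧
      (∀ r, M.IsShift ν r (X r)) ∧ ∀ r p, D r (X (r + 1) p) = X r (D (r + 2) p) := by
  classical
  let S (r : ℕ) := {X : ((Fin n →₀ ℕ) →₀ A) →ₗ[A] ((Fin n →₀ ℕ) →₀ A) //
    M.IsShift ν r X ∧ ∀ p, M.Cyc D r (X (D (r + 2) p))}
  have step : ∀ r (X : S r), ∃ X' : S (r + 1), ∀ p, D r (X'.1 p) = X.1 (D (r + 2) p) := by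
    rintro r ⟨X, hX, hXc⟩
    have h : ∀ δ, ∃ p, D r p = X (D (r + 2) (single δ 1)) ∧
        (Cell N δ → height N δ = r + 3 → p ∈ M.sp (valid N (r + 1) ∩ dles m ν (m.toSyn δ))) := by
      intro δ
      by_cases hδ : Cell N δ ∧ height N δ = r + 3
      · have hz := hX.map_mem ((hD.boundary (r + 2)).single_mem hN hδ.1 hδ.2)
        rcases mem_dles_or hz with h0 | ⟨g, hg, hmem⟩
        · exact ⟨0, by rw [h0, map_zero], fun _ _ => zero_mem _⟩
        · obtain ⟨s, hs, h⟩ := hD.exact r g _ hmem (hXc _)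
          refine ⟨s, h, fun _ _ => sp_mono (Set.inter_subset_inter_right _ fun x hx => ?_) hs⟩
          show m.toSyn (x.1 + x.2 + ν) ≤ _
          rw [map_add]
          exact (add_le_add_left (show m.toSyn (x.1 + x.2) ≤ g from hx) _).trans hg
      · refine ⟨0, ?_, fun h1 h2 => absurd ⟨h1, h2⟩ hδ⟩
        rw [(hD.boundary (r + 2)).eq_zero δ hδ, map_zero, map_zero]
    choose p hp hmem using h
    have hlc : ∀ δ, linearCombination A p (single δ 1) = p δ := fun δ => by
      rw [linearCombination_single, one_smul]
    have hcomm : ∀ q, D r (linearCombination A p q) = X (D (r + 2) q) := by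
      intro q
      have : D r ∘ₗ linearCombination A p = X ∘ₗ D (r + 2) := by
        refine Finsupp.lhom_ext' fun δ => LinearMap.ext_ring ?_
        simp only [LinearMap.comp_apply, lsingle_apply, hlc]
        exact hp δ
      exact LinearMap.congr_fun this q
    refine ⟨⟨linearCombination A p, fun δ h1 h2 => ?_, fun q => ?_⟩, hcomm⟩
    · rw [hlc]
      exact hmem δ h1 h2
    · show D r _ = 0
      rw [hcomm]
      have : D (r + 2) (D (r + 1 + 2) q) = 0 := hD.cyc (r + 3) q
      rw [this, map_zero]
  choose next hnext using step
  let F : ∀ r, S r := fun r => Nat.rec ⟨X₀, hX₀, fun p => hcyc p⟩ (fun r X => next r X) r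
  exact ⟨fun r => (F r).1, rfl, fun r => (F r).2.1, fun r p => hnext r (F r) p⟩

/-- A degree `2` map of resolutions does not annihilate the periodicity of the cells if it does not
do so in the lowest degree. -/
theorem IsResolution.cof_shift_ne_zero (hN : ∀ i, N i ≠ 1) (hD : M.IsResolution D) {i : Fin n}
    (hi : N i ≠ 0) {X : ℕ → ((Fin n →₀ ℕ) →₀ A) →ₗ[A] ((Fin n →₀ ℕ) →₀ A)}
    (hX : ∀ r, M.IsShift (period N i) r (X r)) (hcomm : ∀ r p, D r (X (r + 1) p) = X r (D (r + 2) p))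
    (h0 : M.cof 0 (X 0 (single (period N i) 1)) ≠ 0) (r : ℕ) :
    ∀ δ : Fin n →₀ ℕ, Cell N δ → height N δ = r →
      M.cof (0, δ) (X r (single (δ + period N i) 1)) ≠ 0 := by
  induction r with
  | zero =>
    intro δ _ hr
    rw [height_eq_zero_iff.mp hr, zero_add]
    exact h0
  | succ r ih =>
    intro δ hδ hr
    have hne : δ ≠ 0 := by
      rintro rfl
      rw [height_zero] at hr
      omega
    obtain ⟨j, hj, -⟩ := exists_first hne
    have hj' : 0 < (δ + period N i) j := by
      rw [Finsupp.add_apply]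
      omega
    have hδ' := hδ.add_period i
    have hr' : height N (δ + period N i) = r + 2 + 1 := by
      rw [height_add_period δ hi, hr]
    have hz := hX (r + 1) _ hδ' (by rw [hr'])
    rw [dles_add] at hz
    have hw := (hD.boundary (r + 2)).single_mem hN hδ' hr'
    -- Only `e_δ` itself can contribute to the `j`-th face of `δ` under `D r`.
    have key1 : M.sp (valid N (r + 1) ∩ dle m (m.toSyn δ)) ≤ LinearMap.ker
        (M.cof (up N j δ, drop N j δ) ∘ₗ (D r).restrictScalars k -
          M.cof (up N j δ, drop N j δ) (D r (single δ 1)) • M.cof (0, δ)) := by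
      refine sp_le fun x hx hxb => ?_
      rw [LinearMap.mem_ker, LinearMap.sub_apply, LinearMap.comp_apply,
        LinearMap.restrictScalars_apply, LinearMap.smul_apply, M.cof_elt _ hxb]
      rcases deg_cases hx with hlt | heq
      · have h1 : (0, δ) ≠ x := by
          rintro rfl
          exact hlt.ne (by rw [zero_add])
        have h3 := (hD.boundary r).map_mem_dle hN
          (elt_mem (M := M) (x := x) (T := valid N (r + 1) ∩ dle m (m.toSyn (x.1 + x.2)))
            ⟨hx.1, le_rfl⟩)
        rw [if_neg h1, cof_eq_zero h3 (fun h => (lt_of_le_of_lt h.2 hlt).ne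
          (congrArg _ (up_add_drop hj)))]
        simp
      · have h1 := fst_eq_zero_of_height hN hx.1 (by rwa [heq]) (by rw [heq, hr])
        have h2 : x = (0, δ) := Prod.ext h1 (by rw [← heq, h1, zero_add])
        subst h2
        rw [M.elt_zero_fst]
        simp
    -- Only the `j`-th face of `δ + period N i` can contribute to the same coefficient under `X r`.
    have key2 : M.sp (valid N (r + 2) ∩ dle m (m.toSyn (δ + period N i))) ≤ LinearMap.ker
        (M.cof (up N j δ, drop N j δ) ∘ₗ (X r).restrictScalars k -
          (M.lc (up N j δ) 0 * M.cof (0, drop N j δ) (X r (single (drop N j δ + period N i) 1))) •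
            M.cof (up N j δ, drop N j δ + period N i)) := by
      refine sp_le fun x hx hxb => ?_
      rw [LinearMap.mem_ker, LinearMap.sub_apply, LinearMap.comp_apply,
        LinearMap.restrictScalars_apply, LinearMap.smul_apply, M.cof_elt _ hxb]
      have hdeg : up N j δ + (drop N j δ + period N i) = δ + period N i := by
        rw [← add_assoc, up_add_drop hj]
      rcases deg_cases hx with hlt | heq
      · have h1 : (up N j δ, drop N j δ + period N i) ≠ x := by
          rintro rfl
          exact hlt.ne (by rw [hdeg])
        have h3 := (hX r).map_mem
          (elt_mem (M := M) (x := x) (T := valid N (r + 2) ∩ dle m (m.toSyn (x.1 + x.2)))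
            ⟨hx.1, le_rfl⟩)
        rw [if_neg h1, cof_eq_zero h3 (fun h => (lt_of_le_of_lt h.2 hlt).ne
          (by show m.toSyn (up N j δ + drop N j δ + period N i) = _; rw [up_add_drop hj]))]
        simp
      · obtain ⟨l, hl, hxl⟩ := eq_up_drop hN hx.1 (by rwa [heq]) (by rwa [heq])
        rw [heq] at hl hxl
        have hmem := hX r _ (hδ'.drop hN hl)
          (by have := hδ'.height_drop hN hl; omega)
        by_cases hlj : l = j
        · subst hlj
          rw [up_add_period, drop_add_period i hj] at hxl
          rw [drop_add_period i hj, dles_add] at hmem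
          subst hxl
          have h1 := cof_smul (M := M) (α := up N l δ) (β := 0) (δ := drop N l δ)
            (by rw [add_zero]; exact box_up hN l δ) (by rwa [zero_add])
          rw [add_zero] at h1
          rw [M.elt_eq_smul, map_smul, h1, if_pos rfl, smul_eq_mul, mul_one, sub_self]
        · have hup := up_pos hN hl
          have h1 : (up N j δ, drop N j δ + period N i) ≠ x := by
            rintro rfl
            have h0 : up N j δ = up N l (δ + period N i) := (Prod.ext_iff.mp hxl).1
            rw [← h0, up_apply_ne hlj] at hup
            exact lt_irrefl _ hup
          subst hxl
          rw [if_neg h1, M.elt_eq_smul, map_smul, cof_smul_eq_zero _ _ hmem]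
          · simp
          · rw [← map_add, up_add_drop hl, up_add_drop hj]
          · intro hle
            have h2 : up N l (δ + period N i) l ≤ up N j δ l := hle l
            rw [up_apply_ne hlj] at h2
            omega
    -- The identity `D X = X D` on the shifted cell equates a multiple of the wanted coefficient
    -- with a product of a structure scalar, an inductive coefficient and a face coefficient, all
    -- nonzero.
    have e1 := key1 hz
    have e2 := key2 hw
    rw [LinearMap.mem_ker, LinearMap.sub_apply, LinearMap.comp_apply,
      LinearMap.restrictScalars_apply, LinearMap.smul_apply, sub_eq_zero] at e1 e2
    rw [hcomm, e2, smul_eq_mul, smul_eq_mul] at e1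
    have c1 := (hD.cof_ne_zero hN (r + 2)) (δ + period N i) j hδ' hr' hj'
    rw [up_add_period, drop_add_period i hj] at c1
    have c2 := ih (drop N j δ) (hδ.drop hN hj) (by have := hδ.height_drop hN hj; omega)
    intro hcon
    rw [hcon, mul_zero] at e1
    exact mul_ne_zero (mul_ne_zero (M.lc_ne_zero _ _) c2) c1 e1

end MonomialAlgebra

end Anick

namespace Anick

open Finsupp

namespace MonomialAlgebra

section

variable {k A : Type*} [Field k] [Ring A] [Algebra k A] {n : ℕ}
  {m : MonomialOrder.{0, o} (Fin n)} {N : Fin n → ℕ} {M : MonomialAlgebra k A m N}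
  {D : ℕ → ((Fin n →₀ ℕ) →₀ A) →ₗ[A] ((Fin n →₀ ℕ) →₀ A)}

/-! ### Periodicity operators from Hochschild cocycles -/

/-- A Hochschild `2`-cocycle with trivial coefficients that detects the relation `x_i ^ N_i = 0`. -/
structure PowerCocycle (M : MonomialAlgebra k A m N) (i : Fin n) where
  μ : A →ₗ[k] A →ₗ[k] k
  cocycle : ∀ a b c, M.ε a * μ b c + μ a (b * c) = μ a b * M.ε c + μ (a * b) c
  le_of_ne_zero : ∀ α β, μ (M.mon α) (M.mon β) ≠ 0 → m.toSyn (period N i) ≤ m.toSyn (α + β)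
  ne_zero : μ (M.mon (single i (N i - 1))) (M.mon (single i 1)) ≠ 0

/-- The functional on the module of cells induced by a cocycle. -/
def PowerCocycle.functional {i : Fin n} (c : M.PowerCocycle i)
    (D : ((Fin n →₀ ℕ) →₀ A) →ₗ[A] ((Fin n →₀ ℕ) →₀ A)) : ((Fin n →₀ ℕ) →₀ A) →ₗ[k] k :=
  lsum k fun δ => c.μ.flip (D (single δ 1) 0)

theorem PowerCocycle.functional_single {i : Fin n} (c : M.PowerCocycle i) (D) (δ : Fin n →₀ ℕ)
    (a : A) : c.functional D (single δ a) = c.μ a (D (single δ 1) 0) := by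
  simp [PowerCocycle.functional]

/-- This is the cocycle identity, whose term with `ε` of the last entry vanishes because boundaries
have augmentation zero. The functional is therefore linear over `A` on cycles. -/
theorem PowerCocycle.functional_smul {i : Fin n} (c : M.PowerCocycle i)
    {D : ((Fin n →₀ ℕ) →₀ A) →ₗ[A] ((Fin n →₀ ℕ) →₀ A)} (hD : ∀ p, M.ε (D p 0) = 0) (a : A)
    (p : (Fin n →₀ ℕ) →₀ A) :
    c.functional D (a • p) = M.ε a * c.functional D p + c.μ a (D p 0) := by
  induction p using Finsupp.induction_linear with
  | zero => simp
  | add p q hp hq =>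
    rw [smul_add, map_add, hp, hq, map_add, map_add, Finsupp.add_apply, map_add]
    ring
  | single δ b =>
    have e : D (single δ b) = b • D (single δ 1) := by rw [smul_single_eq b, map_smul]
    rw [smul_single, c.functional_single, c.functional_single, e, Finsupp.smul_apply, smul_eq_mul,
      smul_eq_mul, c.cocycle, hD, mul_zero, zero_add]

theorem PowerCocycle.functional_smul_of_eq_zero {i : Fin n} (c : M.PowerCocycle i)
    {D : ((Fin n →₀ ℕ) →₀ A) →ₗ[A] ((Fin n →₀ ℕ) →₀ A)} (hD : ∀ p, M.ε (D p 0) = 0) (a : A)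
    {p : (Fin n →₀ ℕ) →₀ A} (hp : D p = 0) :
    c.functional D (a • p) = M.ε a * c.functional D p := by
  rw [c.functional_smul hD, hp, Finsupp.zero_apply, map_zero, add_zero]

theorem cell_of_mem_valid_one (hN : ∀ i, N i ≠ 1) {δ : Fin n →₀ ℕ} (hδ : Cell N δ)
    (hr : height N δ = 1) : ∃ j, First j δ ∧ up N j δ = δ ∧ drop N j δ = 0 := by
  have hne : δ ≠ 0 := by
    rintro rfl
    rw [height_zero] at hr
    omega
  obtain ⟨j, hj⟩ := exists_first hne
  have hd : drop N j δ = 0 := by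
    rw [← height_eq_zero_iff (N := N)]
    have := hδ.height_drop hN hj.1
    omega
  refine ⟨j, hj, ?_, hd⟩
  have := up_add_drop (N := N) hj.1
  rwa [hd, add_zero] at this

/-- The only possible correction is a multiple of `e_0`, and the vanishing augmentation of a
boundary excludes it. -/
theorem IsResolution.zero_single (hN : ∀ i, N i ≠ 1) (hD : M.IsResolution D) {δ : Fin n →₀ ℕ}
    (hδ : Cell N δ) (hr : height N δ = 1) : D 0 (single δ 1) = M.elt (δ, 0) := by
  obtain ⟨j, hj, h1, h2⟩ := cell_of_mem_valid_one hN hδ hr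
  have hmem := (hD.boundary 0).single_sub_mem δ j hδ hr hj
  rw [h1, h2] at hmem
  have hne : δ ≠ 0 := by
    rintro rfl
    exact lt_irrefl _ hj.1
  have hs : D 0 (single δ 1) - M.elt (δ, 0) ∈ Submodule.span k {M.elt 0} := by
    refine Submodule.span_mono ?_ hmem
    rintro _ ⟨x, hx, rfl⟩
    rw [mem_upper_zero hx.1]
    rfl
  obtain ⟨c, hc⟩ := Submodule.mem_span_singleton.mp hs
  have h0 : M.ε ((D 0 (single δ 1) - M.elt (δ, 0)) 0) = 0 := by
    rw [Finsupp.sub_apply, map_sub, hD.cyc 0 (single δ 1)]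
    simp [elt, M.aug_mon δ hne]
  rw [← hc] at h0
  have hc0 : c = 0 := by simpa [elt, M.mon_zero] using h0
  rw [hc0, zero_smul] at hc
  exact sub_eq_zero.mp hc.symm

theorem IsResolution.functional_elt (hN : ∀ i, N i ≠ 1) (hD : M.IsResolution D) {i : Fin n}
    (c : M.PowerCocycle i) {x} (hx : x ∈ valid N 1) :
    c.functional (D 0) (M.elt x) = c.μ (M.mon x.1) (M.mon x.2) := by
  rw [elt, c.functional_single, hD.zero_single hN hx.2.1 hx.2.2]
  simp [elt]

theorem period_sub (i : Fin n) (hi : N i ≠ 0) :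
    up N i (period N i) = single i (N i - 1) ∧ drop N i (period N i) = single i 1 := by
  have h1 : up N i (period N i) = single i (N i - 1) := by
    rw [up, period, single_eq_same, step, Nat.mod_self, if_pos rfl]
  refine ⟨h1, ?_⟩
  rw [drop, h1, period, ← single_tsub]
  congr 1
  omega

theorem cell_period (i : Fin n) : Cell N (period N i) := by
  simpa using (cell_zero N).add_period i

theorem height_period {i : Fin n} (hi : N i ≠ 0) : height N (period N i) = 2 := by
  simpa [height_zero] using height_add_period (0 : Fin n →₀ ℕ) hi

/-- The cocycle ignores terms of degree below `period N i`. In that degree the only pair of height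
one is the face `x i ^ (N i - 1)` on the cell of `x i`, which is not among the upper corrections. -/
theorem IsResolution.functional_period_ne_zero (hN : ∀ i, N i ≠ 1) (hD : M.IsResolution D)
    {i : Fin n} (hi : N i ≠ 0) (c : M.PowerCocycle i) :
    c.functional (D 0) (D 1 (single (period N i) 1)) ≠ 0 := by
  have hpos : 0 < period N i i := by
    simp only [period, single_eq_same]
    omega
  have hfirst : First i (period N i) := ⟨hpos, fun j hj => by simp [period, single_eq_of_ne hj.ne]⟩
  have hmem := (hD.boundary 1).single_sub_mem _ i (cell_period i) (height_period hi) hfirst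
  have h0 := map_mem (W := ⊥) (c.functional (D 0)) (fun x hx _ => ?_) hmem
  · rw [Submodule.mem_bot, map_sub, sub_eq_zero, hD.functional_elt hN c
      (up_mem_valid hN (cell_period i) (height_period hi) hpos)] at h0
    rw [h0]
    simp only [(period_sub i hi).1, (period_sub i hi).2]
    exact c.ne_zero
  · rw [Submodule.mem_bot, hD.functional_elt hN c hx.1.1]
    by_contra hne
    have hle := c.le_of_ne_zero _ _ hne
    have heq : x.1 + x.2 = period N i := m.toSyn.injective (le_antisymm hx.2 hle)
    obtain ⟨l, hl, hxl⟩ := eq_up_drop hN hx.1.1 (by rw [heq]; exact cell_period i)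
      (by rw [heq]; exact height_period hi)
    rw [heq] at hl hxl
    have hli : l = i := by
      by_contra hli
      simp [period, single_eq_of_ne hli] at hl
    subst hli
    exact up_not_mem_upper hN (cell_period l) hfirst 1 (hxl ▸ hx.1)

/-- The map of modules of cells in the lowest degree induced by a cocycle. -/
def PowerCocycle.lift {i : Fin n} (c : M.PowerCocycle i)
    (D : ℕ → ((Fin n →₀ ℕ) →₀ A) →ₗ[A] ((Fin n →₀ ℕ) →₀ A)) :
    ((Fin n →₀ ℕ) →₀ A) →ₗ[A] ((Fin n →₀ ℕ) →₀ A) :=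
  linearCombination A fun δ => c.functional (D 0) (D 1 (single δ 1)) • M.elt 0

theorem PowerCocycle.lift_single {i : Fin n} (c : M.PowerCocycle i) (D) (δ : Fin n →₀ ℕ) :
    c.lift D (single δ 1) = c.functional (D 0) (D 1 (single δ 1)) • M.elt 0 := by
  rw [PowerCocycle.lift, linearCombination_single, one_smul]

theorem IsResolution.aug_lift (hD : M.IsResolution D) {i : Fin n} (c : M.PowerCocycle i)
    (p : (Fin n →₀ ℕ) →₀ A) : M.ε (c.lift D p 0) = c.functional (D 0) (D 1 p) := by
  induction p using Finsupp.induction_linear with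
  | zero => simp
  | add p q hp hq => rw [map_add, Finsupp.add_apply, map_add, hp, hq, map_add, map_add]
  | single δ a =>
    rw [smul_single_eq, map_smul, map_smul,
      c.functional_smul_of_eq_zero (hD.cyc 0) a (hD.cyc 1 (single δ 1)), c.lift_single]
    simp [elt, M.mon_zero, mul_comm]

/-- A cell below the period has a boundary of smaller degree, on which the cocycle vanishes. -/
theorem IsResolution.isShift_lift (hN : ∀ i, N i ≠ 1) (hD : M.IsResolution D) {i : Fin n}
    (c : M.PowerCocycle i) : M.IsShift (period N i) 0 (c.lift D) := by
  intro δ hδ hr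
  rw [c.lift_single]
  by_cases h0 : c.functional (D 0) (D 1 (single δ 1)) = 0
  · rw [h0, zero_smul]
    exact zero_mem _
  refine Submodule.smul_mem _ _ (elt_mem ⟨⟨box_zero N, cell_zero N, height_zero N⟩, ?_⟩)
  show m.toSyn (0 + 0 + period N i) ≤ m.toSyn δ
  rw [zero_add, zero_add]
  by_contra hlt
  refine h0 (map_mem (W := ⊥) (c.functional (D 0)) (fun x hx _ => ?_)
    ((hD.boundary 1).single_mem hN hδ hr))
  rw [Submodule.mem_bot, hD.functional_elt hN c hx.1]
  by_contra hne
  exact hlt ((c.le_of_ne_zero _ _ hne).trans hx.2)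

end

/-! ### The tower of syzygies -/

section Category

variable {k A : Type u} [Field k] [Ring A] [Algebra k A] {n : ℕ}
  {m : MonomialOrder.{0, o} (Fin n)} {N : Fin n → ℕ} {M : MonomialAlgebra k A m N}
  {D : ℕ → ((Fin n →₀ ℕ) →₀ A) →ₗ[A] ((Fin n →₀ ℕ) →₀ A)}

variable (A N) in
/-- The free module on the cells of height `r`. -/
def cells (r : ℕ) : Submodule A ((Fin n →₀ ℕ) →₀ A) :=
  supported A A {δ | Cell N δ ∧ height N δ = r}

variable (M D) in
/-- The submodule of cycles. -/
def cycles : ℕ → Submodule A ((Fin n →₀ ℕ) →₀ A)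
  | 0 => { carrier := {p | p ∈ cells A N 0 ∧ M.ε (p 0) = 0}
           add_mem' := fun ha hb => ⟨add_mem ha.1 hb.1, by
             rw [Finsupp.add_apply, map_add, ha.2, hb.2, add_zero]⟩
           zero_mem' := ⟨zero_mem _, by simp⟩
           smul_mem' := fun a p hp => ⟨Submodule.smul_mem _ a hp.1, by
             rw [Finsupp.smul_apply, smul_eq_mul, map_mul, hp.2, mul_zero]⟩ }
  | r + 1 => cells A N (r + 1) ⊓ LinearMap.ker (D r)

theorem mem_cycles {r : ℕ} {p} : p ∈ M.cycles D r ↔ p ∈ cells A N r ∧ M.Cyc D r p := by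
  cases r
  · exact Iff.rfl
  · exact Iff.rfl

theorem mem_cells_iff {r : ℕ} {p : (Fin n →₀ ℕ) →₀ A} :
    p ∈ cells A N r ↔ p ∈ M.sp (valid N r) := by
  constructor
  · intro hp
    rw [← Finsupp.sum_single p]
    refine sum_mem fun δ hδ => ?_
    have hδ' : Cell N δ ∧ height N δ = r := (mem_supported A p).mp hp hδ
    have : (⊤ : Submodule k A) ≤ (M.sp (valid N r)).comap (lsingle (R := k) δ) := by
      rw [← M.span_eq_top, Submodule.span_le]
      rintro _ ⟨α, rfl⟩
      by_cases hα : Box N α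
      · exact elt_mem (M := M) (x := (α, δ)) ⟨hα, hδ'⟩
      · rw [M.mon_eq_zero α hα]
        exact zero_mem _
    exact this (Submodule.mem_top (x := p δ))
  · intro hp
    have : M.sp (valid N r) ≤ (cells A N r).restrictScalars k :=
      sp_le fun x hx _ => single_mem_supported A _ hx.2
    exact this hp

theorem single_mem_cells {r : ℕ} {δ : Fin n →₀ ℕ} (h : Cell N δ ∧ height N δ = r) :
    single δ 1 ∈ cells A N r :=
  single_mem_supported A _ h

theorem IsResolution.map_mem_cells (hN : ∀ i, N i ≠ 1) (hD : M.IsResolution D) {r : ℕ} {p}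
    (hp : p ∈ cells A N (r + 1)) : D r p ∈ cells A N r := by
  rw [mem_cells_iff (M := M)] at hp ⊢
  obtain ⟨g, hg⟩ := exists_dle hp
  exact sp_mono Set.inter_subset_left ((hD.boundary r).map_mem_dle hN hg)

theorem IsShift.map_mem_cells {ν : Fin n →₀ ℕ} {r : ℕ} {X} (hX : M.IsShift ν r X) {p}
    (hp : p ∈ cells A N (r + 2)) : X p ∈ cells A N r := by
  rw [mem_cells_iff (M := M)] at hp ⊢
  obtain ⟨g, hg⟩ := exists_dle hp
  exact sp_mono Set.inter_subset_left (hX.map_mem hg)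

theorem IsResolution.exists_of_mem_cycles (hD : M.IsResolution D) {r : ℕ} {p}
    (hp : p ∈ M.cycles D r) : ∃ s ∈ cells A N (r + 1), D r s = p := by
  obtain ⟨h1, h2⟩ := mem_cycles.mp hp
  rw [mem_cells_iff (M := M)] at h1
  obtain ⟨g, hg⟩ := exists_dle h1
  obtain ⟨s, hs, h⟩ := hD.exact r g p hg h2
  refine ⟨s, ?_, h⟩
  rw [mem_cells_iff (M := M)]
  exact sp_mono Set.inter_subset_left hs

variable (M) in
/-- The augmentation of the module of cells of height `0`. -/
def augHom : ((Fin n →₀ ℕ) →₀ A) →ₗ[A] trivialModule M.ε where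
  toFun p := M.ε (p 0)
  map_add' p q := by
    rw [Finsupp.add_apply, map_add]
    rfl
  map_smul' a p := by
    rw [Finsupp.smul_apply, smul_eq_mul, map_mul]
    rfl

variable (M D) in
/-- The syzygies of the trivial module. -/
def syz : ℕ → ModuleCat.{u} A
  | 0 => trivialModule M.ε
  | r + 1 => ModuleCat.of A (M.cycles D r)

theorem IsResolution.map_mem_cycles (hN : ∀ i, N i ≠ 1) (hD : M.IsResolution D) {r : ℕ} {p}
    (hp : p ∈ cells A N (r + 1)) : D r p ∈ M.cycles D r :=
  mem_cycles.mpr ⟨hD.map_mem_cells hN hp, hD.cyc r p⟩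

/-- The projections onto the syzygies. -/
def IsResolution.proj (hN : ∀ i, N i ≠ 1) (hD : M.IsResolution D) :
    ∀ r, cells A N r →ₗ[A] M.syz D r
  | 0 => M.augHom ∘ₗ (cells A N 0).subtype
  | r + 1 => LinearMap.restrict (D r) (q := M.cycles D r) fun _ hp => hD.map_mem_cycles hN hp

theorem cycles_le (r : ℕ) : M.cycles D r ≤ cells A N r := fun _ h => (mem_cycles.mp h).1

theorem IsResolution.proj_eq_zero_iff (hN : ∀ i, N i ≠ 1) (hD : M.IsResolution D) (r : ℕ)
    (p : cells A N r) : hD.proj hN r p = 0 ↔ M.Cyc D r p := by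
  cases r with
  | zero => exact Iff.rfl
  | succ r => exact Subtype.ext_iff

theorem IsResolution.proj_surjective (hN : ∀ i, N i ≠ 1) (hD : M.IsResolution D) (r : ℕ) :
    Function.Surjective (hD.proj hN r) := by
  cases r with
  | zero =>
    intro (c : k)
    refine ⟨⟨single 0 (algebraMap k A c), single_mem_supported A _ ⟨cell_zero N, height_zero N⟩⟩, ?_⟩
    show M.ε (single (0 : Fin n →₀ ℕ) (algebraMap k A c) 0) = c
    rw [single_eq_same]
    exact M.ε.commutes c
  | succ r =>
    rintro ⟨p, hp⟩
    obtain ⟨s, hs, h⟩ := hD.exists_of_mem_cycles hp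
    exact ⟨⟨s, hs⟩, Subtype.ext h⟩

instance free_cells (r : ℕ) : Module.Free A (cells A N r) :=
  Module.Free.of_equiv (supportedEquivFinsupp _).symm

/-- The tower of syzygies of the trivial module. -/
def IsResolution.tower (hN : ∀ i, N i ≠ 1) (hD : M.IsResolution D) :
    Syzygy.Tower (ModuleCat.{u} A) where
  K := M.syz D
  P r := ModuleCat.of A (cells A N r)
  i r := ModuleCat.ofHom (Submodule.inclusion (cycles_le r))
  p r := ModuleCat.ofHom (hD.proj hN r)
  w r := by
    ext p
    exact (hD.proj_eq_zero_iff hN r _).mpr (mem_cycles.mp p.2).2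
  exact r := by
    refine ModuleCat.shortComplex_shortExact _ ?_ (Submodule.inclusion_injective (cycles_le r))
      (hD.proj_surjective hN r)
    intro p
    refine (hD.proj_eq_zero_iff hN r p).trans ⟨fun h => ⟨⟨p.1, mem_cycles.mpr ⟨p.2, h⟩⟩, rfl⟩, ?_⟩
    rintro ⟨q, rfl⟩
    exact (mem_cycles.mp q.2).2
  projective r := by
    have : Module.Projective A (cells A N r) := inferInstance
    exact (IsProjective.iff_projective _).mp this

end Category

end MonomialAlgebra

end Anick

/-! ### Leading cells of morphisms of syzygies and finite generation. -/

namespace Anick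

open Finsupp Syzygy

namespace MonomialAlgebra

section Category

variable {k A : Type u} [Field k] [Ring A] [Algebra k A] {n : ℕ}
  {m : MonomialOrder.{0, o} (Fin n)} {N : Fin n → ℕ} {M : MonomialAlgebra k A m N}
  {D : ℕ → ((Fin n →₀ ℕ) →₀ A) →ₗ[A] ((Fin n →₀ ℕ) →₀ A)}

/-- A cocycle as a linear functional on the first syzygies. -/
def IsResolution.cocycleHom (hD : M.IsResolution D) {i : Fin n} (c : M.PowerCocycle i) :
    M.cycles D 1 →ₗ[A] trivialModule M.ε where
  toFun p := c.functional (D 0) p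
  map_add' p q := map_add (c.functional (D 0)) p.1 q.1
  map_smul' a p := c.functional_smul_of_eq_zero (hD.cyc 0) a (mem_cycles.mp p.2).2

theorem IsResolution.shift_mem_cycles (hD : M.IsResolution D) {ν : Fin n →₀ ℕ}
    {X : ℕ → ((Fin n →₀ ℕ) →₀ A) →ₗ[A] ((Fin n →₀ ℕ) →₀ A)} (hX : ∀ r, M.IsShift ν r (X r))
    (hcomm : ∀ r p, D r (X (r + 1) p) = X r (D (r + 2) p)) (r : ℕ) {p}
    (hp : p ∈ M.cycles D (r + 2)) : X r p ∈ M.cycles D r := by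
  refine mem_cycles.mpr ⟨(hX r).map_mem_cells (cycles_le _ hp), ?_⟩
  obtain ⟨s, -, rfl⟩ := hD.exists_of_mem_cycles hp
  rw [← hcomm]
  exact hD.cyc r _

/-- The degree `2` endomorphism of the tower of syzygies that lifts a cocycle. -/
def IsResolution.shift (hN : ∀ i, N i ≠ 1) (hD : M.IsResolution D) {i : Fin n}
    (c : M.PowerCocycle i) {ν : Fin n →₀ ℕ}
    {X : ℕ → ((Fin n →₀ ℕ) →₀ A) →ₗ[A] ((Fin n →₀ ℕ) →₀ A)} (h0 : X 0 = c.lift D)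
    (hX : ∀ r, M.IsShift ν r (X r)) (hcomm : ∀ r p, D r (X (r + 1) p) = X r (D (r + 2) p)) :
    (hD.tower hN).Shift where
  g
    -- The bottom syzygy is `k` rather than a module of cycles, so here the cocycle functional
    -- itself is the map.
    | 0 => show ModuleCat.of A (M.cycles D 1) ⟶ ModuleCat.of A (trivialModule M.ε) from
        ModuleCat.ofHom (hD.cocycleHom c)
    | r + 1 => ModuleCat.ofHom (LinearMap.restrict (X r) (p := M.cycles D (r + 2))
        (q := M.cycles D r) fun _ hp => hD.shift_mem_cycles hX hcomm r hp)
  X r := ModuleCat.ofHom (LinearMap.restrict (X r) (p := cells A N (r + 2)) (q := cells A N r)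
    fun _ hp => (hX r).map_mem_cells hp)
  comm_i _ := rfl
  comm_p
    | 0 => by
      ext p
      show c.functional (D 0) (D 1 p.1) = M.ε (X 0 p.1 0)
      rw [h0, hD.aug_lift]
    | r + 1 => by
      ext p
      exact Subtype.ext (hcomm r p.1).symm

variable (D) in
/-- The functional on the module of cells with the given values on the cells. -/
def cochain (ε : A →ₐ[k] k) (f : (Fin n →₀ ℕ) → k) : ((Fin n →₀ ℕ) →₀ A) →ₗ[k] k :=
  lsum k fun δ => f δ • ε.toLinearMap

theorem cochain_elt (M : MonomialAlgebra k A m N) (f : (Fin n →₀ ℕ) → k) (x) :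
    cochain M.ε f (M.elt x) = if x.1 = 0 then f x.2 else 0 := by
  split_ifs with h
  · simp [cochain, elt, h, M.mon_zero]
  · simp [cochain, elt, M.aug_mon _ h]

open Classical in
/-- The value of a morphism of syzygies on a cell. -/
def IsResolution.value (hN : ∀ i, N i ≠ 1) (hD : M.IsResolution D) (r : ℕ)
    (α : M.syz D r ⟶ trivialModule M.ε) (δ : Fin n →₀ ℕ) : k :=
  if h : Cell N δ ∧ height N δ = r then α.hom (hD.proj hN r ⟨single δ 1, single_mem_cells h⟩) else 0

theorem IsResolution.value_of (hN : ∀ i, N i ≠ 1) (hD : M.IsResolution D) {r : ℕ}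
    (α : M.syz D r ⟶ trivialModule M.ε) {δ : Fin n →₀ ℕ} (h : Cell N δ ∧ height N δ = r) :
    hD.value hN r α δ = α.hom (hD.proj hN r ⟨single δ 1, single_mem_cells h⟩) := dif_pos h

theorem IsResolution.cell_of_value_ne_zero (hN : ∀ i, N i ≠ 1) (hD : M.IsResolution D) {r : ℕ}
    {α : M.syz D r ⟶ trivialModule M.ε} {δ : Fin n →₀ ℕ} (h : hD.value hN r α δ ≠ 0) :
    Cell N δ ∧ height N δ = r := by
  by_contra hcon
  exact h (dif_neg hcon)

theorem linearCombination_of_cells {r : ℕ} {Q : Type*} [AddCommGroup Q] [Module A Q]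
    (φ : cells A N r →ₗ[A] Q) (f : (Fin n →₀ ℕ) → Q)
    (hf : ∀ δ, (h : Cell N δ ∧ height N δ = r) → f δ = φ ⟨single δ 1, single_mem_cells h⟩)
    (p : cells A N r) : φ p = linearCombination A f p.1 := by
  obtain ⟨p, hp⟩ := p
  have hp' := hp
  rw [cells, supported_eq_span_single] at hp'
  induction hp' using Submodule.span_induction with
  | mem _ h =>
    obtain ⟨δ, hδ, rfl⟩ := h
    exact ((hf δ hδ).symm.trans (one_smul A _).symm).trans (linearCombination_single A 1 δ).symm
  | zero =>
    have e : (⟨0, hp⟩ : cells A N r) = 0 := rfl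
    rw [e, map_zero, Submodule.coe_zero, map_zero]
  | add p q hp1 hq1 ihp ihq =>
    have hp2 : p ∈ cells A N r := by rwa [cells, supported_eq_span_single]
    have hq2 : q ∈ cells A N r := by rwa [cells, supported_eq_span_single]
    have e : (⟨p + q, hp⟩ : cells A N r) = ⟨p, hp2⟩ + ⟨q, hq2⟩ := rfl
    rw [e, map_add, ihp hp2, ihq hq2, Submodule.coe_add, map_add]
  | smul a p hp1 ihp =>
    have hp2 : p ∈ cells A N r := by rwa [cells, supported_eq_span_single]
    have e : (⟨a • p, hp⟩ : cells A N r) = a • ⟨p, hp2⟩ := rfl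
    rw [e, map_smul, ihp hp2, Submodule.coe_smul, map_smul]

theorem linearCombination_trivialModule (ε : A →ₐ[k] k) (f : (Fin n →₀ ℕ) → k)
    (p : (Fin n →₀ ℕ) →₀ A) :
    linearCombination A (M := trivialModule ε) f p = (show trivialModule ε from cochain ε f p) := by
  induction p using Finsupp.induction_linear with
  | zero =>
    exact (map_zero (linearCombination A (M := trivialModule ε) f)).trans (map_zero (cochain ε f)).symm
  | add p q hp hq =>
    refine (map_add (linearCombination A (M := trivialModule ε) f) p q).trans ?_
    rw [hp, hq]
    exact (map_add (cochain ε f) p q).symm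
  | single δ a =>
    refine (linearCombination_single A (M := trivialModule ε) a δ).trans ?_
    have e : cochain ε f (single δ a) = f δ * ε a := by simp [cochain]
    exact (mul_comm (ε a) (f δ)).trans e.symm

theorem IsResolution.apply_proj (hN : ∀ i, N i ≠ 1) (hD : M.IsResolution D) {r : ℕ}
    (α : M.syz D r ⟶ trivialModule M.ε) (p : cells A N r) :
    α.hom (hD.proj hN r p) =
      (show trivialModule M.ε from cochain (k := k) M.ε (hD.value hN r α) p.1) := by
  obtain ⟨f, hf⟩ : ∃ f : (Fin n →₀ ℕ) → k, f = hD.value hN r α := ⟨_, rfl⟩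
  rw [← hf]
  exact (linearCombination_of_cells (α.hom ∘ₗ hD.proj hN r) f
    (fun δ h => (congrFun hf δ).trans (hD.value_of hN α h)) p).trans
      (linearCombination_trivialModule M.ε f p.1)

theorem IsResolution.eq_zero_of_value (hN : ∀ i, N i ≠ 1) (hD : M.IsResolution D) {r : ℕ}
    {α : M.syz D r ⟶ trivialModule M.ε} (h : hD.value hN r α = 0) : α = 0 := by
  ext y
  obtain ⟨p, rfl⟩ := hD.proj_surjective hN r y
  have h0 : cochain (k := k) M.ε (0 : (Fin n →₀ ℕ) → k) p.1 = 0 := by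
    simp [cochain, Finsupp.sum]
  rw [← h] at h0
  exact (hD.apply_proj hN α p).trans h0

/-- The values of morphisms of syzygies, as functions on the ordered set of degrees. -/
def IsResolution.ev (hN : ∀ i, N i ≠ 1) (hD : M.IsResolution D) (r : ℕ) :
    (M.syz D r ⟶ trivialModule M.ε) →ₗ[k] (m.syn → k) where
  toFun α ω := hD.value hN r α (m.toSyn.symm ω)
  map_add' α β := by
    funext ω
    by_cases h : Cell N (m.toSyn.symm ω) ∧ height N (m.toSyn.symm ω) = r
    · rw [Pi.add_apply, hD.value_of hN _ h, hD.value_of hN _ h, hD.value_of hN _ h]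
      rfl
    · simp [IsResolution.value, h]
  map_smul' a α := by
    funext ω
    by_cases h : Cell N (m.toSyn.symm ω) ∧ height N (m.toSyn.symm ω) = r
    · rw [Pi.smul_apply, hD.value_of hN _ h, hD.value_of hN _ h, RingHom.id_apply]
      exact congrArg (fun z : k => z * (show k from
        α.hom (hD.proj hN r ⟨single _ 1, single_mem_cells h⟩))) (M.ε.commutes a)
    · simp [IsResolution.value, h]

/-- A cell `δ'` in `p` with constant coefficient satisfies `δ' + ν ≤ δ ≤ δ₀ + ν`, hence `δ' ≤ δ₀`,
and `f` vanishes on all cells below `δ₀`. -/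
theorem cochain_shift {f : (Fin n →₀ ℕ) → k} {δ₀ ν δ : Fin n →₀ ℕ} {r : ℕ}
    (hf : ∀ δ, m.toSyn δ < m.toSyn δ₀ → f δ = 0) (hle : m.toSyn δ ≤ m.toSyn (δ₀ + ν)) {p}
    (hp : p ∈ M.sp (valid N r ∩ dles m ν (m.toSyn δ))) :
    cochain M.ε f p = M.cof (0, δ₀) p * f δ₀ := by
  have key : M.sp (valid N r ∩ dles m ν (m.toSyn δ)) ≤
      LinearMap.ker (cochain M.ε f - f δ₀ • M.cof (0, δ₀)) := by
    refine sp_le fun x hx hxb => ?_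
    rw [LinearMap.mem_ker, LinearMap.sub_apply, LinearMap.smul_apply, M.cof_elt _ hxb, cochain_elt]
    by_cases h0 : x.1 = 0
    · rw [if_pos h0]
      have h1 : m.toSyn (x.1 + x.2 + ν) ≤ m.toSyn (δ₀ + ν) := le_trans hx.2 hle
      rw [h0, zero_add, map_add, map_add, add_le_add_iff_right] at h1
      rcases h1.lt_or_eq with hlt | heq
      · rw [hf _ hlt, if_neg, smul_zero, sub_zero]
        rintro rfl
        exact lt_irrefl _ hlt
      · have heq := m.toSyn.injective heq
        rw [if_pos (Prod.ext h0.symm heq.symm), heq, smul_eq_mul, mul_one, sub_self]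
    · rw [if_neg h0, if_neg, smul_zero, sub_zero]
      rintro rfl
      exact h0 rfl
  have := key hp
  rw [LinearMap.mem_ker, LinearMap.sub_apply, sub_eq_zero] at this
  rw [this, LinearMap.smul_apply, smul_eq_mul, mul_comm]

theorem IsResolution.value_shift (hN : ∀ i, N i ≠ 1) (hD : M.IsResolution D) {i : Fin n}
    (c : M.PowerCocycle i) {ν : Fin n →₀ ℕ}
    {X : ℕ → ((Fin n →₀ ℕ) →₀ A) →ₗ[A] ((Fin n →₀ ℕ) →₀ A)} (h0 : X 0 = c.lift D)
    (hX : ∀ r, M.IsShift ν r (X r)) (hcomm : ∀ r p, D r (X (r + 1) p) = X r (D (r + 2) p))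
    {r : ℕ} (α : M.syz D r ⟶ trivialModule M.ε) {δ : Fin n →₀ ℕ}
    (h : Cell N δ ∧ height N δ = r + 2) :
    hD.value hN (r + 2) ((hD.shift hN c h0 hX hcomm).g r ≫ α) δ =
      cochain M.ε (hD.value hN r α) (X r (single δ 1)) := by
  rw [hD.value_of hN _ h]
  have e := congrArg (fun φ => α.hom (φ.hom ⟨single δ 1, single_mem_cells h⟩))
    ((hD.shift hN c h0 hX hcomm).comm_p r)
  exact e.trans (hD.apply_proj hN α ⟨X r (single δ 1), (hX r).map_mem_cells (single_mem_cells h)⟩)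

/-- At the shifted leading cell the value is the old leading value times a nonzero coefficient.
Below it the degree bound keeps `e_δ₀` out of the image, so the value is zero. -/
theorem IsResolution.isLead_shift (hN : ∀ i, N i ≠ 1) (hD : M.IsResolution D) {i : Fin n}
    (hi : N i ≠ 0) {r : ℕ} {X : ((Fin n →₀ ℕ) →₀ A) →ₗ[A] ((Fin n →₀ ℕ) →₀ A)}
    (hX : M.IsShift (period N i) r X)
    (hlead : ∀ δ : Fin n →₀ ℕ, Cell N δ → height N δ = r →
      M.cof (0, δ) (X (single (δ + period N i) 1)) ≠ 0)
    {α : M.syz D r ⟶ trivialModule M.ε} {β : M.syz D (r + 2) ⟶ trivialModule M.ε}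
    (hβ : ∀ δ, Cell N δ ∧ height N δ = r + 2 →
      hD.value hN (r + 2) β δ = cochain M.ε (hD.value hN r α) (X (single δ 1)))
    {ω : m.syn} (hω : IsLead (hD.ev hN r α) ω) :
    IsLead (hD.ev hN (r + 2) β) (ω + m.toSyn (period N i)) := by
  obtain ⟨δ₀, rfl⟩ := m.toSyn.surjective ω
  have hev : ∀ r (α : M.syz D r ⟶ trivialModule M.ε) δ,
      hD.ev hN r α (m.toSyn δ) = hD.value hN r α δ := fun r α δ => by
    simp [IsResolution.ev]
  have hf0 := hω.1
  rw [hev] at hf0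
  have hf : ∀ δ, m.toSyn δ < m.toSyn δ₀ → hD.value hN r α δ = 0 := fun δ hlt => by
    rw [← hev]
    exact hω.2 _ hlt
  have hc := hD.cell_of_value_ne_zero hN hf0
  rw [← map_add]
  constructor
  · have h2 : Cell N (δ₀ + period N i) ∧ height N (δ₀ + period N i) = r + 2 :=
      ⟨hc.1.add_period _, by rw [height_add_period _ hi, hc.2]⟩
    rw [hev, hβ _ h2, cochain_shift hf le_rfl (hX _ h2.1 h2.2)]
    exact mul_ne_zero (hlead δ₀ hc.1 hc.2) hf0
  · intro ω' hlt
    obtain ⟨δ, rfl⟩ := m.toSyn.surjective ω'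
    rw [hev]
    by_cases h2 : Cell N δ ∧ height N δ = r + 2
    · have hmem := hX _ h2.1 h2.2
      rw [hβ _ h2, cochain_shift hf hlt.le hmem, cof_eq_zero hmem, zero_mul]
      rintro ⟨-, h3⟩
      have h3 : m.toSyn (0 + δ₀ + period N i) ≤ m.toSyn δ := h3
      rw [zero_add] at h3
      exact h3.not_gt hlt
    · exact dif_neg h2

/-- The cohomology of an augmented algebra with a basis of truncated monomials is finitely generated,
if the truncations are detected by Hochschild cocycles. -/
theorem finiteType_cohomology (M : MonomialAlgebra k A m N) (hN : ∀ i, N i ≠ 1)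
    (c : ∀ i, N i ≠ 0 → M.PowerCocycle i) : Algebra.FiniteType k (CohomologyAlgebra M.ε) := by
  obtain ⟨D, hD⟩ := M.exists_isResolution hN
  have hshift : ∀ i : {i // N i ≠ 0}, ∃ X : ℕ → ((Fin n →₀ ℕ) →₀ A) →ₗ[A] ((Fin n →₀ ℕ) →₀ A),
      X 0 = (c i i.2).lift D ∧ (∀ r, M.IsShift (period N i.1) r (X r)) ∧
        ∀ r p, D r (X (r + 1) p) = X r (D (r + 2) p) := fun i =>
    hD.exists_shift hN (hD.isShift_lift hN (c i i.2)) fun p => by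
      have : D 1 (D 2 p) = 0 := hD.cyc 2 p
      rw [hD.aug_lift, this, map_zero]
  choose X hX0 hX hcomm using hshift
  have hlead : ∀ (i : {i // N i ≠ 0}) r (δ : Fin n →₀ ℕ), Cell N δ → height N δ = r →
      M.cof (0, δ) (X i r (single (δ + period N i.1) 1)) ≠ 0 := by
    intro i r
    refine hD.cof_shift_ne_zero hN i.2 (hX i) (hcomm i) ?_ r
    rw [hX0, (c i i.2).lift_single, map_smul, M.cof_elt 0 (y := 0) (box_zero N), if_pos rfl,
      smul_eq_mul, mul_one]
    exact hD.functional_period_ne_zero hN i.2 (c i i.2)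
  refine Tower.finiteType_of_isLead (R := hD.tower hN)
    (fun i : {i // N i ≠ 0} => hD.shift hN (c i i.2) (hX0 i) (hX i) (hcomm i))
    (fun i => m.toSyn (period N i.1)) (hD.ev hN) ?_
    (fun r => m.toSyn '' {δ | Cell N δ ∧ height N δ = r}) (fun r => (finite_cells N r).image _)
    ?_ ?_ ?_ ?_
  · intro r α h
    refine hD.eq_zero_of_value hN (funext fun δ => ?_)
    have e : hD.ev hN r α (m.toSyn δ) = hD.value hN r α δ := by simp [IsResolution.ev]
    exact e.symm.trans (congrFun h (m.toSyn δ))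
  · rintro r r' ω ⟨δ, hδ, rfl⟩ ⟨δ', hδ', h⟩
    obtain rfl := m.toSyn.injective h
    exact hδ.2.symm.trans hδ'.2
  · intro r α ω h
    exact ⟨m.toSyn.symm ω, hD.cell_of_value_ne_zero hN h, m.toSyn.apply_symm_apply ω⟩
  · intro i r α ω hω
    exact hD.isLead_shift hN i.2 (hX i r) (hlead i r)
      (fun δ h => hD.value_shift hN (c i i.2) (hX0 i) (hX i) (hcomm i) α h) hω
  · intro L hL
    have hcell : ∀ δ ∈ m.toSyn ⁻¹' L, Cell N δ := by
      intro δ hδ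
      obtain ⟨r, δ', hδ', h⟩ := Set.mem_iUnion.mp (hL hδ)
      rw [← m.toSyn.injective h]
      exact hδ'.1
    obtain ⟨S, hSL, hS, h⟩ := exists_finite_cells N _ hcell
    refine ⟨m.toSyn '' S, ?_, hS.image _, fun ω hω => ?_⟩
    · rintro _ ⟨δ, hδ, rfl⟩
      exact hSL hδ
    · obtain ⟨δ, rfl⟩ := m.toSyn.surjective ω
      obtain ⟨δ₀, h₀, z, hz, rfl⟩ := h δ hω
      refine ⟨m.toSyn δ₀, ⟨δ₀, h₀, rfl⟩, m.toSyn z, ?_, map_add _ _ _⟩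
      have := AddSubmonoid.mem_map_of_mem m.toSyn.toAddMonoidHom hz
      rw [AddMonoidHom.map_mclosure, ← Set.range_comp] at this
      exact this

end Category

end MonomialAlgebra

end Anick

namespace PBW

open Finsupp

/-! ### Products of words in the generators of a PBW algebra -/

section Word

variable {B : Type*} [Ring B] {n : ℕ} (x : Fin n → B)

/-- The increasing word in which each letter `i` occurs `α i` times. -/
def word (α : Fin n →₀ ℕ) : List (Fin n) :=
  (List.finRange n).flatMap fun i => List.replicate (α i) i

/-- The number of occurrences of each letter. -/
def weight (l : List (Fin n)) : Fin n →₀ ℕ := Multiset.toFinsupp (l : Multiset (Fin n))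

theorem weight_append (l l' : List (Fin n)) : weight (l ++ l') = weight l + weight l' := by
  rw [weight, ← Multiset.coe_add, map_add]
  rfl

theorem weight_replicate (a : ℕ) (i : Fin n) : weight (List.replicate a i) = single i a := by
  ext j
  simp [weight, List.count_replicate, single_apply]

theorem perm_iff_weight_eq {l l' : List (Fin n)} : l.Perm l' ↔ weight l = weight l' := by
  rw [weight, weight, Multiset.toFinsupp.injective.eq_iff, Multiset.coe_eq_coe]

theorem weight_word (α : Fin n →₀ ℕ) : weight (word α) = α := by
  ext j
  have : (fun i => List.count j (List.replicate (α i) i)) = fun i => if i = j then α j else 0 := by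
    funext i
    rw [List.count_replicate]
    by_cases h : i = j <;> simp [h]
  simp [weight, word, List.count_flatMap, Function.comp_def, this, ← Fin.sum_univ_def]

theorem pairwise_word (α : Fin n →₀ ℕ) : (word α).Pairwise (· ≤ ·) := by
  rw [word, List.pairwise_flatMap]
  refine ⟨fun i _ => List.pairwise_replicate.2 (Or.inr le_rfl), ?_⟩
  refine (List.pairwise_lt_finRange n).imp fun {i j} hij a ha b hb => ?_
  rw [List.eq_of_mem_replicate ha, List.eq_of_mem_replicate hb]
  exact hij.le

theorem mem_word {α : Fin n →₀ ℕ} {i : Fin n} : i ∈ word α ↔ α i ≠ 0 := by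
  simp [word, List.mem_replicate]

theorem word_add {α β : Fin n →₀ ℕ} (h : ∀ i j, α i ≠ 0 → β j ≠ 0 → i ≤ j) :
    word (α + β) = word α ++ word β := by
  refine List.Perm.eq_of_pairwise (le := (· ≤ ·)) (fun _ _ _ _ => le_antisymm) (pairwise_word _)
    ?_ ?_
  · exact List.pairwise_append.2 ⟨pairwise_word _, pairwise_word _,
      fun i hi j hj => h i j (mem_word.1 hi) (mem_word.1 hj)⟩
  · rw [perm_iff_weight_eq, weight_append, weight_word, weight_word, weight_word]

theorem word_single (i : Fin n) (a : ℕ) : word (single i a) = List.replicate a i := by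
  rw [← List.perm_replicate, perm_iff_weight_eq, weight_word, weight_replicate]

theorem monomial_eq (α : Fin n →₀ ℕ) : monomial x α = ((word α).map x).prod := by
  rw [monomial, List.ofFn_eq_map, word, List.map_flatMap, List.flatMap_def, List.prod_flatten,
    List.map_map]
  simp [Function.comp_def]

theorem monomial_add {α β : Fin n →₀ ℕ} (h : ∀ i j, α i ≠ 0 → β j ≠ 0 → i ≤ j) :
    monomial x (α + β) = monomial x α * monomial x β := by
  rw [monomial_eq, monomial_eq, monomial_eq, word_add h, List.map_append, List.prod_append]

theorem monomial_single (i : Fin n) (a : ℕ) : monomial x (single i a) = x i ^ a := by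
  rw [monomial_eq, word_single, List.map_replicate, List.prod_replicate]

theorem monomial_zero : monomial x 0 = 1 := by simp [monomial]

end Word

variable {k B : Type*} [Field k] [Ring B] [Algebra k B] {n : ℕ} {x : Fin n → B}
  {m : MonomialOrder.{0, o} (Fin n)} {q : Fin n → Fin n → kˣ}

variable (k x m) in
/-- The span of the ordered monomials of degree less than `γ`. -/
def lower (γ : Fin n →₀ ℕ) : Submodule k B :=
  Submodule.span k (monomial x '' {α | m.toSyn α < m.toSyn γ})

theorem lower_mono {γ γ' : Fin n →₀ ℕ} (h : m.toSyn γ ≤ m.toSyn γ') :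
    lower k x m γ ≤ lower k x m γ' :=
  Submodule.span_mono (Set.image_mono fun _ hα => lt_of_lt_of_le hα h)

theorem monomial_mem_lower {α γ : Fin n →₀ ℕ} (h : m.toSyn α < m.toSyn γ) :
    monomial x α ∈ lower k x m γ :=
  Submodule.subset_span (Set.mem_image_of_mem _ h)

variable (k x m) in
/-- Every word of degree `γ` has the leading term of the ordered monomial of degree `γ`. -/
def Sortable (γ : Fin n →₀ ℕ) : Prop :=
  ∀ l : List (Fin n), weight l = γ →
    ∃ c : k, c ≠ 0 ∧ (l.map x).prod - c • monomial x γ ∈ lower k x m γ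

/-- Each monomial of `p`, flanked by `u` and `v`, is a word of degree below `γ`, which the induction
hypothesis can sort. -/
theorem mul_lower_mul_mem {γ δ : Fin n →₀ ℕ}
    (ih : ∀ γ', m.toSyn γ' < m.toSyn γ → Sortable k x m γ') (u v : List (Fin n))
    (h : weight u + δ + weight v = γ) {p : B} (hp : p ∈ lower k x m δ) :
    (u.map x).prod * p * (v.map x).prod ∈ lower k x m γ := by
  induction hp using Submodule.span_induction with
  | mem _ hp =>
    obtain ⟨α, hα, rfl⟩ := hp
    have hα : m.toSyn α < m.toSyn δ := hα
    have hw : weight (u ++ word α ++ v) = weight u + α + weight v := by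
      rw [weight_append, weight_append, weight_word]
    have hlt : m.toSyn (weight u + α + weight v) < m.toSyn γ := by
      rw [← h]
      simpa only [map_add, add_lt_add_iff_right, add_lt_add_iff_left] using hα
    obtain ⟨c, -, hc⟩ := ih _ hlt _ hw
    rw [monomial_eq, ← List.prod_append, ← List.map_append, ← List.prod_append, ← List.map_append]
    have := add_mem (lower_mono hlt.le hc) ((lower k x m γ).smul_mem c (monomial_mem_lower hlt))
    rwa [sub_add_cancel] at this
  | zero => simp
  | add p p' _ _ hp hp' =>
    rw [mul_add, add_mul]
    exact add_mem hp hp'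
  | smul c p _ hp =>
    rw [mul_smul_comm, smul_mul_assoc]
    exact Submodule.smul_mem _ c hp

theorem IsPBWAlgebra.exists_swap (h : IsPBWAlgebra x m q) (i j : Fin n) : ∃ c : k, c ≠ 0 ∧
    x i * x j - c • (x j * x i) ∈ lower k x m (single i 1 + single j 1) := by
  rcases lt_trichotomy i j with hij | rfl | hij
  · exact ⟨q i j, Units.ne_zero _, h.commutation i j hij⟩
  · exact ⟨1, one_ne_zero, by simp⟩
  · refine ⟨(q j i : k)⁻¹, inv_ne_zero (Units.ne_zero _), ?_⟩
    have := Submodule.smul_mem (lower k x m (single j 1 + single i 1)) (-(q j i : k)⁻¹)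
      (h.commutation j i hij)
    rw [add_comm (single j 1)] at this
    rw [smul_sub, smul_smul, neg_mul, inv_mul_cancel₀ (Units.ne_zero _)] at this
    convert this using 1
    simp only [neg_smul, one_smul]
    abel

/-- Sorting by adjacent swaps: each one costs a nonzero scalar and terms of lower degree. The prefix
`u` is kept arbitrary to absorb the letters fixed by `List.Perm.cons`. -/
theorem IsPBWAlgebra.sortable_perm (h : IsPBWAlgebra x m q) {γ : Fin n →₀ ℕ}
    (ih : ∀ γ', m.toSyn γ' < m.toSyn γ → Sortable k x m γ') {l l' : List (Fin n)}
    (hl : l.Perm l') : ∀ u : List (Fin n), weight (u ++ l) = γ → ∃ c : k, c ≠ 0 ∧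
      ((u ++ l).map x).prod - c • ((u ++ l').map x).prod ∈ lower k x m γ := by
  induction hl with
  | nil => exact fun u _ => ⟨1, one_ne_zero, by simp⟩
  | cons a _ ihl =>
    intro u hu
    have := ihl (u ++ [a])
    simp only [List.append_assoc, List.singleton_append] at this
    exact this hu
  | swap j i l =>
    intro u hu
    obtain ⟨c, hc, hmem⟩ := h.exists_swap i j
    refine ⟨c, hc, ?_⟩
    have hw : weight u + (single i 1 + single j 1) + weight l = γ := by
      rw [← hu, ← List.singleton_append, ← List.singleton_append (l := l), weight_append,
        weight_append, weight_append, ← List.replicate_one, ← List.replicate_one,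
        weight_replicate, weight_replicate, add_assoc, add_assoc]
    convert mul_lower_mul_mem ih u l hw hmem using 1
    simp [mul_sub, sub_mul, mul_assoc]
  | trans h1 _ ih1 ih2 =>
    intro u hu
    obtain ⟨c, hc, hmem⟩ := ih1 u hu
    obtain ⟨d, hd, hmem'⟩ := ih2 u
      (by rw [← hu, weight_append, weight_append, perm_iff_weight_eq.1 h1])
    refine ⟨c * d, mul_ne_zero hc hd, ?_⟩
    have := add_mem hmem ((lower k x m γ).smul_mem c hmem')
    rwa [smul_sub, smul_smul, sub_add_sub_cancel] at this

theorem IsPBWAlgebra.sortable (h : IsPBWAlgebra x m q) (γ : Fin n →₀ ℕ) : Sortable k x m γ := by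
  obtain ⟨ω, rfl⟩ := m.toSyn.symm.surjective γ
  induction ω using WellFoundedLT.induction with
  | ind ω ih =>
    intro l hl
    obtain ⟨c, hc, hmem⟩ := h.sortable_perm (γ := m.toSyn.symm ω)
      (fun γ' hγ' => by
        have := ih (m.toSyn γ') (by simpa using hγ')
        rwa [m.toSyn.symm_apply_apply] at this)
      (l' := word (m.toSyn.symm ω)) (perm_iff_weight_eq.2 (hl.trans (weight_word _).symm)) [] hl
    exact ⟨c, hc, by simpa only [List.nil_append, ← monomial_eq] using hmem⟩

theorem IsPBWAlgebra.exists_monomial_mul (h : IsPBWAlgebra x m q) (α β : Fin n →₀ ℕ) :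
    ∃ c : k, c ≠ 0 ∧
      monomial x α * monomial x β - c • monomial x (α + β) ∈ lower k x m (α + β) := by
  obtain ⟨c, hc, hmem⟩ := h.sortable (α + β) (word α ++ word β)
    (by rw [weight_append, weight_word, weight_word])
  rw [List.map_append, List.prod_append, ← monomial_eq, ← monomial_eq] at hmem
  exact ⟨c, hc, hmem⟩

/-! ### Powers in the braided center -/

theorem of_filter_ne_zero {α : Fin n →₀ ℕ} {p : Fin n → Prop} [DecidablePred p] {i : Fin n}
    (h : α.filter p i ≠ 0) : p i :=
  by_contra fun hn => h (filter_apply_neg p α hn)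

theorem MemBraidedCenter.exists_mul_comm {a : Fin n →₀ ℕ} (h : MemBraidedCenter x q a)
    (b : Fin n →₀ ℕ) :
    ∃ c : k, c ≠ 0 ∧ monomial x a * monomial x b = c • (monomial x b * monomial x a) :=
  ⟨_, Units.ne_zero _, sub_eq_zero.1 (h b)⟩

/-- Split `x^β` after the letter `j` and commute the power past the later letters only. No lower
terms arise, unlike for general products of monomials. -/
theorem MemBraidedCenter.exists_monomial_mul {j : Fin n} {N : ℕ}
    (h : MemBraidedCenter x q (single j N)) (β : Fin n →₀ ℕ) : ∃ c : k, c ≠ 0 ∧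
      monomial x (β + single j N) = c • (monomial x β * monomial x (single j N)) := by
  obtain ⟨c, hc, e⟩ := h.exists_mul_comm (β.filter (j < ·))
  refine ⟨c, hc, ?_⟩
  have hβ : β.filter (¬ j < ·) + β.filter (j < ·) = β := by
    rw [add_comm]
    exact filter_add_filter_not β _
  have h1 : monomial x β = monomial x (β.filter (¬ j < ·)) * monomial x (β.filter (j < ·)) := by
    rw [← monomial_add, hβ]
    intro i l hi hl
    exact (not_lt.1 (of_filter_ne_zero hi)).trans (of_filter_ne_zero hl).le
  have h2 : β + single j N = β.filter (¬ j < ·) + single j N + β.filter (j < ·) := by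
    conv_lhs => rw [← hβ]
    rw [add_right_comm]
  rw [h1, h2, monomial_add, monomial_add, mul_assoc, e, mul_smul_comm, mul_assoc]
  · intro i l hi hl
    rw [single_apply_ne_zero] at hl
    rw [hl.1]
    exact not_lt.1 (of_filter_ne_zero hi)
  · intro i l hi hl
    refine le_trans ?_ (of_filter_ne_zero hl).le
    by_contra hlt
    refine hi ?_
    rw [Finsupp.add_apply, filter_apply_neg (fun l => ¬ j < l) β (not_not.2 (not_le.1 hlt)),
      single_eq_of_ne (not_le.1 hlt).ne', add_zero]

/-! ### The ideal generated by powers in the braided center -/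

variable (k x) in
/-- The span of the ordered monomials that are divisible by one of the powers `x i ^ N i`. -/
def outer (N : Fin n → ℕ) : Submodule k B :=
  Submodule.span k (monomial x '' {γ | ¬ Anick.Box N γ})

section Outer

variable {N : Fin n → ℕ}

theorem monomial_mem_outer {γ : Fin n →₀ ℕ} (h : ¬ Anick.Box N γ) : monomial x γ ∈ outer k x N :=
  Submodule.subset_span (Set.mem_image_of_mem _ h)

theorem exists_eq_add_single {γ : Fin n →₀ ℕ} (h : ¬ Anick.Box N γ) :
    ∃ (j : Fin n) (β : Fin n →₀ ℕ), N j ≠ 0 ∧ γ = β + single j (N j) := by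
  simp only [Anick.Box, not_forall, not_or, not_lt] at h
  obtain ⟨j, hj, hle⟩ := h
  exact ⟨j, γ - single j (N j), hj, (tsub_add_cancel_of_le (single_le_iff.2 hle)).symm⟩

theorem not_box_add_single {j : Fin n} (hj : N j ≠ 0) (β : Fin n →₀ ℕ) :
    ¬ Anick.Box N (β + single j (N j)) := by
  intro h
  rcases h j with h | h
  · exact hj h
  · simp at h

/-- Since `x^β` times a central power is exactly a scalar multiple of one monomial, the span of
non-box monomials contains every left multiple of the powers. -/
theorem mul_power_mem_outer (h : IsPBWAlgebra x m q)
    (hc : ∀ j, N j ≠ 0 → MemBraidedCenter x q (single j (N j))) {j : Fin n} (hj : N j ≠ 0) (b : B) :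
    b * monomial x (single j (N j)) ∈ outer k x N := by
  have hb : b ∈ Submodule.span k (Set.range (monomial x)) := h.span_eq_top ▸ Submodule.mem_top
  induction hb using Submodule.span_induction with
  | mem _ hb =>
    obtain ⟨β, rfl⟩ := hb
    obtain ⟨c, hc0, e⟩ := (hc j hj).exists_monomial_mul β
    rw [← inv_smul_smul₀ hc0 (monomial x β * _), ← e]
    exact Submodule.smul_mem _ _ (monomial_mem_outer (not_box_add_single hj β))
  | zero => simp
  | add b b' _ _ hb hb' =>
    rw [add_mul]
    exact add_mem hb hb'
  | smul c b _ hb =>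
    rw [smul_mul_assoc]
    exact Submodule.smul_mem _ c hb

/-- To prove a linear property of the elements of `outer k x N` it suffices to check the multiples
of the powers. -/
theorem outer_induction (hc : ∀ j, N j ≠ 0 → MemBraidedCenter x q (single j (N j)))
    (V : Submodule k B)
    (hV : ∀ j, N j ≠ 0 → ∀ β, monomial x β * monomial x (single j (N j)) ∈ V) : outer k x N ≤ V := by
  refine Submodule.span_le.2 ?_
  rintro _ ⟨γ, hγ, rfl⟩
  obtain ⟨j, β, hj, rfl⟩ := exists_eq_add_single hγ
  obtain ⟨c, -, e⟩ := (hc j hj).exists_monomial_mul β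
  rw [e]
  exact V.smul_mem c (hV j hj β)

theorem mul_mem_outer_left (h : IsPBWAlgebra x m q)
    (hc : ∀ j, N j ≠ 0 → MemBraidedCenter x q (single j (N j))) (b : B) {c : B}
    (hmem : c ∈ outer k x N) : b * c ∈ outer k x N := by
  refine outer_induction hc ((outer k x N).comap (LinearMap.mulLeft k b)) (fun j hj β => ?_) hmem
  change b * (_ * _) ∈ outer k x N
  rw [← mul_assoc]
  exact mul_power_mem_outer h hc hj _

theorem mul_mem_outer_right (h : IsPBWAlgebra x m q)
    (hc : ∀ j, N j ≠ 0 → MemBraidedCenter x q (single j (N j))) (b : B) {c : B}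
    (hmem : c ∈ outer k x N) : c * b ∈ outer k x N := by
  refine outer_induction hc ((outer k x N).comap (LinearMap.mulRight k b)) (fun j hj β => ?_) hmem
  change _ * _ * b ∈ outer k x N
  have hb : b ∈ Submodule.span k (Set.range (monomial x)) := h.span_eq_top ▸ Submodule.mem_top
  induction hb using Submodule.span_induction with
  | mem _ hb =>
    obtain ⟨γ, rfl⟩ := hb
    obtain ⟨d, -, e⟩ := (hc j hj).exists_mul_comm γ
    rw [mul_assoc, e, mul_smul_comm, ← mul_assoc]
    exact Submodule.smul_mem _ _ (mul_power_mem_outer h hc hj _)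
  | zero => simp
  | add b b' _ _ hb hb' =>
    rw [mul_add]
    exact add_mem hb hb'
  | smul c b _ hb =>
    rw [mul_smul_comm]
    exact Submodule.smul_mem _ c hb

end Outer

end PBW

namespace PBW

open Finsupp

/-! ### The quotient by powers in the braided center -/

variable {k B : Type*} [Field k] [Ring B] [Algebra k B] {n : ℕ} {x : Fin n → B}
  {m : MonomialOrder.{0, o} (Fin n)} {q : Fin n → Fin n → kˣ} {N : Fin n → ℕ}

/-- The basis of ordered monomials. -/
def IsPBWAlgebra.basis (h : IsPBWAlgebra x m q) : Module.Basis (Fin n →₀ ℕ) k B :=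
  Module.Basis.mk h.linearIndependent h.span_eq_top.ge

theorem IsPBWAlgebra.basis_apply (h : IsPBWAlgebra x m q) (α : Fin n →₀ ℕ) :
    h.basis α = monomial x α :=
  Module.Basis.mk_apply _ _ α

theorem IsPBWAlgebra.coord_monomial (h : IsPBWAlgebra x m q) (α β : Fin n →₀ ℕ) :
    h.basis.coord β (monomial x α) = if β = α then 1 else 0 := by
  rw [← h.basis_apply, Module.Basis.coord_apply, Module.Basis.repr_self, single_apply]
  simp only [eq_comm]

theorem IsPBWAlgebra.mem_span (h : IsPBWAlgebra x m q) (b : B) :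
    b ∈ Submodule.span k (Set.range (monomial x)) :=
  h.span_eq_top ▸ Submodule.mem_top

open Classical in
/-- The projection to the span of the monomials in the box. -/
def IsPBWAlgebra.trunc (h : IsPBWAlgebra x m q) (N : Fin n → ℕ) : B →ₗ[k] B :=
  h.basis.constr k fun α => if Anick.Box N α then monomial x α else 0

theorem IsPBWAlgebra.trunc_monomial (h : IsPBWAlgebra x m q) {α : Fin n →₀ ℕ}
    (hα : Anick.Box N α) : h.trunc N (monomial x α) = monomial x α := by
  rw [trunc, ← h.basis_apply, Module.Basis.constr_basis, if_pos hα, h.basis_apply]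

theorem IsPBWAlgebra.trunc_monomial_of_not_box (h : IsPBWAlgebra x m q) {α : Fin n →₀ ℕ}
    (hα : ¬ Anick.Box N α) : h.trunc N (monomial x α) = 0 := by
  rw [trunc, ← h.basis_apply, Module.Basis.constr_basis, if_neg hα]

theorem IsPBWAlgebra.trunc_eq_zero (h : IsPBWAlgebra x m q) {b : B} (hb : b ∈ outer k x N) :
    h.trunc N b = 0 := by
  refine (Submodule.span_le (p := LinearMap.ker (h.trunc N))).2 ?_ hb
  rintro _ ⟨γ, hγ, rfl⟩
  exact h.trunc_monomial_of_not_box hγ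

theorem IsPBWAlgebra.sub_trunc_mem (h : IsPBWAlgebra x m q) (b : B) :
    b - h.trunc N b ∈ outer k x N := by
  induction h.mem_span b using Submodule.span_induction with
  | mem _ hb =>
    obtain ⟨α, rfl⟩ := hb
    by_cases hα : Anick.Box N α
    · rw [h.trunc_monomial hα, sub_self]
      exact zero_mem _
    · rw [h.trunc_monomial_of_not_box hα, sub_zero]
      exact monomial_mem_outer hα
  | zero => simp
  | add b b' _ _ hb hb' =>
    rw [map_add, add_sub_add_comm]
    exact add_mem hb hb'
  | smul c b _ hb =>
    rw [LinearMap.map_smul, ← smul_sub]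
    exact Submodule.smul_mem _ c hb

theorem IsPBWAlgebra.coord_trunc (h : IsPBWAlgebra x m q) {β : Fin n →₀ ℕ} (hβ : ¬ Anick.Box N β)
    (b : B) : h.basis.coord β (h.trunc N b) = 0 := by
  induction h.mem_span b using Submodule.span_induction with
  | mem _ hb =>
    obtain ⟨α, rfl⟩ := hb
    by_cases hα : Anick.Box N α
    · rw [h.trunc_monomial hα, h.coord_monomial, if_neg]
      rintro rfl
      exact hβ hα
    · rw [h.trunc_monomial_of_not_box hα, map_zero]
  | zero => simp
  | add b b' _ _ hb hb' => rw [map_add, map_add, hb, hb', add_zero]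
  | smul c b _ hb => rw [LinearMap.map_smul, LinearMap.map_smul, hb, smul_zero]

theorem map_monomial_eq_zero {A : Type*} [Ring A] [Algebra k A] (e : B →ₐ[k] A)
    (he : ∀ j, e (x j) = 0) {α : Fin n →₀ ℕ} (hα : α ≠ 0) : e (monomial x α) = 0 := by
  obtain ⟨j, hj⟩ := Finsupp.ne_iff.1 hα
  obtain ⟨u, v, huv⟩ := List.append_of_mem (mem_word.2 hj)
  rw [monomial_eq, huv]
  simp [he]

variable {A : Type*} [Ring A] [Algebra k A] {π : B →ₐ[k] A}

theorem map_mem_span_of_mem_lower (π : B →ₐ[k] A) {γ : Fin n →₀ ℕ} {b : B}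
    (hb : b ∈ lower k x m γ) : π b ∈
      Submodule.span k ((fun α => π (monomial x α)) '' {α | m.toSyn α < m.toSyn γ}) := by
  have h := Submodule.mem_map_of_mem (f := π.toLinearMap) hb
  rw [lower, Submodule.map_span, ← Set.image_comp] at h
  exact h

/-- The representative of an element of the quotient in the span of the monomials in the box. -/
def IsPBWAlgebra.normalForm (h : IsPBWAlgebra x m q) (N : Fin n → ℕ)
    (hπ : Function.Surjective π) : A →ₗ[k] B :=
  h.trunc N ∘ₗ (π.toLinearMap.exists_rightInverse_of_surjective
    (LinearMap.range_eq_top.2 hπ)).choose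

theorem IsPBWAlgebra.normalForm_apply (h : IsPBWAlgebra x m q) (hπ : Function.Surjective π)
    (hker : ∀ b, π b = 0 ↔ b ∈ outer k x N) (b : B) :
    h.normalForm N hπ (π b) = h.trunc N b := by
  set g := (π.toLinearMap.exists_rightInverse_of_surjective (LinearMap.range_eq_top.2 hπ)).choose
    with hg
  have e : π (g (π b)) = π b := LinearMap.congr_fun
    (π.toLinearMap.exists_rightInverse_of_surjective (LinearMap.range_eq_top.2 hπ)).choose_spec (π b)
  have hmem : g (π b) - b ∈ outer k x N := by rw [← hker, map_sub, e, sub_self]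
  have := h.trunc_eq_zero hmem
  rw [map_sub, sub_eq_zero] at this
  exact this

theorem IsPBWAlgebra.normalForm_monomial (h : IsPBWAlgebra x m q) (hπ : Function.Surjective π)
    (hker : ∀ b, π b = 0 ↔ b ∈ outer k x N) {α : Fin n →₀ ℕ} (hα : Anick.Box N α) :
    h.normalForm N hπ (π (monomial x α)) = monomial x α := by
  rw [h.normalForm_apply hπ hker, h.trunc_monomial hα]

theorem IsPBWAlgebra.map_normalForm (h : IsPBWAlgebra x m q) (hπ : Function.Surjective π)
    (hker : ∀ b, π b = 0 ↔ b ∈ outer k x N) (a : A) : π (h.normalForm N hπ a) = a := by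
  obtain ⟨b, rfl⟩ := hπ a
  have := (hker _).2 (h.sub_trunc_mem (N := N) b)
  rw [map_sub, sub_eq_zero] at this
  rw [h.normalForm_apply hπ hker, this]

theorem IsPBWAlgebra.normalForm_mul_sub_mem (h : IsPBWAlgebra x m q) (hπ : Function.Surjective π)
    (hker : ∀ b, π b = 0 ↔ b ∈ outer k x N) (a b : A) :
    h.normalForm N hπ a * h.normalForm N hπ b - h.normalForm N hπ (a * b) ∈ outer k x N := by
  rw [← hker, map_sub, map_mul, h.map_normalForm hπ hker, h.map_normalForm hπ hker,
    h.map_normalForm hπ hker, sub_self]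

/-- The basis of truncated monomials of the quotient of a PBW algebra. -/
def IsPBWAlgebra.monomialAlgebra (h : IsPBWAlgebra x m q) (hπ : Function.Surjective π)
    (hker : ∀ b, π b = 0 ↔ b ∈ outer k x N) (ε : A →ₐ[k] k) (hε : ∀ j, ε (π (x j)) = 0) :
    Anick.MonomialAlgebra k A m N where
  mon α := π (monomial x α)
  coeff β := h.basis.coord β ∘ₗ h.normalForm N hπ
  ε := ε
  lc α β := (h.exists_monomial_mul α β).choose
  mon_zero := by rw [monomial_zero, map_one]
  mon_eq_zero α hα := (hker _).2 (monomial_mem_outer hα)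
  span_eq_top := by
    have := congrArg (Submodule.map π.toLinearMap) h.span_eq_top
    rw [Submodule.map_span, ← Set.range_comp, Submodule.map_top, LinearMap.range_eq_top.2 hπ] at this
    exact this
  coeff_mon α β hα := by
    rw [LinearMap.comp_apply, h.normalForm_monomial hπ hker hα, h.coord_monomial]
  lc_ne_zero α β := (h.exists_monomial_mul α β).choose_spec.1
  mul_mem α β := by
    have := map_mem_span_of_mem_lower π (h.exists_monomial_mul α β).choose_spec.2
    simpa using this
  aug_mon α hα := map_monomial_eq_zero (ε.comp π) hε hα

/-! ### The cocycle that detects a truncation -/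

/-- The coefficient of the power `x i ^ N i`. -/
def IsPBWAlgebra.powerCoeff (h : IsPBWAlgebra x m q) (N : Fin n → ℕ) (i : Fin n) : B →ₗ[k] k :=
  h.basis.coord (single i (N i))

theorem IsPBWAlgebra.coord_monomial_mul_eq_zero (h : IsPBWAlgebra x m q) {α β γ : Fin n →₀ ℕ}
    (hγ : m.toSyn (α + β) < m.toSyn γ) :
    h.basis.coord γ (monomial x α * monomial x β) = 0 := by
  obtain ⟨c, -, hmem⟩ := h.exists_monomial_mul α β
  have hmem := add_mem (lower_mono hγ.le hmem)
    ((lower k x m γ).smul_mem c (monomial_mem_lower hγ))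
  rw [sub_add_cancel] at hmem
  refine (Submodule.span_le (p := LinearMap.ker (h.basis.coord γ))).2 ?_ hmem
  rintro _ ⟨δ, hδ, rfl⟩
  refine (h.coord_monomial δ γ).trans (if_neg ?_)
  rintro rfl
  exact lt_irrefl _ hδ

/-- Up to a scalar, `x^β` times `x j ^ N j` is a single monomial, and it equals `x i ^ N i` only for
`β = 0` and `i = j`. -/
theorem IsPBWAlgebra.powerCoeff_mul_power (h : IsPBWAlgebra x m q) {i j : Fin n} (hj : N j ≠ 0)
    (hc : MemBraidedCenter x q (single j (N j))) (e : B →ₐ[k] k) (he : ∀ j, e (x j) = 0) (b : B) :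
    h.powerCoeff N i (b * monomial x (single j (N j))) = e b * if i = j then 1 else 0 := by
  induction h.mem_span b using Submodule.span_induction with
  | mem _ hb =>
    obtain ⟨β, rfl⟩ := hb
    by_cases hβ : β = 0
    · rw [hβ, monomial_zero, one_mul, map_one, one_mul, powerCoeff, h.coord_monomial]
      by_cases hij : i = j
      · rw [hij]
        simp
      · rw [if_neg hij, if_neg fun e => hij ?_]
        have := DFunLike.congr_fun e j
        by_contra hij
        rw [single_eq_same, single_eq_of_ne (Ne.symm hij)] at this
        exact hj this.symm
    · obtain ⟨c, hc0, e1⟩ := hc.exists_monomial_mul β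
      rw [map_monomial_eq_zero e he hβ, zero_mul, ← inv_smul_smul₀ hc0 (monomial x β * _), ← e1,
        LinearMap.map_smul, powerCoeff, h.coord_monomial, if_neg, smul_zero]
      intro e2
      by_cases hij : i = j
      · rw [hij] at e2
        exact hβ (add_eq_right.1 e2.symm)
      · have := DFunLike.congr_fun e2 j
        rw [Finsupp.add_apply, single_eq_same, single_eq_of_ne (Ne.symm hij)] at this
        omega
  | zero => simp
  | add b b' _ _ hb hb' => rw [add_mul, map_add, hb, hb', map_add, add_mul]
  | smul c b _ hb =>
    rw [smul_mul_assoc, LinearMap.map_smul, hb, map_smul, smul_eq_mul, smul_eq_mul, mul_assoc]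

/-- On the ideal of powers the coefficient is a bimodule map to the trivial module. This is what
turns the defect of the normal form into a cocycle. -/
theorem IsPBWAlgebra.powerCoeff_mul_left (h : IsPBWAlgebra x m q) (i : Fin n)
    (hc : ∀ j, N j ≠ 0 → MemBraidedCenter x q (single j (N j))) (e : B →ₐ[k] k)
    (he : ∀ j, e (x j) = 0) (b : B) {c : B} (hmem : c ∈ outer k x N) :
    h.powerCoeff N i (b * c) = e b * h.powerCoeff N i c := by
  have := outer_induction hc (LinearMap.eqLocus (h.powerCoeff N i ∘ₗ LinearMap.mulLeft k b)
    (e b • h.powerCoeff N i)) (fun j hj β => ?_) hmem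
  · exact this
  · change h.powerCoeff N i (b * (_ * _)) = e b * h.powerCoeff N i _
    rw [← mul_assoc, h.powerCoeff_mul_power hj (hc j hj) e he,
      h.powerCoeff_mul_power hj (hc j hj) e he, map_mul, mul_assoc]

theorem IsPBWAlgebra.powerCoeff_mul_right (h : IsPBWAlgebra x m q) (i : Fin n)
    (hc : ∀ j, N j ≠ 0 → MemBraidedCenter x q (single j (N j))) (e : B →ₐ[k] k)
    (he : ∀ j, e (x j) = 0) (b : B) {c : B} (hmem : c ∈ outer k x N) :
    h.powerCoeff N i (c * b) = e b * h.powerCoeff N i c := by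
  have := outer_induction hc (LinearMap.eqLocus (h.powerCoeff N i ∘ₗ LinearMap.mulRight k b)
    (e b • h.powerCoeff N i)) (fun j hj β => ?_) hmem
  · exact this
  · change h.powerCoeff N i (_ * _ * b) = e b * h.powerCoeff N i _
    induction h.mem_span b using Submodule.span_induction with
    | mem _ hb =>
      obtain ⟨γ, rfl⟩ := hb
      by_cases hγ : γ = 0
      · rw [hγ, monomial_zero, mul_one, map_one, one_mul]
      · obtain ⟨d, -, e1⟩ := (hc j hj).exists_mul_comm γ
        rw [mul_assoc, e1, mul_smul_comm, ← mul_assoc, LinearMap.map_smul,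
          h.powerCoeff_mul_power hj (hc j hj) e he, map_mul, map_monomial_eq_zero e he hγ]
        simp
    | zero => simp
    | add b b' _ _ hb hb' => rw [mul_add, map_add, hb, hb', map_add, add_mul]
    | smul c b _ hb =>
      rw [mul_smul_comm, LinearMap.map_smul, hb, map_smul, smul_eq_mul, smul_eq_mul, mul_assoc]

/-- The Hochschild cocycle measuring the failure of the normal form to be multiplicative at the
power `x i ^ N i`. -/
def IsPBWAlgebra.powerCocycle (h : IsPBWAlgebra x m q) (hN : ∀ i, N i ≠ 1)
    (hc : ∀ j, N j ≠ 0 → MemBraidedCenter x q (single j (N j))) (hπ : Function.Surjective π)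
    (hker : ∀ b, π b = 0 ↔ b ∈ outer k x N) (ε : A →ₐ[k] k) (hε : ∀ j, ε (π (x j)) = 0)
    (i : Fin n) (hi : N i ≠ 0) : (h.monomialAlgebra hπ hker ε hε).PowerCocycle i where
  μ := ((LinearMap.mul k B).compl₁₂ (h.normalForm N hπ) (h.normalForm N hπ)).compr₂
    (h.powerCoeff N i)
  cocycle a b c := by
    have hs : ∀ a, ε (π (h.normalForm N hπ a)) = ε a := fun a => by rw [h.map_normalForm hπ hker]
    have h0 : ∀ a, h.powerCoeff N i (h.normalForm N hπ a) = 0 := fun a =>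
      h.coord_trunc (fun hb => not_box_add_single hi 0 (by rwa [zero_add])) _
    -- The coefficient of the triple product of normal forms is expanded with either bracketing.
    -- Normal forms themselves contain no `x i ^ N i`, so the terms in `h0` drop out.
    have h1 := h.powerCoeff_mul_left i hc (ε.comp π) hε (h.normalForm N hπ a)
      (h.normalForm_mul_sub_mem hπ hker b c)
    have h2 := h.powerCoeff_mul_right i hc (ε.comp π) hε (h.normalForm N hπ c)
      (h.normalForm_mul_sub_mem hπ hker a b)
    rw [mul_sub, map_sub, map_sub, h0, sub_zero, AlgHom.comp_apply, hs, ← mul_assoc] at h1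
    rw [sub_mul, map_sub, map_sub, h0, sub_zero, AlgHom.comp_apply, hs] at h2
    change ε a * h.powerCoeff N i (h.normalForm N hπ b * h.normalForm N hπ c) +
      h.powerCoeff N i (h.normalForm N hπ a * h.normalForm N hπ (b * c)) =
      h.powerCoeff N i (h.normalForm N hπ a * h.normalForm N hπ b) * ε c +
      h.powerCoeff N i (h.normalForm N hπ (a * b) * h.normalForm N hπ c)
    rw [← h1, mul_comm _ (ε c), ← h2]
    ring
  le_of_ne_zero α β hne := by
    by_contra hlt
    refine hne ?_
    change h.powerCoeff N i (h.normalForm N hπ (π (monomial x α)) *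
      h.normalForm N hπ (π (monomial x β))) = 0
    rw [h.normalForm_apply hπ hker, h.normalForm_apply hπ hker]
    by_cases hα : Anick.Box N α
    · by_cases hβ : Anick.Box N β
      · rw [h.trunc_monomial hα, h.trunc_monomial hβ]
        exact h.coord_monomial_mul_eq_zero (not_le.1 hlt)
      · rw [h.trunc_monomial_of_not_box hβ, mul_zero, map_zero]
    · rw [h.trunc_monomial_of_not_box hα, zero_mul, map_zero]
  ne_zero := by
    have h1 := hN i
    have hb : ∀ a, a < N i → Anick.Box N (single i a) := fun a ha j => by
      by_cases hij : j = i
      · subst hij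
        right
        rwa [single_eq_same]
      · rw [single_eq_of_ne hij]
        omega
    change h.powerCoeff N i (h.normalForm N hπ (π (monomial x (single i (N i - 1)))) *
      h.normalForm N hπ (π (monomial x (single i 1)))) ≠ 0
    rw [h.normalForm_monomial hπ hker (hb _ (by omega)),
      h.normalForm_monomial hπ hker (hb _ (by omega)), monomial_single, monomial_single, ← pow_add,
      Nat.sub_add_cancel (by omega), ← monomial_single, powerCoeff, h.coord_monomial, if_pos rfl]
    exact one_ne_zero

end PBW

/-! ### Identification of the ideal of powers and the final theorem. -/

namespace PBW

open Finsupp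

variable {k B : Type*} [Field k] [Ring B] [Algebra k B] {n t : ℕ} {x : Fin n → B}
  {m : MonomialOrder.{0, o} (Fin n)} {q : Fin n → Fin n → kˣ}

/-- The truncations of all the generators; the value `0` means no truncation. -/
def truncation (N : Fin t → ℕ) (j : Fin n) : ℕ := if hj : (j : ℕ) < t then N ⟨j, hj⟩ else 0

theorem truncation_castLE (ht : t ≤ n) (N : Fin t → ℕ) (i : Fin t) :
    truncation N (Fin.castLE ht i) = N i := dif_pos i.2

theorem exists_castLE_of_truncation_ne_zero (ht : t ≤ n) {N : Fin t → ℕ} {j : Fin n}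
    (h : truncation N j ≠ 0) : ∃ i, Fin.castLE ht i = j := by
  by_cases hj : (j : ℕ) < t
  · exact ⟨⟨j, hj⟩, rfl⟩
  · exact absurd (dif_neg hj) h

/-- The span of the non-box monomials is itself a two-sided ideal containing the powers, and it is
spanned by left multiples of them. -/
theorem mem_powerIdeal_iff (h : IsPBWAlgebra x m q) (ht : t ≤ n) {N : Fin t → ℕ}
    (hN : ∀ i, 1 < N i)
    (hc : ∀ j : Fin n, truncation N j ≠ 0 → MemBraidedCenter x q (single j (truncation N j)))
    (b : B) : b ∈ powerIdeal ht x N ↔ b ∈ outer k x (truncation N) := by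
  constructor
  · intro hb
    let I : TwoSidedIdeal B := TwoSidedIdeal.mk' (outer k x (truncation N)) (zero_mem _)
      (fun h h' => add_mem h h') (fun h => neg_mem h) (fun h' => mul_mem_outer_left h hc _ h')
      (fun h' => mul_mem_outer_right h hc _ h')
    have : b ∈ I := by
      refine TwoSidedIdeal.mem_span_iff.1 hb I ?_
      rintro _ ⟨i, rfl⟩
      refine (TwoSidedIdeal.mem_mk' _ _ _ _ _ _ _).2 ?_
      have hi : truncation N (Fin.castLE ht i) ≠ 0 := by
        rw [truncation_castLE]
        exact (zero_lt_one.trans (hN i)).ne'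
      have := monomial_mem_outer (k := k) (x := x) (not_box_add_single hi 0)
      rwa [zero_add, monomial_single, truncation_castLE] at this
    exact (TwoSidedIdeal.mem_mk' _ _ _ _ _ _ _).1 this
  · have hs : ∀ (c : k) {b : B}, b ∈ powerIdeal ht x N → c • b ∈ powerIdeal ht x N := fun c b hb => by
      rw [← one_mul b, ← smul_mul_assoc]
      exact TwoSidedIdeal.mul_mem_left _ _ _ hb
    let V : Submodule k B :=
      { carrier := powerIdeal ht x N
        zero_mem' := TwoSidedIdeal.zero_mem _
        add_mem' := fun h h' => TwoSidedIdeal.add_mem _ h h'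
        smul_mem' := fun c _ h => hs c h }
    refine fun hb => outer_induction hc V (fun j hj β => ?_) hb
    obtain ⟨i, rfl⟩ := exists_castLE_of_truncation_ne_zero ht hj
    refine TwoSidedIdeal.mul_mem_left _ _ _ ?_
    rw [monomial_single, truncation_castLE]
    exact TwoSidedIdeal.subset_span ⟨i, rfl⟩

/-- The quotient map, as a homomorphism of `k`-algebras. -/
def quotientMap (ht : t ≤ n) (x : Fin n → B) (N : Fin t → ℕ) : B →ₐ[k] PowerQuotient ht x N :=
  { (powerIdeal ht x N).ringCon.mk' with commutes' := fun _ => rfl }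

end PBW

theorem mainTheorem1 {k B : Type u} [Field k] [Ring B] [Algebra k B]
    {n t : ℕ} (ht : t ≤ n)
    (x : Fin n → B) (m : MonomialOrder.{0, o} (Fin n)) (q : Fin n → Fin n → kˣ)
    (hB : PBW.IsPBWAlgebra x m q)
    (N : Fin t → ℕ) (hN : ∀ i, 1 < N i)
    (hcentral : ∀ i : Fin t,
      PBW.MemBraidedCenter x q (Finsupp.single (Fin.castLE ht i) (N i)))
    (ε : PBW.PowerQuotient ht x N →ₐ[k] k)
    (hε : ∀ j : Fin n, ε (PBW.PowerQuotient.mk ht x N (x j)) = 0) :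
    Algebra.FiniteType k (CohomologyAlgebra ε) := by
  have hc : ∀ j : Fin n, PBW.truncation N j ≠ 0 →
      PBW.MemBraidedCenter x q (Finsupp.single j (PBW.truncation N j)) := fun j hj => by
    obtain ⟨i, rfl⟩ := PBW.exists_castLE_of_truncation_ne_zero ht hj
    rw [PBW.truncation_castLE]
    exact hcentral i
  have hN1 : ∀ j : Fin n, PBW.truncation N j ≠ 1 := fun j hj => by
    obtain ⟨i, rfl⟩ := PBW.exists_castLE_of_truncation_ne_zero ht (hj ▸ one_ne_zero)
    rw [PBW.truncation_castLE] at hj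
    exact (hN i).ne' hj
  have hπ : Function.Surjective (PBW.quotientMap (k := k) ht x N) :=
    (PBW.powerIdeal ht x N).ringCon.mk'_surjective
  have hker : ∀ b, PBW.quotientMap (k := k) ht x N b = 0 ↔ b ∈ PBW.outer k x (PBW.truncation N) :=
    fun b => by
      rw [← PBW.mem_powerIdeal_iff hB ht hN hc, TwoSidedIdeal.mem_iff]
      exact RingCon.eq _
  exact (hB.monomialAlgebra hπ hker ε hε).finiteType_cohomology hN1
    (hB.powerCocycle hN1 hc hπ hker ε hε)

end
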